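/- **Setting.** Let $0<q<1$ and $[N]=(q^{-N}-q^{N})/(q^{-1}-q)$. Let $\mathcal H$ be the Hilbert space with orthonormal basis $v^j_{x,y,s}$, where $2j=0,1,2,\dots$, $0\le x\le 2j$, $s\in\{\uparrow,\downarrow\}$, $0\le y\le 2j+1$ if $s=\uparrow$ and $0\le y\le 2j-1$ if $s=\downarrow$ (vectors with labels out of range are $0$). Put $p_\uparrow=q^{(x+y-2j-1)/2}$, $p_\downarrow=q^{(x+y-2j)/2}$ and define $$\begin{aligned} a_+v^j_{x,y,\uparrow}&=p_\uparrow[x{+}1]^{\frac12}\Big(\tfrac{q^{-j-1/2}[y+1]^{1/2}}{[2j+2]}v^{j+1/2}_{x+1,y+1,\uparrow}+\tfrac{q^{1/2}[2j-y+1]^{1/2}}{[2j+1][2j+2]}v^{j+1/2}_{x+1,y,\downarrow}\Big),\\ a_+v^j_{x,y,\downarrow}&=p_\downarrow[x{+}1]^{\frac12}\tfrac{q^{-j}[y+1]^{1/2}}{[2j+1]}v^{j+1/2}_{x+1,y+1,\downarrow},\\ a_-v^j_{x,y,\uparrow}&=p_\uparrow[2j{-}x]^{\frac12}\tfrac{q^{j+1}[2j-y+1]^{1/2}}{[2j+1]}v^{j-1/2}_{x,y,\uparrow},\\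 a_-v^j_{x,y,\downarrow}&=p_\downarrow[2j{-}x]^{\frac12}\Big(-\tfrac{q^{1/2}[y+1]^{1/2}}{[2j][2j+1]}v^{j-1/2}_{x,y+1,\uparrow}+\tfrac{q^{j+1/2}[2j-y-1]^{1/2}}{[2j]}v^{j-1/2}_{x,y,\downarrow}\Big),\\ b_+v^j_{x,y,\uparrow}&=p_\uparrow[x{+}1]^{\frac12}\Big(\tfrac{[2j-y+2]^{1/2}}{[2j+2]}v^{j+1/2}_{x+1,y,\uparrow}-\tfrac{q^{-j-1}[y]^{1/2}}{[2j+1][2j+2]}v^{j+1/2}_{x+1,y-1,\downarrow}\Big),\\ b_+v^j_{x,y,\downarrow}&=p_\downarrow[x{+}1]^{\frac12}\tfrac{q^{-1/2}[2j-y]^{1/2}}{[2j+1]}v^{j+1/2}_{x+1,y,\downarrow},\\ b_-v^j_{x,y,\uparrow}&=-p_\uparrow[2j{-}x]^{\frac12}\tfrac{q^{-1/2}[y]^{1/2}}{[2j+1]}v^{j-1/2}_{x,y-1,\uparrow},\\ b_-v^j_{x,y,\downarrow}&=-p_\downarrow[2j{-}x]^{\frac12}\Big(\tfrac{q^{j}[2j-y]^{1/2}}{[2j][2j+1]}v^{j-1/2}_{x,y,\uparrow}+\tfrac{[y]^{1/2}}{[2j]}v^{j-1/2}_{x,y-1,\downarrow}\Big).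 \end{aligned}$$ Let $\mathcal A$ be the $*$-algebra generated by $\pi(a)=a_++a_-$ and $\pi(b)=b_++b_-$ (the spinor representation of the coordinate algebra of $SU_q(2)$). Let $Dv^j_{x,y,\uparrow}=(2j+\frac32)v^j_{x,y,\uparrow}$, $Dv^j_{x,y,\downarrow}=-(2j+\frac12)v^j_{x,y,\downarrow}$, $F=D/|D|$, $P^\uparrow=\frac12(1+F)$, $P^\downarrow=\frac12(1-F)$ and $\delta(T)=[|D|,T]$; all these operators act on the linear span of the basis. Let $\mathcal B$ be the algebra generated by all $\delta^k(\mathcal A)$, $\Psi^0$ the algebra generated by all $\delta^k(\mathcal A)$ and $\delta^k([D,\mathcal A])$, $k\ge 0$, and $\Psi^0_P\supseteq\Psi^0$ the algebra generated by $\Psi^0$ and $P^\uparrow$. The dimension spectrum of an algebra of such operators is the set of all poles of the meromorphic continuations of the zeta functions $\zeta_T(z)=\operatorname{Tr}(T|D|^{-z})$ of its elements $T$, and $⨍T:=\operatorname{Res}_{z=0}\operatorname{Tr}(T|D|^{-z})$. On $\ell^2(\mathbb N)$ (basis $\varepsilon_k$, $k\ge0$) let $\pi_\pm(a)\varepsilon_k=\sqrt{1-q^{2k+2}}\,\varepsilon_{k+1}$,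 $\pi_\pm(b)\varepsilon_k=\pm q^k\varepsilon_k$, and let $\mathcal A(D^2_{q\pm})$ be the $*$-algebra generated by $\pi_\pm(a),\pi_\pm(b)$, with these generators written $r_\pm(a),r_\pm(b)$. Let $\mathcal A(S^1)=\mathbb C[u,u^{-1}]$ and let $\sigma:\mathcal A(D^2_{q\pm})\to\mathcal A(S^1)$ be the $*$-homomorphism with $r_\pm(a)\mapsto u$, $r_\pm(b)\mapsto0$. On $\mathcal A(D^2_{q\pm})$ put $\tau_1(x)=\frac1{2\pi}\int_{S^1}\sigma(x)$, $\tau_0^\uparrow(x)=\lim_{N\to\infty}(\operatorname{Tr}_Nx-(N+\frac32)\tau_1(x))$ and $\tau_0^\downarrow(x)=\lim_{N\to\infty}(\operatorname{Tr}_Nx-(N+\frac12)\tau_1(x))$, where $\operatorname{Tr}_Nx=\sum_{k=0}^N\langle\varepsilon_k,x\varepsilon_k\rangle$ (the limits exist). **Theorem.** 1. For every $T\in\Psi^0_P$ (in particular for every $T\in\Psi^0$) the operator $T|D|^{-z}$ is trace class for $\operatorname{Re}z>3$, and $\zeta_T$ extends to a meromorphic function on $\mathbb C$ whose only possible poles are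 at most simple poles at $1,2,3$. The dimension spectrum of $\Psi^0$, and that of $\Psi^0_P$, is exactly $\{1,2,3\}$. 2. There is a unique $*$-homomorphism $\rho:\mathcal B\to\mathcal A(D^2_{q+})\otimes\mathcal A(D^2_{q-})\otimes\mathcal A(S^1)$ which sends, with $\tilde c:=P^\uparrow cP^\uparrow+P^\downarrow cP^\downarrow$, $\tilde a_+\mapsto r_+(a)\otimes r_-(a)\otimes u$, $\tilde a_-\mapsto -q\,r_+(b)\otimes r_-(b^*)\otimes u^*$, $\tilde b_+\mapsto -r_+(a)\otimes r_-(b)\otimes u$, $\tilde b_-\mapsto -r_+(b)\otimes r_-(a^*)\otimes u^*$, and sends $P^\downarrow c_+P^\uparrow+P^\uparrow c_-P^\downarrow$ to $0$ for $c=a,b$. Write $r\rho(T)^0\in\mathcal A(D^2_{q+})\otimes\mathcal A(D^2_{q-})$ for the part of $\rho(T)$ of degree $0$ in $u$. For all $T\in\mathcal B$, $$⨍T|D|^{-3}=2(\tau_1\otimes\tau_1)(r\rho(T)^0),$$ $$⨍T|D|^{-2}=\big(\tau_1\otimes(\tau_0^\uparrow+\tau_0^\downarrow)+(\tau_0^\uparrow+\tau_0^\downarrow)\otimes\tau_1\big)(r\rho(T)^0),$$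 $$⨍T|D|^{-1}=(\tau_0^\uparrow\otimes\tau_0^\downarrow+\tau_0^\downarrow\otimes\tau_0^\uparrow)(r\rho(T)^0).$$ 3. $\rho$ extends uniquely to a homomorphism $(\rho_\uparrow,\rho_\downarrow)$ from $\Psi^0_P$ to pairs of elements of $\mathcal A(D^2_{q+})\otimes\mathcal A(D^2_{q-})\otimes\mathcal A(S^1)$ with $\rho_\uparrow=\rho_\downarrow=\rho$ on $\mathcal B$ and $P^\uparrow\mapsto(1,0)$. For all $T\in\Psi^0_P$, $$⨍T|D|^{-3}=(\tau_1\otimes\tau_1)(r\rho_\uparrow(T)^0)+(\tau_1\otimes\tau_1)(r\rho_\downarrow(T)^0),$$ $$⨍T|D|^{-2}=(\tau_1\otimes\tau_0^\downarrow+\tau_0^\uparrow\otimes\tau_1)(r\rho_\uparrow(T)^0)+(\tau_1\otimes\tau_0^\uparrow+\tau_0^\downarrow\otimes\tau_1)(r\rho_\downarrow(T)^0),$$ $$⨍T|D|^{-1}=(\tau_0^\uparrow\otimes\tau_0^\downarrow)(r\rho_\uparrow(T)^0)+(\tau_0^\downarrow\otimes\tau_0^\uparrow)(r\rho_\downarrow(T)^0).$$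 -/

import Mathlib

noncomputable section

namespace SUq2

open Filter Topology LaurentPolynomial

/-! ### Operators on the span of an orthonormal basis -/

/-- The dense subspace of `ℓ²(ι)` spanned algebraically by the standard orthonormal basis. -/
abbrev Core (ι : Type) : Type := ι →₀ ℂ

/-- Linear operators on the dense subspace `Core ι`. -/
abbrev Op (ι : Type) : Type := Module.End ℂ (Core ι)

/-- The operator with prescribed values on the basis vectors. -/
def ofBasis {ι : Type} (f : ι → Core ι) : Op ι := Finsupp.linearCombination ℂ f

/-- The diagonal operator with eigenvalues `d`. -/
def diag {ι : Type} (d : ι → ℂ) : Op ι := ofBasis fun i => Finsupp.single i (d i)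

/-- `S` is the adjoint of `T`: `⟨e_i, S e_k⟩` is the complex conjugate of `⟨e_k, T e_i⟩`. -/
def IsAdj {ι : Type} (S T : Op ι) : Prop :=
  ∀ i k, S (Finsupp.single k 1) i = starRingEnd ℂ (T (Finsupp.single i 1) k)

/-- The unital `*`-algebra generated by a set of operators. -/
def starAlg {ι : Type} (X : Set (Op ι)) : Subalgebra ℂ (Op ι) :=
  Algebra.adjoin ℂ (X ∪ {S | ∃ T ∈ X, IsAdj S T})

/-- The deformation parameter `0 < q < 1`. -/
abbrev QParam : Type := Set.Ioo (0 : ℝ) 1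

/-! ### The quantum disks -/

/-- `π_±(a) ε_k = √(1 - q^(2k+2)) ε_{k+1}`. -/
def piA (q : QParam) : Op ℕ :=
  ofBasis fun k => Finsupp.single (k + 1) (Real.sqrt (1 - (q : ℝ) ^ (2 * k + 2)) : ℂ)

/-- `π_±(a^*) ε_k = √(1 - q^(2k)) ε_{k-1}` (zero for `k = 0`). -/
def piAStar (q : QParam) : Op ℕ :=
  ofBasis fun k => Finsupp.single (k - 1) (Real.sqrt (1 - (q : ℝ) ^ (2 * k)) : ℂ)

/-- `π_±(b) ε_k = ± q^k ε_k`; the sign is `ε`. -/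
def piB (q : QParam) (ε : ℤˣ) : Op ℕ :=
  ofBasis fun k => Finsupp.single k (((ε : ℤ) : ℂ) * ((q : ℝ) : ℂ) ^ k)

theorem ofBasis_single {ι : Type} (f : ι → Core ι) (i : ι) :
    ofBasis f (Finsupp.single i 1) = f i := by
  simp [ofBasis]

theorem isAdj_piAStar (q : QParam) : IsAdj (piAStar q) (piA q) := by
  intro i k
  simp only [piA, piAStar, ofBasis_single, Finsupp.single_apply]
  rcases k with _ | k
  · simp
  · simp only [Nat.add_sub_cancel]
    by_cases h : k = i
    · subst h
      simp [Complex.conj_ofReal, mul_add]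
    · simp [h, Ne.symm h]

theorem isAdj_piB (q : QParam) (ε : ℤˣ) : IsAdj (piB q ε) (piB q ε) := by
  intro i k
  simp only [piB, ofBasis_single, Finsupp.single_apply]
  by_cases h : k = i
  · subst h; simp
  · simp [h, Ne.symm h]

/-- The algebra `𝒜(D²_{q±}) = 𝒜(SU_q(2)) / ker π_±`, identified with its faithful image, the
`*`-algebra generated by `π_±(a)` and `π_±(b)`. -/
def Disk (q : QParam) (ε : ℤˣ) : Subalgebra ℂ (Op ℕ) := starAlg {piA q, piB q ε}

/-- `r_±(a)`. -/
def diskA (q : QParam) (ε : ℤˣ) : Disk q ε :=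
  ⟨piA q, Algebra.subset_adjoin (Or.inl (Or.inl rfl))⟩

/-- `r_±(a^*)`. -/
def diskAStar (q : QParam) (ε : ℤˣ) : Disk q ε :=
  ⟨piAStar q, Algebra.subset_adjoin (Or.inr ⟨piA q, Or.inl rfl, isAdj_piAStar q⟩)⟩

/-- `r_±(b) = r_±(b^*)`. -/
def diskB (q : QParam) (ε : ℤˣ) : Disk q ε :=
  ⟨piB q ε, Algebra.subset_adjoin (Or.inl (Or.inr rfl))⟩

/-! ### The symbol map `σ` of the quantum disks

An operator has symbol `f = ∑ f_l u^l` if it agrees with the Toeplitz-type operator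
`ε_k ↦ ∑ f_l ε_{k+l}` up to an error which is exponentially small in `k`. -/

/-- The `ℓ¹` norm of a finitely supported vector. -/
def l1 (v : Core ℕ) : ℝ := v.sum fun _ c => ‖c‖

/-- The basis vector `ε_m`, which is `0` for `m < 0`. -/
def evec (m : ℤ) : Core ℕ := if 0 ≤ m then Finsupp.single m.toNat 1 else 0

/-- The vector `∑ f_l ε_{m+l}`. -/
def toep (m : ℤ) : ℂ[T;T⁻¹] →ₗ[ℂ] Core ℕ :=
  Finsupp.linearCombination ℂ (fun l : ℤ => evec (m + l)) ∘ₗ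
    (AddMonoidAlgebra.coeffLinearEquiv ℂ).toLinearMap

/-- The operator `x` has the symbol `f`. -/
def HasSymbol (q : QParam) (x : Op ℕ) (f : ℂ[T;T⁻¹]) : Prop :=
  ∃ C : ℝ, ∀ k : ℕ, l1 (x (Finsupp.single k 1) - toep k f) ≤ C * (q : ℝ) ^ k

theorem l1_eq_of_subset (v : Core ℕ) {s : Finset ℕ} (hs : v.support ⊆ s) :
    l1 v = ∑ k ∈ s, ‖v k‖ :=
  Finset.sum_subset hs fun k _ hk => by simpa using hk

theorem l1_nonneg (v : Core ℕ) : 0 ≤ l1 v := Finset.sum_nonneg fun _ _ => norm_nonneg _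

theorem l1_zero : l1 0 = 0 := by simp [l1]

theorem l1_add_le (v w : Core ℕ) : l1 (v + w) ≤ l1 v + l1 w := by
  classical
  rw [l1_eq_of_subset (v + w) Finsupp.support_add,
    l1_eq_of_subset v (Finset.subset_union_left (s₂ := w.support)),
    l1_eq_of_subset w (Finset.subset_union_right (s₁ := v.support)), ← Finset.sum_add_distrib]
  exact Finset.sum_le_sum fun k _ => norm_add_le _ _

theorem l1_smul (c : ℂ) (v : Core ℕ) : l1 (c • v) = ‖c‖ * l1 v := by
  rw [l1_eq_of_subset (c • v) Finsupp.support_smul, l1_eq_of_subset v subset_rfl, Finset.mul_sum]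
  simp

theorem l1_neg (v : Core ℕ) : l1 (-v) = l1 v := by
  simpa using l1_smul (-1) v

theorem l1_single (k : ℕ) (c : ℂ) : l1 (Finsupp.single k c) = ‖c‖ := by
  simp [l1]

theorem norm_le_l1 (v : Core ℕ) (k : ℕ) : ‖v k‖ ≤ l1 v := by
  classical
  rw [l1_eq_of_subset v (Finset.subset_insert k v.support)]
  exact Finset.single_le_sum (f := fun k => ‖v k‖) (fun _ _ => norm_nonneg _)
    (Finset.mem_insert_self _ _)

theorem l1_op_le (x : Op ℕ) (M : ℝ) (h : ∀ k, l1 (x (Finsupp.single k 1)) ≤ M) (v : Core ℕ) :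
    l1 (x v) ≤ M * l1 v := by
  induction v using Finsupp.induction with
  | zero => simp [l1_zero]
  | single_add k c v hk _ ih =>
    have h1 : l1 (Finsupp.single k c + v) = ‖c‖ + l1 v := by
      unfold l1
      rw [Finsupp.sum_add_index_of_disjoint]
      · simp
      · classical
        exact Finset.disjoint_of_subset_left Finsupp.support_single_subset (by simpa using hk)
    have h2 : (Finsupp.single k c : Core ℕ) = c • Finsupp.single k 1 := by simp
    rw [h1, map_add, h2, map_smul]
    refine (l1_add_le _ _).trans ?_
    rw [l1_smul, mul_add]
    have := mul_le_mul_of_nonneg_left (h k) (norm_nonneg c)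
    linarith

theorem toep_C_mul_T (m l : ℤ) (c : ℂ) : toep m (C c * T l) = c • evec (m + l) := by
  rw [← single_eq_C_mul_T]
  simp [toep, -single_eq_C_mul_T]

theorem toep_T (m l : ℤ) : toep m (T l) = evec (m + l) := by
  have := toep_C_mul_T m l 1
  simpa using this

theorem toep_mul_T (m l : ℤ) (f : ℂ[T;T⁻¹]) : toep m (f * T l) = toep (m + l) f := by
  induction f using LaurentPolynomial.induction_on' with
  | add f g hf hg => simp [add_mul, hf, hg]
  | C_mul_T n c =>
    rw [mul_assoc, ← T_add, toep_C_mul_T, toep_C_mul_T]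
    congr 2
    ring

theorem l1_evec_le (m : ℤ) : l1 (evec m) ≤ 1 := by
  unfold evec
  split_ifs
  · simp [l1_single]
  · simp [l1_zero]

theorem exists_l1_toep_le (f : ℂ[T;T⁻¹]) : ∃ F : ℝ, 0 ≤ F ∧ ∀ m, l1 (toep m f) ≤ F := by
  induction f using LaurentPolynomial.induction_on' with
  | add f g hf hg =>
    obtain ⟨F, hF, hF'⟩ := hf
    obtain ⟨G, hG, hG'⟩ := hg
    refine ⟨F + G, by positivity, fun m => ?_⟩
    rw [map_add]
    exact (l1_add_le _ _).trans (add_le_add (hF' m) (hG' m))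
  | C_mul_T n c =>
    refine ⟨‖c‖, norm_nonneg _, fun m => ?_⟩
    rw [toep_C_mul_T, l1_smul]
    exact mul_le_of_le_one_right (norm_nonneg _) (l1_evec_le _)

theorem toep_apply (m : ℤ) (f : ℂ[T;T⁻¹]) (i : ℕ) : toep m f i = f.coeff (i - m) := by
  induction f using LaurentPolynomial.induction_on' with
  | add f g hf hg => simp [hf, hg]
  | C_mul_T n c =>
    rw [toep_C_mul_T, ← single_eq_C_mul_T, AddMonoidAlgebra.coeff_single, Finsupp.single_apply]
    unfold evec
    split_ifs with h1 h2 h2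
    · have : (m + n).toNat = i := by omega
      simp [this]
    · have : (m + n).toNat ≠ i := by omega
      simp [Ne.symm this]
    · omega
    · simp

variable {q : QParam}

theorem qpos (q : QParam) : 0 < (q : ℝ) := q.2.1

theorem HasSymbol.exists_nonneg {x : Op ℕ} {f : ℂ[T;T⁻¹]} (h : HasSymbol q x f) :
    ∃ C : ℝ, 0 ≤ C ∧ ∀ k : ℕ, l1 (x (Finsupp.single k 1) - toep k f) ≤ C * (q : ℝ) ^ k := by
  obtain ⟨C, hC⟩ := h
  exact ⟨C, by simpa using (l1_nonneg _).trans (hC 0), hC⟩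

theorem HasSymbol.bound {x : Op ℕ} {f : ℂ[T;T⁻¹]} (h : HasSymbol q x f) :
    ∃ M : ℝ, ∀ k, l1 (x (Finsupp.single k 1)) ≤ M := by
  obtain ⟨C, h0, hC⟩ := h.exists_nonneg
  obtain ⟨F, _, hF⟩ := exists_l1_toep_le f
  refine ⟨C + F, fun k => ?_⟩
  have e : x (Finsupp.single k 1) = (x (Finsupp.single k 1) - toep k f) + toep k f := by abel
  rw [e]
  refine (l1_add_le _ _).trans (add_le_add ((hC k).trans ?_) (hF k))
  exact mul_le_of_le_one_right h0 (pow_le_one₀ (qpos q).le q.2.2.le)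

theorem HasSymbol.add {x y : Op ℕ} {f g : ℂ[T;T⁻¹]} (hx : HasSymbol q x f)
    (hy : HasSymbol q y g) : HasSymbol q (x + y) (f + g) := by
  obtain ⟨C, hC⟩ := hx
  obtain ⟨C', hC'⟩ := hy
  refine ⟨C + C', fun k => ?_⟩
  have e : (x + y) (Finsupp.single k 1) - toep k (f + g) =
      (x (Finsupp.single k 1) - toep k f) + (y (Finsupp.single k 1) - toep k g) := by
    rw [LinearMap.add_apply, map_add]; abel
  rw [e, add_mul]
  exact (l1_add_le _ _).trans (add_le_add (hC k) (hC' k))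

theorem HasSymbol.scalar (c : ℂ) :
    HasSymbol q (algebraMap ℂ (Op ℕ) c) (algebraMap ℂ ℂ[T;T⁻¹] c) := by
  refine ⟨0, fun k => ?_⟩
  have h : toep k (algebraMap ℂ ℂ[T;T⁻¹] c) = c • evec k := by
    have := toep_C_mul_T k 0 c
    simpa [← C_eq_algebraMap] using this
  rw [h]
  simp [Module.algebraMap_end_apply, evec, l1_zero]

theorem HasSymbol.comp_toep {x : Op ℕ} {f : ℂ[T;T⁻¹]} (hx : HasSymbol q x f) (g : ℂ[T;T⁻¹]) :
    ∃ C : ℝ, ∀ k : ℕ, l1 (x (toep k g) - toep k (f * g)) ≤ C * (q : ℝ) ^ k := by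
  induction g using LaurentPolynomial.induction_on' with
  | add g g' hg hg' =>
    obtain ⟨C, hC⟩ := hg
    obtain ⟨C', hC'⟩ := hg'
    refine ⟨C + C', fun k => ?_⟩
    have e : x (toep k (g + g')) - toep k (f * (g + g')) =
        (x (toep k g) - toep k (f * g)) + (x (toep k g') - toep k (f * g')) := by
      rw [map_add, map_add, mul_add, map_add]; abel
    rw [e, add_mul]
    exact (l1_add_le _ _).trans (add_le_add (hC k) (hC' k))
  | C_mul_T l c =>
    obtain ⟨C₁, h0, hC⟩ := hx.exists_nonneg
    obtain ⟨F, hF0, hF⟩ := exists_l1_toep_le f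
    refine ⟨‖c‖ * ((C₁ + F) * (q : ℝ) ^ l), fun k => ?_⟩
    have e : x (toep k (C c * T l)) - toep k (f * (C c * T l)) =
        c • (x (evec (k + l)) - toep (k + l) f) := by
      have : f * (C c * T l) = c • (f * T l) := by
        rw [smul_eq_C_mul]; ring
      rw [toep_C_mul_T, this, map_smul, map_smul, toep_mul_T, smul_sub]
    rw [e, l1_smul, mul_assoc, mul_assoc (C₁ + F), ← zpow_natCast, ← zpow_add₀ (qpos q).ne',
      add_comm l]
    refine mul_le_mul_of_nonneg_left ?_ (norm_nonneg c)
    have hz : 0 < (q : ℝ) ^ ((k : ℤ) + l) := zpow_pos (qpos q) _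
    by_cases hkl : 0 ≤ (k : ℤ) + l
    · obtain ⟨n, hn⟩ := Int.eq_ofNat_of_zero_le hkl
      rw [hn] at hz ⊢
      have := hC n
      simp only [evec, Int.natCast_nonneg, if_true, Int.toNat_natCast,
        zpow_natCast] at this hz ⊢
      nlinarith
    · have h1 : (1 : ℝ) ≤ (q : ℝ) ^ ((k : ℤ) + l) :=
        one_le_zpow_of_nonpos₀ (qpos q) q.2.2.le (by omega)
      simp only [evec, hkl, if_false, map_zero, zero_sub, l1_neg]
      have := hF (k + l)
      nlinarith

theorem HasSymbol.mul {x y : Op ℕ} {f g : ℂ[T;T⁻¹]} (hx : HasSymbol q x f)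
    (hy : HasSymbol q y g) : HasSymbol q (x * y) (f * g) := by
  obtain ⟨M, hM⟩ := hx.bound
  obtain ⟨C, hC⟩ := hx.comp_toep g
  obtain ⟨C', hC'⟩ := hy
  have hM0 : 0 ≤ M := (l1_nonneg _).trans (hM 0)
  refine ⟨M * C' + C, fun k => ?_⟩
  have e : (x * y) (Finsupp.single k 1) - toep k (f * g) =
      x (y (Finsupp.single k 1) - toep k g) + (x (toep k g) - toep k (f * g)) := by
    rw [Module.End.mul_apply, map_sub]; abel
  rw [e, add_mul, mul_assoc]
  exact (l1_add_le _ _).trans (add_le_add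
    ((l1_op_le x M hM _).trans (mul_le_mul_of_nonneg_left (hC' k) hM0)) (hC k))

theorem abs_sqrt_sub_one_le {t : ℝ} (h0 : 0 ≤ t) (h1 : t ≤ 1) : |Real.sqrt (1 - t) - 1| ≤ t := by
  have h2 : Real.sqrt (1 - t) ≤ 1 := Real.sqrt_le_one.2 (by linarith)
  have h3 : 1 - t ≤ Real.sqrt (1 - t) := Real.le_sqrt_of_sq_le (by nlinarith)
  rw [abs_le]
  constructor <;> linarith

theorem norm_sqrt_sub_one_le (q : QParam) {n k : ℕ} (h : k ≤ n) :
    ‖((Real.sqrt (1 - (q : ℝ) ^ n) : ℝ) : ℂ) - 1‖ ≤ 1 * (q : ℝ) ^ k := by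
  have e : ((Real.sqrt (1 - (q : ℝ) ^ n) : ℝ) : ℂ) - 1 =
      ((Real.sqrt (1 - (q : ℝ) ^ n) - 1 : ℝ) : ℂ) := by push_cast; ring
  rw [e, Complex.norm_real, Real.norm_eq_abs, one_mul]
  exact (abs_sqrt_sub_one_le (pow_nonneg (qpos q).le _) (pow_le_one₀ (qpos q).le q.2.2.le)).trans
    (pow_le_pow_of_le_one (qpos q).le q.2.2.le h)

theorem hasSymbol_piA (q : QParam) : HasSymbol q (piA q) (T 1) := by
  refine ⟨1, fun k => ?_⟩
  have h : evec ((k : ℤ) + 1) = Finsupp.single (k + 1) 1 := by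
    rw [evec, if_pos (by positivity)]
    congr 1
  rw [toep_T, piA, ofBasis_single, h, ← Finsupp.single_sub, l1_single]
  exact norm_sqrt_sub_one_le q (by omega)

theorem hasSymbol_piAStar (q : QParam) : HasSymbol q (piAStar q) (T (-1)) := by
  refine ⟨1, fun k => ?_⟩
  rw [toep_T, piAStar, ofBasis_single]
  rcases k with _ | k
  · simp [evec, l1_zero]
  · have h : evec (((k + 1 : ℕ) : ℤ) + -1) = Finsupp.single k 1 := by
      have : ((k + 1 : ℕ) : ℤ) + -1 = k := by push_cast; ring
      rw [this, evec, if_pos (by positivity)]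
      congr 1
    rw [h, Nat.add_sub_cancel, ← Finsupp.single_sub, l1_single]
    exact norm_sqrt_sub_one_le q (by omega)

theorem hasSymbol_piB (q : QParam) (ε : ℤˣ) : HasSymbol q (piB q ε) 0 := by
  refine ⟨1, fun k => ?_⟩
  rw [map_zero, sub_zero, piB, ofBasis_single, l1_single, norm_mul, norm_pow, Complex.norm_real,
    Real.norm_eq_abs, abs_of_pos (qpos q)]
  rcases Int.units_eq_one_or ε with h | h <;> simp [h]

theorem HasSymbol.unique {x : Op ℕ} {f g : ℂ[T;T⁻¹]} (hf : HasSymbol q x f)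
    (hg : HasSymbol q x g) : f = g := by
  obtain ⟨C₁, hC⟩ := hf
  obtain ⟨C', hC'⟩ := hg
  ext l
  have hlim : Tendsto (fun k : ℕ => (C₁ + C') * (q : ℝ) ^ k) atTop (𝓝 0) := by
    simpa using (tendsto_pow_atTop_nhds_zero_of_lt_one (qpos q).le q.2.2).const_mul (C₁ + C')
  have hle : ∀ᶠ k : ℕ in atTop, ‖f.coeff l - g.coeff l‖ ≤ (C₁ + C') * (q : ℝ) ^ k := by
    filter_upwards [eventually_ge_atTop l.natAbs] with k hk
    have hi : (((k + l).toNat : ℕ) : ℤ) - k = l := by omega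
    have e : f.coeff l - g.coeff l = (-(x (Finsupp.single k 1) - toep k f) +
        (x (Finsupp.single k 1) - toep k g)) (k + l).toNat := by
      simp only [Finsupp.add_apply, Finsupp.neg_apply, Finsupp.sub_apply, toep_apply, hi]
      ring
    rw [e, add_mul]
    refine (norm_le_l1 _ _).trans ((l1_add_le _ _).trans ?_)
    rw [l1_neg]
    exact add_le_add (hC k) (hC' k)
  have h0 := ge_of_tendsto hlim hle
  exact sub_eq_zero.1 (norm_le_zero_iff.1 h0)

theorem isAdj_unique {ι : Type} {S S' T : Op ι} (h : IsAdj S T) (h' : IsAdj S' T) : S = S' := by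
  refine Finsupp.lhom_ext' fun k => LinearMap.ext_ring (Finsupp.ext fun i => ?_)
  simpa using (h i k).trans (h' i k).symm

theorem exists_hasSymbol {ε : ℤˣ} {x : Op ℕ} (hx : x ∈ Disk q ε) : ∃ f, HasSymbol q x f := by
  refine Algebra.adjoin_induction (p := fun x _ => ∃ f, HasSymbol q x f) ?_
    (fun c => ⟨_, HasSymbol.scalar c⟩) (fun x y _ _ ⟨f, hf⟩ ⟨g, hg⟩ => ⟨_, hf.add hg⟩)
    (fun x y _ _ ⟨f, hf⟩ ⟨g, hg⟩ => ⟨_, hf.mul hg⟩) hx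
  rintro x ((rfl | rfl) | ⟨y, (rfl | rfl), h⟩)
  · exact ⟨_, hasSymbol_piA q⟩
  · exact ⟨_, hasSymbol_piB q ε⟩
  · rw [isAdj_unique h (isAdj_piAStar q)]
    exact ⟨_, hasSymbol_piAStar q⟩
  · rw [isAdj_unique h (isAdj_piB q ε)]
    exact ⟨_, hasSymbol_piB q ε⟩

/-- The symbol of an element of the quantum disk. -/
def symb {ε : ℤˣ} (x : Disk q ε) : ℂ[T;T⁻¹] := (exists_hasSymbol x.2).choose

theorem hasSymbol_symb {ε : ℤˣ} (x : Disk q ε) : HasSymbol q x (symb x) :=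
  (exists_hasSymbol x.2).choose_spec

/-- The symbol map `σ : 𝒜(D²_{q±}) → 𝒜(S¹) = ℂ[u, u⁻¹]`, the `*`-homomorphism with
`σ(r_±(a)) = u` and `σ(r_±(b)) = 0`. -/
def sigma (q : QParam) (ε : ℤˣ) : Disk q ε →ₐ[ℂ] ℂ[T;T⁻¹] :=
  AlgHom.ofLinearMap
    { toFun := symb
      map_add' := fun x y =>
        (hasSymbol_symb (x + y)).unique ((hasSymbol_symb x).add (hasSymbol_symb y))
      map_smul' := fun c x => by
        refine (hasSymbol_symb (c • x)).unique ?_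
        rw [RingHom.id_apply, Algebra.smul_def c (symb x), Subalgebra.coe_smul, Algebra.smul_def]
        exact (HasSymbol.scalar c).mul (hasSymbol_symb x) }
    ((hasSymbol_symb 1).unique (by simpa using HasSymbol.scalar (q := q) 1))
    (fun x y => (hasSymbol_symb (x * y)).unique ((hasSymbol_symb x).mul (hasSymbol_symb y)))

theorem sigma_diskA (q : QParam) (ε : ℤˣ) : sigma q ε (diskA q ε) = T 1 :=
  (hasSymbol_symb (diskA q ε)).unique (hasSymbol_piA q)

theorem sigma_diskAStar (q : QParam) (ε : ℤˣ) : sigma q ε (diskAStar q ε) = T (-1) :=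
  (hasSymbol_symb (diskAStar q ε)).unique (hasSymbol_piAStar q)

theorem sigma_diskB (q : QParam) (ε : ℤˣ) : sigma q ε (diskB q ε) = 0 :=
  (hasSymbol_symb (diskB q ε)).unique (hasSymbol_piB q ε)

/-! ### The functionals `τ₁`, `τ₀^↑`, `τ₀^↓` -/

/-- The normalized integral `f ↦ (1/2π) ∫_{S¹} f` of Laurent polynomials in `u = e^{iθ}`. -/
def circleMean : ℂ[T;T⁻¹] →ₗ[ℂ] ℂ :=
  Finsupp.linearCombination ℂ (fun l : ℤ =>
      (1 / (2 * Real.pi) : ℂ) * ∫ θ in (0 : ℝ)..(2 * Real.pi), Complex.exp (l * θ * Complex.I)) ∘ₗ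
    (AddMonoidAlgebra.coeffLinearEquiv ℂ).toLinearMap

theorem circleMean_monomial (l : ℤ) :
    (1 / (2 * Real.pi) : ℂ) * ∫ θ in (0 : ℝ)..(2 * Real.pi), Complex.exp (l * θ * Complex.I) =
      if l = 0 then 1 else 0 := by
  split_ifs with h
  · subst h
    have : (Real.pi : ℂ) ≠ 0 := by exact_mod_cast Real.pi_ne_zero
    simp
    field_simp
  · have hc : (l : ℂ) * Complex.I ≠ 0 := mul_ne_zero (by exact_mod_cast h) Complex.I_ne_zero
    have e : ∀ θ : ℝ, Complex.exp (l * θ * Complex.I) = Complex.exp (l * Complex.I * θ) :=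
      fun θ => by congr 1; ring
    simp_rw [e]
    rw [integral_exp_mul_complex hc]
    have : (l : ℂ) * Complex.I * ((2 * Real.pi : ℝ) : ℂ) = l * (2 * Real.pi * Complex.I) := by
      push_cast; ring
    rw [this, Complex.exp_int_mul_two_pi_mul_I]
    simp

theorem circleMean_apply (f : ℂ[T;T⁻¹]) : circleMean f = f.coeff 0 := by
  induction f using LaurentPolynomial.induction_on' with
  | add f g hf hg => simp [hf, hg]
  | C_mul_T n c =>
    rw [← single_eq_C_mul_T]
    simp only [circleMean, circleMean_monomial]
    simp [Finsupp.single_apply, -single_eq_C_mul_T]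

/-- `τ₁(x) = (1/2π) ∫_{S¹} σ(x)`. -/
def tau1 (q : QParam) (ε : ℤˣ) : Disk q ε →ₗ[ℂ] ℂ := circleMean ∘ₗ (sigma q ε).toLinearMap

/-- The truncated trace `Tr_N(x) = ∑_{k=0}^N ⟨ε_k, x ε_k⟩`. -/
def truncTr (N : ℕ) : Op ℕ →ₗ[ℂ] ℂ where
  toFun x := ∑ k ∈ Finset.range (N + 1), x (Finsupp.single k 1) k
  map_add' x y := by simp [Finset.sum_add_distrib]
  map_smul' c x := by simp [Finset.mul_sum]

/-- The sequence `Tr_N(x) - (N + c) τ₁(x)`. -/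
def tauSeq (q : QParam) (ε : ℤˣ) (c : ℂ) (N : ℕ) : Disk q ε →ₗ[ℂ] ℂ :=
  truncTr N ∘ₗ (Disk q ε).val.toLinearMap - (N + c) • tau1 q ε

theorem exists_tendsto_tauSeq (q : QParam) (ε : ℤˣ) (c : ℂ) (x : Disk q ε) :
    ∃ t, Tendsto (fun N => tauSeq q ε c N x) atTop (𝓝 t) := by
  obtain ⟨C₁, hC⟩ := hasSymbol_symb x
  set d : ℕ → ℂ := fun k => (x : Op ℕ) (Finsupp.single k 1) k - tau1 q ε x with hd
  have ht : tau1 q ε x = (symb x).coeff 0 := circleMean_apply _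
  have hs : Summable d := by
    refine Summable.of_norm_bounded (g := fun k => C₁ * (q : ℝ) ^ k)
      ((summable_geometric_of_lt_one (qpos q).le q.2.2).mul_left C₁) fun k => ?_
    refine le_trans (le_of_eq ?_) ((norm_le_l1 _ k).trans (hC k))
    rw [Finsupp.sub_apply, toep_apply, hd, ht, sub_self]
  refine ⟨∑' k, d k + (1 - c) * tau1 q ε x, ?_⟩
  have h1 := ((tendsto_add_atTop_iff_nat 1).2 hs.hasSum.tendsto_sum_nat).add_const
    ((1 - c) * tau1 q ε x)
  refine h1.congr fun N => ?_
  have e : tauSeq q ε c N x = (∑ k ∈ Finset.range (N + 1), (x : Op ℕ) (Finsupp.single k 1) k) -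
      (N + c) * tau1 q ε x := rfl
  rw [e]
  simp only [hd, Finset.sum_sub_distrib, Finset.sum_const, Finset.card_range, nsmul_eq_mul]
  push_cast
  ring

/-- The functional `x ↦ lim_{N → ∞} (Tr_N(x) - (N + c) τ₁(x))`. -/
def tau0 (q : QParam) (ε : ℤˣ) (c : ℂ) : Disk q ε →ₗ[ℂ] ℂ where
  toFun x := limUnder atTop fun N => tauSeq q ε c N x
  map_add' x y := by
    have hx := tendsto_nhds_limUnder (exists_tendsto_tauSeq q ε c x)
    have hy := tendsto_nhds_limUnder (exists_tendsto_tauSeq q ε c y)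
    simp only [map_add]
    exact (hx.add hy).limUnder_eq
  map_smul' z x := by
    have hx := tendsto_nhds_limUnder (exists_tendsto_tauSeq q ε c x)
    simp only [map_smul, RingHom.id_apply]
    exact (hx.const_smul z).limUnder_eq

/-- `τ₀^↑(x) = lim (Tr_N(x) - (N + 3/2) τ₁(x))`. -/
def tau0Up (q : QParam) (ε : ℤˣ) : Disk q ε →ₗ[ℂ] ℂ := tau0 q ε (3 / 2)

/-- `τ₀^↓(x) = lim (Tr_N(x) - (N + 1/2) τ₁(x))`. -/
def tau0Dn (q : QParam) (ε : ℤˣ) : Disk q ε →ₗ[ℂ] ℂ := tau0 q ε (1 / 2)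

/-! ### The spectral triple -/

/-- The spin label `s = ↑, ↓`. -/
inductive Spin : Type
  | up : Spin
  | dn : Spin
  deriving DecidableEq

/-- The largest value of `y` for given `n = 2j` and `s`. -/
def yMax (n : ℤ) : Spin → ℤ
  | .up => n + 1
  | .dn => n - 1

/-- The labels `(j, x, y, s)` of the orthonormal basis of spinors, with `n = 2j = 0, 1, 2, …`,
`0 ≤ x ≤ 2j`, and `0 ≤ y ≤ 2j + 1` for `s = ↑`, `0 ≤ y ≤ 2j - 1` for `s = ↓`. -/
structure Idx : Type where
  n : ℤ
  x : ℤ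
  y : ℤ
  s : Spin
  hx : 0 ≤ x ∧ x ≤ n
  hy : 0 ≤ y ∧ y ≤ yMax n s
  deriving DecidableEq

/-- The Hilbert space of spinors. -/
abbrev SpinorSpace : Type := lp (fun _ : Idx => ℂ) 2

/-- The basis vector `v^j_{x,y,s}` with `n = 2j`; it is `0` if the label is out of range. -/
def vec (n x y : ℤ) (s : Spin) : Core Idx :=
  if h : (0 ≤ x ∧ x ≤ n) ∧ (0 ≤ y ∧ y ≤ yMax n s) then
    Finsupp.single ⟨n, x, y, s, h.1, h.2⟩ 1
  else 0

/-- The `q`-number `[N] = (q^{-N} - q^N) / (q^{-1} - q)`. -/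
def qnum (q : QParam) (N : ℤ) : ℝ :=
  ((q : ℝ) ^ (-N) - (q : ℝ) ^ N) / ((q : ℝ)⁻¹ - (q : ℝ))

/-- `[N]^{1/2}`. -/
def qsqrt (q : QParam) (N : ℤ) : ℝ := Real.sqrt (qnum q N)

/-- The power `q^t` with real exponent. -/
def qpow (q : QParam) (t : ℝ) : ℝ := (q : ℝ) ^ t

/-- The common prefactor: `q^{(x+y-2j-1)/2}` for `s = ↑` and `q^{(x+y-2j)/2}` for `s = ↓`. -/
def pref (q : QParam) (n x y : ℤ) : Spin → ℝ
  | .up => qpow q ((x + y - n - 1) / 2)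
  | .dn => qpow q ((x + y - n) / 2)

/-- The operator `a_+` (raising `j` by `1/2`). -/
def aPlus (q : QParam) : Op Idx := ofBasis fun
  | ⟨n, x, y, .up, _, _⟩ => (pref q n x y .up * qsqrt q (x + 1)) •
      ((qpow q (-(n / 2) - 1 / 2) * qsqrt q (y + 1) / qnum q (n + 2)) •
          vec (n + 1) (x + 1) (y + 1) .up
        + (qpow q (1 / 2) * qsqrt q (n - y + 1) / (qnum q (n + 1) * qnum q (n + 2))) •
          vec (n + 1) (x + 1) y .dn)
  | ⟨n, x, y, .dn, _, _⟩ => (pref q n x y .dn * qsqrt q (x + 1)) •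
      ((qpow q (-(n / 2)) * qsqrt q (y + 1) / qnum q (n + 1)) •
          vec (n + 1) (x + 1) (y + 1) .dn)

/-- The operator `a_-` (lowering `j` by `1/2`). -/
def aMinus (q : QParam) : Op Idx := ofBasis fun
  | ⟨n, x, y, .up, _, _⟩ => (pref q n x y .up * qsqrt q (n - x)) •
      ((qpow q (n / 2 + 1) * qsqrt q (n - y + 1) / qnum q (n + 1)) •
          vec (n - 1) x y .up)
  | ⟨n, x, y, .dn, _, _⟩ => (pref q n x y .dn * qsqrt q (n - x)) •
      (-(qpow q (1 / 2) * qsqrt q (y + 1) / (qnum q n * qnum q (n + 1))) •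
          vec (n - 1) x (y + 1) .up
        + (qpow q (n / 2 + 1 / 2) * qsqrt q (n - y - 1) / qnum q n) •
          vec (n - 1) x y .dn)

/-- The operator `b_+` (raising `j` by `1/2`). -/
def bPlus (q : QParam) : Op Idx := ofBasis fun
  | ⟨n, x, y, .up, _, _⟩ => (pref q n x y .up * qsqrt q (x + 1)) •
      ((qsqrt q (n - y + 2) / qnum q (n + 2)) •
          vec (n + 1) (x + 1) y .up
        - (qpow q (-(n / 2) - 1) * qsqrt q y / (qnum q (n + 1) * qnum q (n + 2))) •
          vec (n + 1) (x + 1) (y - 1) .dn)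
  | ⟨n, x, y, .dn, _, _⟩ => (pref q n x y .dn * qsqrt q (x + 1)) •
      ((qpow q (-(1 / 2)) * qsqrt q (n - y) / qnum q (n + 1)) •
          vec (n + 1) (x + 1) y .dn)

/-- The operator `b_-` (lowering `j` by `1/2`). -/
def bMinus (q : QParam) : Op Idx := ofBasis fun
  | ⟨n, x, y, .up, _, _⟩ => -(pref q n x y .up * qsqrt q (n - x)) •
      ((qpow q (-(1 / 2)) * qsqrt q y / qnum q (n + 1)) •
          vec (n - 1) x (y - 1) .up)
  | ⟨n, x, y, .dn, _, _⟩ => -(pref q n x y .dn * qsqrt q (n - x)) •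
      ((qpow q (n / 2) * qsqrt q (n - y) / (qnum q n * qnum q (n + 1))) •
          vec (n - 1) x y .up
        + (qsqrt q y / qnum q n) •
          vec (n - 1) x (y - 1) .dn)

/-- The represented algebra `π(𝒜)`: the `*`-algebra generated by `π(a) = a_+ + a_-` and
`π(b) = b_+ + b_-`. -/
def algA (q : QParam) : Subalgebra ℂ (Op Idx) :=
  starAlg {aPlus q + aMinus q, bPlus q + bMinus q}

/-- The eigenvalues of the Dirac operator: `2j + 3/2` for `s = ↑`, `-(2j + 1/2)` for `s = ↓`. -/
def diracEv : Idx → ℝ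
  | ⟨n, _, _, .up, _, _⟩ => n + 3 / 2
  | ⟨n, _, _, .dn, _, _⟩ => -(n + 1 / 2)

/-- The Dirac operator `D`. -/
def dirac : Op Idx := diag fun i => (diracEv i : ℂ)

/-- The power `|D|^w` for a complex exponent `w`. -/
def absDiracPow (w : ℂ) : Op Idx := diag fun i => ((|diracEv i| : ℝ) : ℂ) ^ w

/-- `|D|`. -/
def absDirac : Op Idx := diag fun i => ((|diracEv i| : ℝ) : ℂ)

/-- The sign `F = D / |D|`. -/
def signD : Op Idx := diag fun i => ((diracEv i / |diracEv i| : ℝ) : ℂ)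

/-- The projection `P^↑ = (1 + F) / 2`. -/
def pUp : Op Idx := (1 / 2 : ℂ) • (1 + signD)

/-- The projection `P^↓ = (1 - F) / 2`. -/
def pDn : Op Idx := (1 / 2 : ℂ) • (1 - signD)

/-- The commutator `[S, T]`. -/
def comm (S T : Op Idx) : Op Idx := S * T - T * S

/-- The derivation `δ(T) = [|D|, T]`. -/
def delta (T : Op Idx) : Op Idx := comm absDirac T

/-- The algebra `ℬ` generated by all `δ^k(𝒜)`. -/
def algB (q : QParam) : Subalgebra ℂ (Op Idx) :=
  Algebra.adjoin ℂ {S | ∃ k : ℕ, ∃ T ∈ algA q, S = delta^[k] T}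

/-- The algebra `Ψ⁰` generated by all `δ^k(𝒜)` and `δ^k([D, 𝒜])`. -/
def psi0 (q : QParam) : Subalgebra ℂ (Op Idx) :=
  Algebra.adjoin ℂ
    {S | ∃ k : ℕ, ∃ T ∈ algA q, S = delta^[k] T ∨ S = delta^[k] (comm dirac T)}

/-- The algebra generated by `Ψ⁰` and the projection `P^↑`. -/
def psi0P (q : QParam) : Subalgebra ℂ (Op Idx) :=
  Algebra.adjoin ℂ ((psi0 q : Set (Op Idx)) ∪ {pUp})

theorem algB_le_psi0P (q : QParam) : algB q ≤ psi0P q := by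
  refine Algebra.adjoin_le ?_
  rintro S ⟨k, T, hT, rfl⟩
  exact Algebra.subset_adjoin (Or.inl (Algebra.subset_adjoin ⟨k, T, hT, Or.inl rfl⟩))

theorem pUp_mem (q : QParam) : pUp ∈ psi0P q := Algebra.subset_adjoin (Or.inr rfl)

/-! ### Traces, zeta functions and residues -/

/-- Hilbert-Schmidt operators on the Hilbert space of spinors. -/
def IsHilbertSchmidt (S : SpinorSpace →L[ℂ] SpinorSpace) : Prop :=
  Summable fun i : Idx => ‖S (lp.single 2 i (1 : ℂ))‖ ^ 2

/-- Trace class operators: products of two Hilbert-Schmidt operators. -/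
def IsTraceClass (S : SpinorSpace →L[ℂ] SpinorSpace) : Prop :=
  ∃ A B : SpinorSpace →L[ℂ] SpinorSpace,
    IsHilbertSchmidt A ∧ IsHilbertSchmidt B ∧ S = A ∘L B

/-- The operator `T` extends to a trace class operator on the Hilbert space of spinors, and its
trace is `t`. -/
def HasTrace (T : Op Idx) (t : ℂ) : Prop :=
  ∃ S : SpinorSpace →L[ℂ] SpinorSpace,
    (∀ i k : Idx, S (lp.single 2 k (1 : ℂ)) i = T (Finsupp.single k 1) i) ∧
    IsTraceClass S ∧
    HasSum (fun i : Idx => inner ℂ (lp.single 2 i (1 : ℂ)) (S (lp.single 2 i (1 : ℂ)))) t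

/-- `Z` is (the meromorphic continuation to `ℂ` of) the zeta function `z ↦ Tr(T |D|^{-z})`, which
is defined by the trace on some half-plane `Re z > R`. -/
def IsZeta (T : Op Idx) (Z : ℂ → ℂ) : Prop :=
  (∀ w, MeromorphicAt Z w) ∧
    ∃ R : ℝ, ∀ z : ℂ, R < z.re → HasTrace (T * absDiracPow (-z)) (Z z)

/-- The dimension spectrum of an algebra of operators: the set of all poles of the zeta functions
of its elements. -/
def dimSpectrum (X : Subalgebra ℂ (Op Idx)) : Set ℂ :=
  {w | ∃ T ∈ X, ∃ Z, IsZeta T Z ∧ meromorphicOrderAt Z w < 0}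

/-- `⨍ T = r`: the zeta function of `T` has at most a simple pole at `0`, with residue `r`. -/
def HasNcint (T : Op Idx) (r : ℂ) : Prop :=
  ∃ Z, IsZeta T Z ∧ Tendsto (fun z => z * Z z) (𝓝[≠] 0) (𝓝 r)

/-! ### The symbol map `ρ` -/

open scoped TensorProduct

/-- The target `𝒜(D²_{q+}) ⊗ 𝒜(D²_{q-}) ⊗ 𝒜(S¹)` of the symbol map. -/
abbrev SymbolAlg (q : QParam) : Type := (Disk q 1 ⊗[ℂ] Disk q (-1)) ⊗[ℂ] ℂ[T;T⁻¹]

/-- The diagonal part `T̃ = P^↑ T P^↑ + P^↓ T P^↓`. -/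
def diagPart (T : Op Idx) : Op Idx := pUp * T * pUp + pDn * T * pDn

/-- The off-diagonal operator `P^↓ T_+ P^↑ + P^↑ T_- P^↓`. -/
def slash (Tp Tm : Op Idx) : Op Idx := pDn * Tp * pUp + pUp * Tm * pDn

/-- `T` belongs to the algebra `S`, and `ρ` maps it to `v`. -/
def Sends {S : Subalgebra ℂ (Op Idx)} {V : Type} (ρ : S → V) (T : Op Idx) (v : V) : Prop :=
  ∃ h : T ∈ S, ρ ⟨T, h⟩ = v

/-- The adjoint of `T` exists and belongs to the algebra `S`, and `ρ` maps it to `v`. -/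
def SendsAdj {S : Subalgebra ℂ (Op Idx)} {V : Type} (ρ : S → V) (T : Op Idx) (v : V) : Prop :=
  ∃ T', IsAdj T' T ∧ Sends ρ T' v

/-- `ρ` is the `*`-homomorphism on `ℬ` with the prescribed values on the generators
`ã_±`, `b̃_±`, `ã_/`, `b̃_/` (and hence on their adjoints). -/
structure IsSymbolMap (q : QParam) (ρ : algB q →ₐ[ℂ] SymbolAlg q) : Prop where
  aPlus : Sends ρ (diagPart (SUq2.aPlus q)) ((diskA q 1 ⊗ₜ diskA q (-1)) ⊗ₜ T 1)
  aMinus : Sends ρ (diagPart (SUq2.aMinus q))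
    ((-((q : ℝ) : ℂ)) • ((diskB q 1 ⊗ₜ diskB q (-1)) ⊗ₜ T (-1)))
  bPlus : Sends ρ (diagPart (SUq2.bPlus q)) ((-1 : ℂ) • ((diskA q 1 ⊗ₜ diskB q (-1)) ⊗ₜ T 1))
  bMinus : Sends ρ (diagPart (SUq2.bMinus q)) ((-1 : ℂ) • ((diskB q 1 ⊗ₜ diskAStar q (-1)) ⊗ₜ T (-1)))
  aSlash : Sends ρ (slash (SUq2.aPlus q) (SUq2.aMinus q)) 0
  bSlash : Sends ρ (slash (SUq2.bPlus q) (SUq2.bMinus q)) 0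
  aPlusStar : SendsAdj ρ (diagPart (SUq2.aPlus q))
    ((diskAStar q 1 ⊗ₜ diskAStar q (-1)) ⊗ₜ T (-1))
  aMinusStar : SendsAdj ρ (diagPart (SUq2.aMinus q))
    ((-((q : ℝ) : ℂ)) • ((diskB q 1 ⊗ₜ diskB q (-1)) ⊗ₜ T 1))
  bPlusStar : SendsAdj ρ (diagPart (SUq2.bPlus q))
    ((-1 : ℂ) • ((diskAStar q 1 ⊗ₜ diskB q (-1)) ⊗ₜ T (-1)))
  bMinusStar : SendsAdj ρ (diagPart (SUq2.bMinus q))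
    ((-1 : ℂ) • ((diskB q 1 ⊗ₜ diskA q (-1)) ⊗ₜ T 1))
  aSlashStar : SendsAdj ρ (slash (SUq2.aPlus q) (SUq2.aMinus q)) 0
  bSlashStar : SendsAdj ρ (slash (SUq2.bPlus q) (SUq2.bMinus q)) 0

/-- `R` extends `ρ` to the algebra generated by `Ψ⁰` and `P^↑`, with values in
`𝒜(D²_{q+}) ⊗ 𝒜(D²_{q-}) ⊗ 𝒜(S¹)` tensored with the diagonal `2 × 2` matrices, by `R(P^↑) = P^↑`. -/
structure IsExtendedSymbolMap (q : QParam) (ρ : algB q →ₐ[ℂ] SymbolAlg q)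
    (R : psi0P q →ₐ[ℂ] (Spin → SymbolAlg q)) : Prop where
  extends_symbol : ∀ T : algB q, R (Subalgebra.inclusion (algB_le_psi0P q) T) = fun _ => ρ T
  map_pUp : R ⟨pUp, pUp_mem q⟩ = Pi.single Spin.up 1

/-- The map `x ↦ r(x⁰)`: take the part of degree `0` in `u` and project to the first two
tensor factors. -/
def rZero (q : QParam) : SymbolAlg q →ₗ[ℂ] Disk q 1 ⊗[ℂ] Disk q (-1) :=
  (TensorProduct.rid ℂ (Disk q 1 ⊗[ℂ] Disk q (-1))).toLinearMap ∘ₗ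
    (Finsupp.lapply (0 : ℤ) ∘ₗ
      (AddMonoidAlgebra.coeffLinearEquiv ℂ).toLinearMap : ℂ[T;T⁻¹] →ₗ[ℂ] ℂ).lTensor
        (Disk q 1 ⊗[ℂ] Disk q (-1))

/-- The functional `φ ⊗ ψ` on `𝒜(D²_{q+}) ⊗ 𝒜(D²_{q-})`. -/
def tens {q : QParam} (φ : Disk q 1 →ₗ[ℂ] ℂ) (ψ : Disk q (-1) →ₗ[ℂ] ℂ) :
    Disk q 1 ⊗[ℂ] Disk q (-1) →ₗ[ℂ] ℂ :=
  LinearMap.mul' ℂ ℂ ∘ₗ TensorProduct.map φ ψ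

end SUq2

end

open SUq2

/-!
Everything is computed modulo operators on the span of the basis whose columns are exponentially
small in `2j` (`IsSmall`). They contribute entire functions to the zeta functions.

A symbol is a pair `f = (f_↑, f_↓)` of elements of `𝒜(D²_{q+}) ⊗ 𝒜(D²_{q-}) ⊗ ℂ[u, u⁻¹]`. It has a
truncated model `model q f` on the spinor space: the two disks act on the labels `x` and `y`, the
variable `u` raises `2j` by one, and whatever falls out of the range of the labels is dropped. The
model is not multiplicative, but it is so up to small operators for the generators of interest.
Accordingly `symbolGraph` is the algebra of the pairs `(G, g)` such that left multiplication by
the operator `G` corresponds to left multiplication by the symbol `g`, modulo small operators. The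
symbol is determined by the operator (`symbolGraph_unique`), as the matrix entries of a symbol can
be read off from its model far away from the cutoffs.

The diagonal parts of the four components of the generators, and their adjoints, are weighted
shifts. Replacing each `q`-number by its leading exponential shows that they differ from the
models of the prescribed symbols by small operators (`mem_aPlus`, `mem_aMinus`, `mem_bPlus`,
`mem_bMinus`). The off-diagonal parts are small even after multiplication by `|D|`, and commute
with `|D|` (`isNegligible_shift`). The decomposition of `π(a)`, `π(b)` into eigenvectors of `δ`
shows that `ℬ` is generated by these parts (`gens_subset_algB`, `algB_le_adjoin`) and that `Ψ⁰_P`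
is generated by the diagonal parts, `P^↑` and small off-diagonal operators (`psi0P_le_adjoin`).
Hence every element of `Ψ⁰_P` has a symbol, which defines `(ρ_↑, ρ_↓)` as `symR` and `ρ` as
`symRho`. For uniqueness, an extension of `ρ` sends `P^↑` to a central idempotent, hence kills
every operator exchanging the two spins (`map_offDiag`).

The trace of a model over the eigenspace of `|D|` with eigenvalue `d = m + 1/2` is a sum over the
two spins of products of truncated traces on the two disks. A truncated trace is affine in `d` up
to an exponentially small error, with slope `τ₁` and constant term `τ₀^↑` or `τ₀^↓`. So the trace
over the eigenspace is `α d² + β d + γ` up to an exponentially small error (`exists_levelTr_le`),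
and `ζ_T(z) = α H(z - 2) + β H(z - 1) + γ H(z)` up to an entire function, where `H(z) = ∑ (m +
1/2)^{-z}` is a Hurwitz zeta function (`exists_continuation`). Its only pole is simple, at `1`
with residue `1`; this gives the poles of `ζ_T` and identifies `α`, `β`, `γ` with the residues at
`3`, `2`, `1`. For `Re z > 3` the operator `T |D|^{-z}` is trace class, being the product of the
two Hilbert–Schmidt operators `T |D|^{-z/2}` and `|D|^{-z/2}` (`hasTrace_of_isBdd`).

All three poles occur in the dimension spectrum: `T = 1` has poles at `1` and `3`, and the symbol
of `b̃_- b̃_-^*` has `β ≠ 0` (`exists_resTwo_ne_zero`).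
-/

noncomputable section
namespace SUq2
open Filter Topology LaurentPolynomial
open scoped TensorProduct
variable {q : QParam}

/-! ### Column norms and exponentially small operators -/

/-- The `ℓ¹` norm on the span of an orthonormal basis. -/
def nrm {ι : Type} (v : Core ι) : ℝ := v.sum fun _ c => ‖c‖

section nrm

variable {ι κ : Type}

theorem nrm_eq_of_subset (v : Core ι) {s : Finset ι} (hs : v.support ⊆ s) :
    nrm v = ∑ k ∈ s, ‖v k‖ :=
  Finset.sum_subset hs fun k _ hk => by simpa using hk

theorem nrm_nonneg (v : Core ι) : 0 ≤ nrm v := Finset.sum_nonneg fun _ _ => norm_nonneg _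

@[simp] theorem nrm_zero : nrm (0 : Core ι) = 0 := by simp [nrm]

theorem nrm_add_le (v w : Core ι) : nrm (v + w) ≤ nrm v + nrm w := by
  classical
  rw [nrm_eq_of_subset (v + w) Finsupp.support_add,
    nrm_eq_of_subset v (Finset.subset_union_left (s₂ := w.support)),
    nrm_eq_of_subset w (Finset.subset_union_right (s₁ := v.support)), ← Finset.sum_add_distrib]
  exact Finset.sum_le_sum fun k _ => norm_add_le _ _

theorem nrm_smul (c : ℂ) (v : Core ι) : nrm (c • v) = ‖c‖ * nrm v := by
  rw [nrm_eq_of_subset (c • v) Finsupp.support_smul, nrm_eq_of_subset v subset_rfl,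
    Finset.mul_sum]
  simp

theorem nrm_neg (v : Core ι) : nrm (-v) = nrm v := by
  simpa using nrm_smul (-1) v

@[simp] theorem nrm_single (k : ι) (c : ℂ) : nrm (Finsupp.single k c) = ‖c‖ := by
  simp [nrm]

theorem norm_apply_le_nrm (v : Core ι) (k : ι) : ‖v k‖ ≤ nrm v := by
  classical
  rw [nrm_eq_of_subset v (Finset.subset_insert k v.support)]
  exact Finset.single_le_sum (f := fun k => ‖v k‖) (fun _ _ => norm_nonneg _)
    (Finset.mem_insert_self _ _)

theorem nrm_sum_le {α : Type*} (s : Finset α) (f : α → Core ι) :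
    nrm (∑ k ∈ s, f k) ≤ ∑ k ∈ s, nrm (f k) := by
  classical
  induction s using Finset.induction_on with
  | empty => simp
  | insert a s ha ih =>
    rw [Finset.sum_insert ha, Finset.sum_insert ha]
    exact (nrm_add_le _ _).trans (add_le_add le_rfl ih)

/-- A bound on the columns of `E` met by the support of `v` bounds `E v`. -/
theorem nrm_map_le (E : Core ι →ₗ[ℂ] Core κ) (v : Core ι) (B : ℝ)
    (h : ∀ k ∈ v.support, nrm (E (Finsupp.single k 1)) ≤ B) : nrm (E v) ≤ B * nrm v := by
  have e : E v = ∑ k ∈ v.support, v k • E (Finsupp.single k 1) := by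
    conv_lhs => rw [← Finsupp.sum_single v, Finsupp.sum, map_sum]
    refine Finset.sum_congr rfl fun k _ => ?_
    rw [← map_smul, Finsupp.smul_single, smul_eq_mul, mul_one]
  rw [e, nrm_eq_of_subset v subset_rfl, Finset.mul_sum]
  refine (nrm_sum_le _ _).trans (Finset.sum_le_sum fun k hk => ?_)
  rw [nrm_smul, mul_comm]
  exact mul_le_mul_of_nonneg_right (h k hk) (norm_nonneg _)

theorem ofBasis_apply_single (f : ι → Core ι) (i : ι) (c : ℂ) :
    ofBasis f (Finsupp.single i c) = c • f i := by
  simp [ofBasis]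

theorem op_sub_mul (R S T : Op ι) : (R - S) * T = R * T - S * T := sub_mul R S T

theorem op_mul_sub (R S T : Op ι) : R * (S - T) = R * S - R * T := mul_sub R S T

theorem op_sub_self (T : Op ι) : T - T = 0 := sub_self T

theorem op_ext {S T : Op ι} (h : ∀ i, S (Finsupp.single i 1) = T (Finsupp.single i 1)) : S = T :=
  Finsupp.lhom_ext' fun k => LinearMap.ext_ring (h k)

end nrm

/-- The rate `√q` of exponential decay. It is slower than `q`, so that polynomial factors are
absorbed. -/
def rate (q : QParam) : ℝ := Real.sqrt q

theorem rate_pos (q : QParam) : 0 < rate q := Real.sqrt_pos.2 (qpos q)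

theorem rate_lt_one (q : QParam) : rate q < 1 := by
  rw [rate, Real.sqrt_lt' one_pos]; simpa using q.2.2

theorem rate_sq (q : QParam) : rate q ^ 2 = q := Real.sq_sqrt (qpos q).le

theorem q_le_rate (q : QParam) : (q : ℝ) ≤ rate q := by
  rw [← rate_sq q, sq]
  exact mul_le_of_le_one_left (rate_pos q).le (rate_lt_one q).le

theorem rate_zpow_pos (q : QParam) (n : ℤ) : 0 < rate q ^ n := zpow_pos (rate_pos q) _

theorem Idx.n_nonneg (i : Idx) : 0 ≤ i.n := i.hx.1.trans i.hx.2

/-- The operator `E` has bounded columns. -/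
def IsBdd (E : Op Idx) : Prop := ∃ C : ℝ, 0 ≤ C ∧ ∀ i, nrm (E (Finsupp.single i 1)) ≤ C

/-- The columns of the operator `E` are exponentially small in the spin `n = 2j`. -/
def IsSmall (q : QParam) (E : Op Idx) : Prop :=
  ∃ C : ℝ, 0 ≤ C ∧ ∀ i : Idx, nrm (E (Finsupp.single i 1)) ≤ C * rate q ^ i.n

theorem IsBdd.add {E F : Op Idx} (hE : IsBdd E) (hF : IsBdd F) : IsBdd (E + F) := by
  obtain ⟨C, h0, hC⟩ := hE
  obtain ⟨C', h0', hC'⟩ := hF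
  exact ⟨C + C', by positivity, fun i =>
    (nrm_add_le _ _).trans (add_le_add (hC i) (hC' i))⟩

theorem IsSmall.zero : IsSmall q 0 := ⟨0, le_rfl, fun i => by simp⟩

theorem IsSmall.add {E F : Op Idx} (hE : IsSmall q E) (hF : IsSmall q F) : IsSmall q (E + F) := by
  obtain ⟨C, h0, hC⟩ := hE
  obtain ⟨C', h0', hC'⟩ := hF
  refine ⟨C + C', by positivity, fun i => ?_⟩
  rw [add_mul]
  exact (nrm_add_le _ _).trans (add_le_add (hC i) (hC' i))

theorem IsSmall.smul {E : Op Idx} (c : ℂ) (hE : IsSmall q E) : IsSmall q (c • E) := by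
  obtain ⟨C, h0, hC⟩ := hE
  refine ⟨‖c‖ * C, by positivity, fun i => ?_⟩
  rw [LinearMap.smul_apply, nrm_smul, mul_assoc]
  exact mul_le_mul_of_nonneg_left (hC i) (norm_nonneg c)

theorem IsSmall.sub {E F : Op Idx} (hE : IsSmall q E) (hF : IsSmall q F) : IsSmall q (E - F) := by
  have e : E - F = E + (-1 : ℂ) • F := by module
  exact e ▸ hE.add (hF.smul (-1))

theorem IsSmall.isBdd {E : Op Idx} (hE : IsSmall q E) : IsBdd E := by
  obtain ⟨C, h0, hC⟩ := hE
  refine ⟨C, h0, fun i => (hC i).trans (mul_le_of_le_one_right h0 ?_)⟩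
  obtain ⟨n, hn⟩ := Int.eq_ofNat_of_zero_le i.n_nonneg
  rw [hn, zpow_natCast]
  exact pow_le_one₀ (rate_pos q).le (rate_lt_one q).le

theorem IsBdd.mul_isSmall {E F : Op Idx} (hE : IsBdd E) (hF : IsSmall q F) :
    IsSmall q (E * F) := by
  obtain ⟨C, h0, hC⟩ := hE
  obtain ⟨C', h0', hC'⟩ := hF
  refine ⟨C * C', by positivity, fun i => ?_⟩
  rw [Module.End.mul_apply, mul_assoc]
  exact (nrm_map_le E _ C fun k _ => hC k).trans (mul_le_mul_of_nonneg_left (hC' i) h0)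

/-! ### Weighted shifts of the spinor basis -/

theorem vec_apply (n x y : ℤ) (s : Spin) (k : Idx) :
    vec n x y s k = if k.n = n ∧ k.x = x ∧ k.y = y ∧ k.s = s then 1 else 0 := by
  unfold vec
  split_ifs with h1 h2 h2
  · obtain ⟨kn, kx, ky, ks, hx, hy⟩ := k
    obtain ⟨rfl, rfl, rfl, rfl⟩ := h2
    simp
  · rw [Finsupp.single_apply, if_neg]
    rintro rfl
    exact h2 ⟨rfl, rfl, rfl, rfl⟩
  · obtain ⟨rfl, rfl, rfl, rfl⟩ := h2
    exact absurd ⟨k.hx, k.hy⟩ h1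
  · rfl

theorem vec_idx (i : Idx) : vec i.n i.x i.y i.s = Finsupp.single i 1 := by
  rw [vec, dif_pos ⟨i.hx, i.hy⟩]

theorem nrm_vec_le (n x y : ℤ) (s : Spin) : nrm (vec n x y s) ≤ 1 := by
  unfold vec
  split_ifs <;> simp

/-- The weighted shift `v_{n,x,y,s} ↦ c(n,x,y,s) v_{n+d,x+dx,y+dy,τ(s)}`. -/
def shift (τ : Equiv.Perm Spin) (d dx dy : ℤ) (c : ℤ → ℤ → ℤ → Spin → ℝ) : Op Idx :=
  ofBasis fun i => (c i.n i.x i.y i.s : ℂ) • vec (i.n + d) (i.x + dx) (i.y + dy) (τ i.s)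

section shift

variable (τ : Equiv.Perm Spin) (d dx dy : ℤ) (c c' : ℤ → ℤ → ℤ → Spin → ℝ)

theorem shift_single (i : Idx) : shift τ d dx dy c (Finsupp.single i 1) =
    (c i.n i.x i.y i.s : ℂ) • vec (i.n + d) (i.x + dx) (i.y + dy) (τ i.s) :=
  ofBasis_single _ _

theorem shift_vec (n x y : ℤ) (s : Spin) (h : (0 ≤ x ∧ x ≤ n) ∧ (0 ≤ y ∧ y ≤ yMax n s)) :
    shift τ d dx dy c (vec n x y s) =
      (c n x y s : ℂ) • vec (n + d) (x + dx) (y + dy) (τ s) := by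
  rw [vec, dif_pos h, shift_single]

theorem shift_sub : shift τ d dx dy (fun n x y s => c n x y s - c' n x y s) =
    shift τ d dx dy c - shift τ d dx dy c' := by
  refine op_ext fun i => ?_
  simp [shift_single, sub_smul]

/-- The adjoint of a weighted shift is a weighted shift. -/
theorem isAdj_shift :
    IsAdj (shift τ.symm (-d) (-dx) (-dy) fun n x y s => c (n - d) (x - dx) (y - dy) (τ.symm s))
      (shift τ d dx dy c) := by
  intro i k
  rw [shift_single, shift_single, Finsupp.smul_apply, Finsupp.smul_apply, vec_apply, vec_apply]
  by_cases h : k.n = i.n + d ∧ k.x = i.x + dx ∧ k.y = i.y + dy ∧ k.s = τ i.s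
  · obtain ⟨h1, h2, h3, h4⟩ := h
    simp [h1, h2, h3, h4]
  · rw [if_neg h, if_neg]
    · simp
    · rintro ⟨h1, h2, h3, h4⟩
      refine h ⟨by omega, by omega, by omega, ?_⟩
      rw [h4, Equiv.apply_symm_apply]

/-- A weighted shift is exponentially small if its weights are; only weights between labels in
range matter. -/
theorem isSmall_shift (C : ℝ) (h : ∀ i : Idx,
      (0 ≤ i.x + dx ∧ i.x + dx ≤ i.n + d) ∧ (0 ≤ i.y + dy ∧ i.y + dy ≤ yMax (i.n + d) (τ i.s)) →
      |c i.n i.x i.y i.s| ≤ C * rate q ^ i.n) : IsSmall q (shift τ d dx dy c) := by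
  refine ⟨max C 0, le_max_right _ _, fun i => ?_⟩
  have hr := rate_zpow_pos q i.n
  rw [shift_single, nrm_smul, Complex.norm_real, Real.norm_eq_abs]
  by_cases hi : (0 ≤ i.x + dx ∧ i.x + dx ≤ i.n + d) ∧
      (0 ≤ i.y + dy ∧ i.y + dy ≤ yMax (i.n + d) (τ i.s))
  · calc _ ≤ |c i.n i.x i.y i.s| * 1 :=
          mul_le_mul_of_nonneg_left (nrm_vec_le _ _ _ _) (abs_nonneg _)
      _ ≤ C * rate q ^ i.n := by simpa using h i hi
      _ ≤ _ := mul_le_mul_of_nonneg_right (le_max_left _ _) hr.le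
  · rw [vec, dif_neg hi]
    rw [nrm_zero, mul_zero]
    exact mul_nonneg (le_max_right _ _) hr.le

/-- Smallness of the weights passes to the adjoint weighted shift. -/
theorem isSmall_shift_adj (C : ℝ) (h : ∀ i : Idx, |c i.n i.x i.y i.s| ≤ C * rate q ^ i.n) :
    IsSmall q (shift τ.symm (-d) (-dx) (-dy)
      fun n x y s => c (n - d) (x - dx) (y - dy) (τ.symm s)) := by
  refine isSmall_shift _ _ _ _ _ (C * rate q ^ (-d)) fun i hi => ?_
  have := h ⟨i.n - d, i.x - dx, i.y - dy, τ.symm i.s, by simpa [sub_eq_add_neg] using hi.1,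
    by simpa [sub_eq_add_neg] using hi.2⟩
  rw [mul_assoc, ← zpow_add₀ (rate_pos q).ne']
  convert this using 3
  ring

end shift

theorem IsAdj.add {ι : Type} {S S' T T' : Op ι} (h : IsAdj S T) (h' : IsAdj S' T') :
    IsAdj (S + S') (T + T') := fun i k => by
  simp [h i k, h' i k]

/-! ### The operators `|D|`, `D`, `P^↑`, `P^↓` -/

/-- The eigenvalue of `|D|` on vectors with labels `n = 2j` and `s`. -/
def absEv (n : ℤ) : Spin → ℝ
  | .up => n + 3 / 2
  | .dn => n + 1 / 2

theorem abs_diracEv (i : Idx) : |diracEv i| = absEv i.n i.s := by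
  have h : (0 : ℝ) ≤ i.n := by exact_mod_cast i.n_nonneg
  obtain ⟨n, x, y, s, hx, hy⟩ := i
  rcases s with _ | _
  · exact abs_of_nonneg (by simp only [diracEv]; linarith)
  · simp only [diracEv, absEv, abs_neg]
    exact abs_of_nonneg (by linarith)

theorem half_le_absEv (i : Idx) : 1 / 2 ≤ absEv i.n i.s := by
  have h : (0 : ℝ) ≤ i.n := by exact_mod_cast i.n_nonneg
  cases i.s <;> simp only [absEv] <;> linarith

theorem absEv_pos (i : Idx) : 0 < absEv i.n i.s := by linarith [half_le_absEv i]

theorem absDirac_single (i : Idx) (c : ℂ) :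
    absDirac (Finsupp.single i c) = ((absEv i.n i.s : ℝ) : ℂ) • Finsupp.single i c := by
  rw [absDirac, diag, ofBasis_apply_single, abs_diracEv]
  simp [mul_comm]

theorem absDirac_vec (n x y : ℤ) (s : Spin) :
    absDirac (vec n x y s) = ((absEv n s : ℝ) : ℂ) • vec n x y s := by
  unfold vec
  split_ifs with h
  · rw [absDirac_single]
  · simp

/-- The sign of the Dirac operator on the two spin components. -/
def spinSign : Spin → ℂ
  | .up => 1
  | .dn => -1

theorem diracEv_eq (i : Idx) : (diracEv i : ℂ) = spinSign i.s * (absEv i.n i.s : ℝ) := by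
  obtain ⟨n, x, y, s, hx, hy⟩ := i
  rcases s with _ | _ <;> simp [diracEv, absEv, spinSign]

theorem signD_single (i : Idx) (c : ℂ) :
    signD (Finsupp.single i c) = spinSign i.s • Finsupp.single i c := by
  rw [signD, diag, ofBasis_apply_single]
  have h : (absEv i.n i.s : ℂ) ≠ 0 := by exact_mod_cast (absEv_pos i).ne'
  push_cast
  rw [diracEv_eq, abs_diracEv, mul_div_cancel_right₀ _ h]
  simp [mul_comm]

theorem pUp_single (i : Idx) (c : ℂ) :
    pUp (Finsupp.single i c) = if i.s = .up then Finsupp.single i c else 0 := by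
  rw [pUp, LinearMap.smul_apply, LinearMap.add_apply, signD_single, Module.End.one_apply]
  cases h : i.s
  · simp only [spinSign, one_smul, if_true]
    rw [← two_smul ℂ, smul_smul]
    norm_num
  · simp [spinSign]

theorem pDn_eq : pDn = 1 - pUp := by
  rw [pDn, pUp]; module

theorem pDn_single (i : Idx) (c : ℂ) :
    pDn (Finsupp.single i c) = if i.s = .dn then Finsupp.single i c else 0 := by
  rw [pDn_eq, LinearMap.sub_apply, pUp_single, Module.End.one_apply]
  cases h : i.s <;> simp

theorem pUp_vec (n x y : ℤ) (s : Spin) :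
    pUp (vec n x y s) = if s = .up then vec n x y s else 0 := by
  unfold vec
  split_ifs with h1 h2 h2
  · rw [pUp_single, if_pos h2]
  · rw [pUp_single, if_neg h2]
  · simp
  · simp

theorem pDn_vec (n x y : ℤ) (s : Spin) :
    pDn (vec n x y s) = if s = .dn then vec n x y s else 0 := by
  rw [pDn_eq, LinearMap.sub_apply, pUp_vec, Module.End.one_apply]
  cases s <;> simp

theorem signD_eq : signD = pUp - pDn := by
  rw [pDn, pUp]; module

theorem dirac_eq : dirac = signD * absDirac := by
  refine op_ext fun i => ?_
  rw [Module.End.mul_apply, absDirac_single, map_smul, signD_single, dirac, diag, ofBasis_single,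
    diracEv_eq]
  simp [mul_comm]

theorem pUp_mul_absDirac : pUp * absDirac = absDirac * pUp := by
  refine op_ext fun i => ?_
  rw [Module.End.mul_apply, Module.End.mul_apply, absDirac_single, map_smul, pUp_single]
  split_ifs with h
  · rw [absDirac_single]
  · simp

theorem signD_mul_absDirac : signD * absDirac = absDirac * signD := by
  rw [signD_eq, pDn_eq, op_sub_mul, op_sub_mul, op_mul_sub, op_mul_sub, pUp_mul_absDirac,
    one_mul, mul_one]

/-! ### The truncated model of a symbol -/

/-- The bilinear map `(ε_x, ε_y) ↦ v_{m,x,y,s}`; labels out of range are sent to `0`. -/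
def lam (m : ℤ) (s : Spin) : Core ℕ →ₗ[ℂ] Core ℕ →ₗ[ℂ] Core Idx :=
  Finsupp.linearCombination ℂ fun x : ℕ =>
    Finsupp.linearCombination ℂ fun y : ℕ => vec m x y s

theorem lam_single (m : ℤ) (s : Spin) (x y : ℕ) :
    lam m s (Finsupp.single x 1) (Finsupp.single y 1) = vec m x y s := by
  simp [lam]

/-- A bilinear map bounded by `B` on pairs of basis vectors is bounded by `B`. -/
theorem nrm_bilin_le (β : Core ℕ →ₗ[ℂ] Core ℕ →ₗ[ℂ] Core Idx) (B : ℝ)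
    (h : ∀ x y : ℕ, nrm (β (Finsupp.single x 1) (Finsupp.single y 1)) ≤ B) (v w : Core ℕ) :
    nrm (β v w) ≤ B * (nrm v * nrm w) := by
  rw [mul_comm (nrm v), ← mul_assoc]
  refine nrm_map_le (β.flip w) v _ fun x _ => ?_
  exact nrm_map_le (β (Finsupp.single x 1)) w _ fun y _ => h x y

theorem nrm_lam_le (m : ℤ) (s : Spin) (v w : Core ℕ) : nrm (lam m s v w) ≤ nrm v * nrm w := by
  have := nrm_bilin_le (lam m s) 1 (fun x y => by
    rw [lam_single]; exact nrm_vec_le _ _ _ _) v w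
  rwa [one_mul] at this

theorem lam_apply (m : ℤ) (s : Spin) (v w : Core ℕ) (k : Idx) :
    lam m s v w k = if k.n = m ∧ k.s = s then v k.x.toNat * w k.y.toNat else 0 := by
  have hx : ((k.x.toNat : ℕ) : ℤ) = k.x := Int.toNat_of_nonneg k.hx.1
  have hy : ((k.y.toNat : ℕ) : ℤ) = k.y := Int.toNat_of_nonneg k.hy.1
  have hxy : ∀ x y : ℕ, vec m x y s k =
      if k.n = m ∧ k.s = s then
        (Finsupp.single x (1 : ℂ) k.x.toNat * Finsupp.single y (1 : ℂ) k.y.toNat) else 0 := by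
    intro x y
    rw [vec_apply, Finsupp.single_apply, Finsupp.single_apply]
    have e1 : k.x = x ↔ x = k.x.toNat := by omega
    have e2 : k.y = y ↔ y = k.y.toNat := by omega
    simp only [e1, e2]
    split_ifs <;> simp_all
  induction v using Finsupp.induction_linear with
  | zero => simp
  | add v v' hv hv' =>
    rw [map_add, LinearMap.add_apply, Finsupp.add_apply, hv, hv', Finsupp.add_apply]
    split_ifs <;> ring
  | single x a =>
    induction w using Finsupp.induction_linear with
    | zero => simp
    | add w w' hw hw' =>
      rw [map_add, Finsupp.add_apply, hw, hw', Finsupp.add_apply]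
      split_ifs <;> ring
    | single y b =>
      have ea : (Finsupp.single x a : Core ℕ) = a • Finsupp.single x 1 := by simp
      have eb : (Finsupp.single y b : Core ℕ) = b • Finsupp.single y 1 := by simp
      rw [ea, eb, map_smul, map_smul, LinearMap.smul_apply, lam_single, Finsupp.smul_apply,
        Finsupp.smul_apply, hxy, Finsupp.smul_apply, Finsupp.smul_apply]
      simp only [smul_eq_mul]
      split_ifs <;> ring

theorem lam_support {m : ℤ} {s : Spin} {v w : Core ℕ} {k : Idx}
    (hk : k ∈ (lam m s v w).support) : k.n = m ∧ k.s = s := by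
  rw [Finsupp.mem_support_iff, lam_apply] at hk
  by_contra h
  exact hk (if_neg h)

/-- The column `X ε_x` of an element of the quantum disk. -/
def diskCol (q : QParam) (ε : ℤˣ) (x : ℕ) : Disk q ε →ₗ[ℂ] Core ℕ :=
  LinearMap.applyₗ (Finsupp.single x (1 : ℂ)) ∘ₗ (Disk q ε).val.toLinearMap

theorem diskCol_apply {ε : ℤˣ} (x : ℕ) (X : Disk q ε) :
    diskCol q ε x X = (X : Op ℕ) (Finsupp.single x 1) := rfl

theorem exists_nrm_diskCol_le {ε : ℤˣ} (X : Disk q ε) :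
    ∃ M : ℝ, 0 ≤ M ∧ ∀ x, nrm (diskCol q ε x X) ≤ M := by
  obtain ⟨M, hM⟩ := (hasSymbol_symb X).bound
  exact ⟨M, (l1_nonneg _).trans (hM 0), hM⟩

/-- The column at the label `i` of the truncated model of a symbol:
`(X ⊗ Y) ⊗ u^l` sends `v_{n,x,y,s}` to the vector `X ε_x ⊗ Y ε_y` placed at `n + l`. -/
def mcol (q : QParam) (i : Idx) : SymbolAlg q →ₗ[ℂ] Core Idx :=
  TensorProduct.lift (LinearMap.flip
    (Finsupp.linearCombination ℂ (fun l : ℤ => TensorProduct.lift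
      ((lam (i.n + l) i.s).compl₁₂ (diskCol q 1 i.x.toNat) (diskCol q (-1) i.y.toNat))) ∘ₗ
      (AddMonoidAlgebra.coeffLinearEquiv ℂ).toLinearMap))

theorem mcol_pure (i : Idx) (X : Disk q 1) (Y : Disk q (-1)) (l : ℤ) :
    mcol q i ((X ⊗ₜ Y) ⊗ₜ T l) =
      lam (i.n + l) i.s (diskCol q 1 i.x.toNat X) (diskCol q (-1) i.y.toNat Y) := by
  have h : (AddMonoidAlgebra.coeffLinearEquiv ℂ) (T l : ℂ[T;T⁻¹]) = Finsupp.single l 1 := rfl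
  simp [mcol, h]

/-- Symbols are sums of pure tensors `(X ⊗ Y) ⊗ u^l`. -/
theorem symbolAlg_induction {P : SymbolAlg q → Prop}
    (pure : ∀ (X : Disk q 1) (Y : Disk q (-1)) (l : ℤ), P ((X ⊗ₜ Y) ⊗ₜ T l))
    (add : ∀ f g, P f → P g → P (f + g)) (f : SymbolAlg q) : P f := by
  have h0 : P 0 := by simpa using pure 0 0 0
  induction f using TensorProduct.induction_on with
  | zero => exact h0
  | add f g hf hg => exact add f g hf hg
  | tmul h p =>
    induction p using LaurentPolynomial.induction_on' with
    | add p p' hp hp' => rw [TensorProduct.tmul_add]; exact add _ _ hp hp'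
    | C_mul_T l c =>
      induction h using TensorProduct.induction_on with
      | zero => simpa using h0
      | add h h' hh hh' => rw [TensorProduct.add_tmul]; exact add _ _ hh hh'
      | tmul X Y =>
        rw [← LaurentPolynomial.smul_eq_C_mul, TensorProduct.tmul_smul, TensorProduct.smul_tmul',
          TensorProduct.smul_tmul']
        exact pure _ _ _

/-- The truncated model of a pair of symbols, one for each spin. -/
def model (q : QParam) : (Spin → SymbolAlg q) →ₗ[ℂ] Op Idx where
  toFun f := ofBasis fun i => mcol q i (f i.s)
  map_add' f g := op_ext fun i => by simp [ofBasis_single]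
  map_smul' c f := op_ext fun i => by simp [ofBasis_single]

theorem model_single (f : Spin → SymbolAlg q) (i : Idx) :
    model q f (Finsupp.single i 1) = mcol q i (f i.s) := ofBasis_single _ _

theorem exists_nrm_mcol_le (h : SymbolAlg q) : ∃ C : ℝ, 0 ≤ C ∧ ∀ i, nrm (mcol q i h) ≤ C := by
  induction h using symbolAlg_induction with
  | add f g hf hg =>
    obtain ⟨C, h0, hC⟩ := hf
    obtain ⟨C', h0', hC'⟩ := hg
    refine ⟨C + C', by positivity, fun i => ?_⟩
    rw [map_add]
    exact (nrm_add_le _ _).trans (add_le_add (hC i) (hC' i))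
  | pure X Y l =>
    obtain ⟨M, hM0, hM⟩ := exists_nrm_diskCol_le X
    obtain ⟨M', hM0', hM'⟩ := exists_nrm_diskCol_le Y
    refine ⟨M * M', by positivity, fun i => ?_⟩
    rw [mcol_pure]
    exact (nrm_lam_le _ _ _ _).trans (mul_le_mul (hM _) (hM' _) (nrm_nonneg _) hM0)

/-- A bound for columns, given separately for the two spins, gives a common bound. -/
theorem exists_common_bound {F : Spin → Idx → ℝ}
    (h : ∀ s, ∃ C : ℝ, 0 ≤ C ∧ ∀ i, F s i ≤ C * rate q ^ i.n) :
    ∃ C : ℝ, 0 ≤ C ∧ ∀ s i, F s i ≤ C * rate q ^ i.n := by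
  choose C h0 hC using h
  refine ⟨C .up + C .dn, add_nonneg (h0 _) (h0 _), fun s i => (hC s i).trans ?_⟩
  refine mul_le_mul_of_nonneg_right ?_ (rate_zpow_pos q _).le
  have h1 := h0 .up
  have h2 := h0 .dn
  cases s <;> linarith

theorem isBdd_model (f : Spin → SymbolAlg q) : IsBdd (model q f) := by
  choose C h0 hC using fun s => exists_nrm_mcol_le (f s)
  refine ⟨C .up + C .dn, add_nonneg (h0 _) (h0 _), fun i => ?_⟩
  rw [model_single]
  refine (hC i.s i).trans ?_
  have h1 := h0 .up
  have h2 := h0 .dn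
  cases i.s <;> linarith

/-- An exponentially small operator stays so after composition with a model. -/
theorem IsSmall.mul_model {E : Op Idx} (hE : IsSmall q E) (f : Spin → SymbolAlg q) :
    IsSmall q (E * model q f) := by
  obtain ⟨C₀, hC₀, hE⟩ := hE
  have key : ∀ h : SymbolAlg q, ∃ C : ℝ, 0 ≤ C ∧ ∀ i, nrm (E (mcol q i h)) ≤ C * rate q ^ i.n := by
    intro h
    induction h using symbolAlg_induction with
    | add f g hf hg =>
      obtain ⟨C, h0, hC⟩ := hf
      obtain ⟨C', h0', hC'⟩ := hg
      refine ⟨C + C', by positivity, fun i => ?_⟩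
      rw [map_add, map_add, add_mul]
      exact (nrm_add_le _ _).trans (add_le_add (hC i) (hC' i))
    | pure X Y l =>
      obtain ⟨C, h0, hC⟩ := exists_nrm_mcol_le ((X ⊗ₜ[ℂ] Y) ⊗ₜ[ℂ] (T l : ℂ[T;T⁻¹]))
      refine ⟨C₀ * rate q ^ l * C, mul_nonneg (mul_nonneg hC₀ (rate_zpow_pos q l).le) h0,
        fun i => ?_⟩
      have h1 := nrm_map_le E (mcol q i ((X ⊗ₜ Y) ⊗ₜ T l)) (C₀ * rate q ^ (i.n + l))
        fun k hk => by
          rw [mcol_pure] at hk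
          rw [← (lam_support hk).1]
          exact hE k
      refine h1.trans ?_
      rw [zpow_add₀ (rate_pos q).ne']
      have h2 := mul_le_mul_of_nonneg_left (hC i)
        (mul_nonneg hC₀ (mul_pos (rate_zpow_pos q i.n) (rate_zpow_pos q l)).le)
      linarith
  obtain ⟨C, h0, hC⟩ := exists_common_bound fun s => key (f s)
  exact ⟨C, h0, fun i => by rw [Module.End.mul_apply, model_single]; exact hC i.s i⟩

/-! ### Matrix entries of symbols -/

/-- The matrix entry `⟨ε_x', X ε_x⟩` of an element of the quantum disk. -/
def entry (q : QParam) (ε : ℤˣ) (x x' : ℕ) : Disk q ε →ₗ[ℂ] ℂ :=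
  Finsupp.lapply x' ∘ₗ diskCol q ε x

/-- The coefficient of `u^l` of a Laurent polynomial. -/
def lcoeff (l : ℤ) : ℂ[T;T⁻¹] →ₗ[ℂ] ℂ :=
  Finsupp.lapply l ∘ₗ (AddMonoidAlgebra.coeffLinearEquiv ℂ).toLinearMap

theorem lcoeff_T (l m : ℤ) : lcoeff l (T m) = if m = l then 1 else 0 := by
  change (Finsupp.single m (1 : ℂ)) l = _
  rw [Finsupp.single_apply]

/-- The functional `φ ⊗ ψ` on a tensor product. -/
def tensorFun {V W : Type*} [AddCommMonoid V] [Module ℂ V] [AddCommMonoid W] [Module ℂ W]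
    (φ : V →ₗ[ℂ] ℂ) (ψ : W →ₗ[ℂ] ℂ) : V ⊗[ℂ] W →ₗ[ℂ] ℂ :=
  LinearMap.mul' ℂ ℂ ∘ₗ TensorProduct.map φ ψ

theorem tensorFun_tmul {V W : Type*} [AddCommMonoid V] [Module ℂ V] [AddCommMonoid W] [Module ℂ W]
    (φ : V →ₗ[ℂ] ℂ) (ψ : W →ₗ[ℂ] ℂ) (v : V) (w : W) :
    tensorFun φ ψ (v ⊗ₜ w) = φ v * ψ w := by
  simp [tensorFun]

/-- Products of separating families of functionals separate the points of a tensor product. -/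
theorem tensorFun_separating {V W I J : Type*} [AddCommMonoid V] [Module ℂ V] [AddCommMonoid W]
    [Module ℂ W] [Module.Free ℂ W] (φ : I → V →ₗ[ℂ] ℂ) (ψ : J → W →ₗ[ℂ] ℂ)
    (hφ : ∀ v, (∀ i, φ i v = 0) → v = 0) (hψ : ∀ w, (∀ j, ψ j w = 0) → w = 0)
    (t : V ⊗[ℂ] W) (ht : ∀ i j, tensorFun (φ i) (ψ j) t = 0) : t = 0 := by
  classical
  let b := Module.Free.chooseBasis ℂ W
  let e := TensorProduct.equivFinsuppOfBasisRight (M := V) b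
  -- `(φ ⊗ id) t` is the vector of `W` with coordinates `φ (e t k)`
  have key : ∀ (t : V ⊗[ℂ] W) (i : I) (j : J), tensorFun (φ i) (ψ j) t =
      ψ j (Finsupp.linearCombination ℂ b (Finsupp.mapRange.linearMap (φ i) (e t))) := by
    intro t i j
    induction t using TensorProduct.induction_on with
    | zero => simp
    | add t t' h h' => simp only [map_add, h, h']
    | tmul v w =>
      have h : Finsupp.mapRange.linearMap (φ i) (e (v ⊗ₜ w)) = φ i v • b.repr w := by
        ext k
        simp [e, TensorProduct.equivFinsuppOfBasisRight_apply_tmul, mul_comm]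
      rw [h, map_smul, b.linearCombination_repr, tensorFun_tmul, map_smul, smul_eq_mul]
  apply e.injective
  rw [map_zero]
  ext k
  refine hφ _ fun i => ?_
  have h0 := hψ _ fun j => (key t i j).symm.trans (ht i j)
  have h1 := b.linearIndependent (h0.trans (map_zero _).symm)
  simpa using DFunLike.congr_fun h1 k

/-- The matrix entries of a symbol, acting on `ε_x ⊗ ε_y` and by multiplication on `ℂ[u, u⁻¹]`. -/
def symEntry (q : QParam) (x x' y y' : ℕ) (l : ℤ) : SymbolAlg q →ₗ[ℂ] ℂ :=
  tensorFun (tensorFun (entry q 1 x x') (entry q (-1) y y')) (lcoeff l)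

theorem mcol_apply (i k : Idx) (h : SymbolAlg q) :
    mcol q i h k = if k.s = i.s then
      symEntry q i.x.toNat k.x.toNat i.y.toNat k.y.toNat (k.n - i.n) h else 0 := by
  induction h using symbolAlg_induction with
  | add f g hf hg =>
    rw [map_add, Finsupp.add_apply, hf, hg, map_add]
    split_ifs <;> ring
  | pure X Y l =>
    rw [mcol_pure, lam_apply, symEntry, tensorFun_tmul, tensorFun_tmul, lcoeff_T]
    have e : l = k.n - i.n ↔ k.n = i.n + l := by omega
    simp only [e, entry, LinearMap.comp_apply, Finsupp.lapply_apply]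
    by_cases h1 : k.n = i.n + l <;> by_cases h2 : k.s = i.s <;> simp [h1, h2]

theorem entry_separating (q : QParam) (ε : ℤˣ) (X : Disk q ε)
    (h : ∀ p : ℕ × ℕ, entry q ε p.1 p.2 X = 0) : X = 0 :=
  Subtype.ext (op_ext fun x => Finsupp.ext fun x' => h (x, x'))

instance disk_free (q : QParam) (ε : ℤˣ) : Module.Free ℂ (Disk q ε) :=
  let _ : AddCommGroup (Disk q ε) := Module.addCommMonoidToAddCommGroup ℂ
  Module.Free.of_divisionRing ℂ (Disk q ε)

theorem symbolAlg_eq_zero (h : SymbolAlg q)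
    (h0 : ∀ x x' y y' l, symEntry q x x' y y' l h = 0) : h = 0 := by
  refine tensorFun_separating
    (fun p : (ℕ × ℕ) × (ℕ × ℕ) =>
      tensorFun (entry q 1 p.1.1 p.1.2) (entry q (-1) p.2.1 p.2.2)) lcoeff ?_ ?_ h
    fun p l => h0 _ _ _ _ _
  · exact fun v hv => tensorFun_separating _ _ (entry_separating q 1) (entry_separating q (-1)) v
      fun i j => hv (i, j)
  · intro w hw
    ext l
    exact hw l

/-- Truncation loses no information: far from the cutoffs, the matrix entries of the model are those
of the symbol, and the latter separate symbols. -/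
theorem model_eq_zero_of_isSmall (f : Spin → SymbolAlg q) (hf : IsSmall q (model q f)) :
    f = 0 := by
  obtain ⟨C, h0, hC⟩ := hf
  funext s
  refine symbolAlg_eq_zero _ fun x x' y y' l => ?_
  have hlim : Tendsto (fun n : ℕ => C * rate q ^ n) atTop (𝓝 0) := by
    simpa using (tendsto_pow_atTop_nhds_zero_of_lt_one (rate_pos q).le
      (rate_lt_one q)).const_mul C
  -- the matrix entry does not depend on `n`, and is exponentially small in `n`
  refine norm_le_zero_iff.1 (ge_of_tendsto hlim ?_)
  filter_upwards [eventually_ge_atTop (x + x' + y + y' + l.natAbs + 1)] with n hn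
  have hs : ∀ m : ℤ, m - 1 ≤ yMax m s := fun m => by cases s <;> simp [yMax]; omega
  have h1 := hs n
  have h2 := hs (n + l)
  let i : Idx := ⟨n, x, y, s, by omega, by omega⟩
  let k : Idx := ⟨n + l, x', y', s, by omega, by omega⟩
  have h3 := (norm_apply_le_nrm _ k).trans (hC i)
  rw [model_single, mcol_apply, if_pos rfl] at h3
  simpa [i, k] using h3

/-! ### Operators with a symbol -/

-- Shortcuts for the instance search; they are definitionally the general instances.
local instance symbolAlgMul (q : QParam) : Mul (SymbolAlg q) := Algebra.TensorProduct.instMul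

local instance symbolAlgSemiring (q : QParam) : Semiring (SymbolAlg q) :=
  Algebra.TensorProduct.instSemiring

local instance symbolAlgAlgebra (q : QParam) : Algebra ℂ (SymbolAlg q) :=
  Algebra.TensorProduct.instAlgebra

local instance symbolPairSemigroup (q : QParam) : Semigroup (Spin → SymbolAlg q) :=
  @Pi.semigroup Spin _ fun _ =>
    @Monoid.toSemigroup _ (MonoidWithZero.toMonoid (M₀ := SymbolAlg q))

local instance symbolPairSemiring (q : QParam) : Semiring (Spin → SymbolAlg q) := Pi.semiring

theorem model_one : model q 1 = 1 := by
  refine op_ext fun i => ?_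
  have h : ((1 : Spin → SymbolAlg q) i.s) = ((1 : Disk q 1) ⊗ₜ (1 : Disk q (-1))) ⊗ₜ T 0 := rfl
  have hx : ((i.x.toNat : ℕ) : ℤ) = i.x := Int.toNat_of_nonneg i.hx.1
  have hy : ((i.y.toNat : ℕ) : ℤ) = i.y := Int.toNat_of_nonneg i.hy.1
  rw [model_single, h, mcol_pure, diskCol_apply, diskCol_apply]
  simp only [OneMemClass.coe_one, Module.End.one_apply]
  rw [lam_single, hx, hy, add_zero, vec_idx]

/-- Left multiplication by the operator `G` acts on symbols as left multiplication by `g`, up to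
exponentially small operators. -/
def ActsAs (q : QParam) (G : Op Idx) (g : Spin → SymbolAlg q) : Prop :=
  ∀ T f, IsSmall q (T - model q f) → IsSmall q (G * T - model q (g * f))

theorem ActsAs.mul {S T : Op Idx} {f g : Spin → SymbolAlg q} (hS : ActsAs q S f)
    (hT : ActsAs q T g) : ActsAs q (S * T) (f * g) := by
  intro U h hU
  rw [mul_assoc, mul_assoc f]
  exact hS _ _ (hT _ _ hU)

theorem ActsAs.add {S T : Op Idx} {f g : Spin → SymbolAlg q} (hS : ActsAs q S f)
    (hT : ActsAs q T g) : ActsAs q (S + T) (f + g) := by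
  intro U h hU
  have e : (S + T) * U - model q ((f + g) * h) =
      (S * U - model q (f * h)) + (T * U - model q (g * h)) := by
    rw [add_mul, add_mul, map_add]
    module
  rw [e]
  exact (hS _ _ hU).add (hT _ _ hU)

theorem ActsAs.scalar (c : ℂ) :
    ActsAs q (algebraMap ℂ (Op Idx) c) (algebraMap ℂ (Spin → SymbolAlg q) c) := by
  intro S f h
  have e : algebraMap ℂ (Op Idx) c * S - model q (algebraMap ℂ (Spin → SymbolAlg q) c * f) =
      c • (S - model q f) := by
    rw [← Algebra.smul_def, ← Algebra.smul_def, LinearMap.map_smul]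
    module
  rw [e]
  exact h.smul c

/-- The algebra of pairs of an operator and a symbol by which it acts. The second component is
determined by the first. -/
def symbolGraph (q : QParam) : Subalgebra ℂ (Op Idx × (Spin → SymbolAlg q)) where
  carrier := {p | ActsAs q p.1 p.2}
  mul_mem' hp hp' := hp.mul hp'
  add_mem' hp hp' := hp.add hp'
  algebraMap_mem' c := ActsAs.scalar c

theorem isSmall_sub_model {S : Op Idx} {f : Spin → SymbolAlg q} (h : (S, f) ∈ symbolGraph q) :
    IsSmall q (S - model q f) := by
  have h1 : (1 : Op Idx) - model q 1 = 0 := by rw [model_one]; exact op_sub_self 1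
  have h2 := h 1 1 (by rw [h1]; exact IsSmall.zero)
  rwa [mul_one, mul_one] at h2

/-- An operator has at most one symbol. -/
theorem symbolGraph_unique {S : Op Idx} {f g : Spin → SymbolAlg q} (hf : (S, f) ∈ symbolGraph q)
    (hg : (S, g) ∈ symbolGraph q) : f = g := by
  have h := (isSmall_sub_model hg).sub (isSmall_sub_model hf)
  have e : (S - model q g) - (S - model q f) = model q (f + (-1 : ℂ) • g) := by
    rw [LinearMap.map_add, LinearMap.map_smul]; module
  rw [e] at h
  have h0 := model_eq_zero_of_isSmall _ h
  have e' : f = (f + (-1 : ℂ) • g) + g := by module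
  rw [e', h0, zero_add]

/-- It suffices to check multiplicativity on models. -/
theorem mem_symbolGraph {G : Op Idx} {g : Spin → SymbolAlg q} (h : IsSmall q (G - model q g))
    (hmul : ∀ f, IsSmall q (model q g * model q f - model q (g * f))) :
    (G, g) ∈ symbolGraph q := by
  intro S f hS
  have hG : IsBdd G := by
    have e : G = (G - model q g) + model q g := by module
    rw [e]
    exact h.isBdd.add (isBdd_model g)
  have e : G * S - model q (g * f) = G * (S - model q f) +
      ((G - model q g) * model q f + (model q g * model q f - model q (g * f))) := by
    rw [op_sub_mul, op_mul_sub]; module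
  rw [e]
  exact (hG.mul_isSmall hS).add ((h.mul_model f).add (hmul f))

/-- Exponentially small operators have symbol `0`. -/
theorem mem_symbolGraph_of_isSmall {E : Op Idx} (h : IsSmall q E) :
    (E, (0 : Spin → SymbolAlg q)) ∈ symbolGraph q := by
  refine mem_symbolGraph ?_ fun f => ?_
  · have e : E - model q 0 = E := by rw [LinearMap.map_zero]; module
    rwa [e]
  · have e : model q 0 * model q f - model q (0 * f) = 0 := by
      rw [zero_mul, LinearMap.map_zero, zero_mul]; exact op_sub_self 0
    rw [e]
    exact IsSmall.zero

/-- The symbol of `P^↑` is the idempotent `(1, 0)`, supported on the component of spin `↑`. -/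
theorem mem_symbolGraph_pUp : (pUp, Pi.single Spin.up 1) ∈ symbolGraph q := by
  have hmul : ∀ f, model q (Pi.single Spin.up 1 * f) = pUp * model q f := by
    intro f
    refine op_ext fun i => ?_
    have hcol : ∀ h : SymbolAlg q, pUp (mcol q i h) = if i.s = .up then mcol q i h else 0 := by
      intro h
      have e : mcol q i h = ∑ k ∈ (mcol q i h).support, Finsupp.single k (mcol q i h k) :=
        (Finsupp.sum_single _).symm
      have e' : pUp (mcol q i h) = ∑ k ∈ (mcol q i h).support,
          if i.s = .up then Finsupp.single k (mcol q i h k) else 0 := by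
        conv_lhs => rw [e]
        rw [map_sum]
        refine Finset.sum_congr rfl fun k hk => ?_
        have hs : k.s = i.s := by
          rw [Finsupp.mem_support_iff, mcol_apply] at hk
          by_contra h
          exact hk (if_neg h)
        rw [pUp_single, hs]
      rw [e']
      split_ifs
      · exact e.symm
      · simp
    rw [Module.End.mul_apply, model_single, model_single, hcol, Pi.mul_apply]
    split_ifs with hs
    · rw [hs, Pi.single_eq_same, one_mul]
    · rw [Pi.single_eq_of_ne hs, zero_mul, LinearMap.map_zero]
  have h1 : model q (Pi.single Spin.up 1) = pUp := by
    have := hmul 1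
    rwa [model_one, mul_one, mul_one] at this
  refine mem_symbolGraph ?_ fun f => ?_
  · have e : pUp - model q (Pi.single Spin.up 1) = 0 := by rw [h1]; exact op_sub_self _
    rw [e]
    exact IsSmall.zero
  · have e : model q (Pi.single Spin.up 1) * model q f - model q (Pi.single Spin.up 1 * f) = 0 := by
      rw [h1, hmul]; exact op_sub_self _
    rw [e]
    exact IsSmall.zero

/-! ### Generators of the symbol algebra -/

/-- The element `A` of the quantum disk is the weighted shift `ε_x ↦ α(x) ε_{x+dx}`. -/
def IsDiskShift {ε : ℤˣ} (A : Disk q ε) (dx : ℤ) (α : ℤ → ℝ) : Prop :=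
  ∀ x : ℕ, (A : Op ℕ) (Finsupp.single x 1) = (α x : ℂ) • evec (x + dx)

theorem isDiskShift_diskA (ε : ℤˣ) :
    IsDiskShift (diskA q ε) 1 fun x => Real.sqrt (1 - (q : ℝ) ^ (2 * x + 2)) := by
  intro x
  have h : evec ((x : ℤ) + 1) = Finsupp.single (x + 1) 1 := by
    rw [evec, if_pos (by positivity)]
    congr 1
  change piA q _ = _
  rw [h, piA, ofBasis_single, Finsupp.smul_single, smul_eq_mul, mul_one]
  norm_cast

theorem isDiskShift_diskAStar (ε : ℤˣ) :
    IsDiskShift (diskAStar q ε) (-1) fun x => Real.sqrt (1 - (q : ℝ) ^ (2 * x)) := by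
  intro x
  change piAStar q _ = _
  rw [piAStar, ofBasis_single]
  rcases x with _ | x
  · simp
  · have h : evec (((x + 1 : ℕ) : ℤ) + -1) = Finsupp.single x 1 := by
      have : ((x + 1 : ℕ) : ℤ) + -1 = x := by push_cast; ring
      rw [this, evec, if_pos (by positivity)]
      congr 1
    rw [h, Nat.add_sub_cancel, Finsupp.smul_single, smul_eq_mul, mul_one]
    norm_cast

theorem isDiskShift_diskB (ε : ℤˣ) :
    IsDiskShift (diskB q ε) 0 fun x => ((ε : ℤ) : ℝ) * (q : ℝ) ^ x := by
  intro x
  have h : evec ((x : ℤ) + 0) = Finsupp.single x 1 := by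
    rw [add_zero, evec, if_pos (by positivity)]
    congr 1
  change piB q ε _ = _
  rw [h, piB, ofBasis_single, Finsupp.smul_single, smul_eq_mul, mul_one]
  push_cast
  rw [zpow_natCast]

theorem lam_evec (m : ℤ) (s : Spin) (x y : ℤ) : lam m s (evec x) (evec y) = vec m x y s := by
  unfold evec
  split_ifs with hx hy
  · rw [lam_single, Int.toNat_of_nonneg hx, Int.toNat_of_nonneg hy]
  · rw [map_zero, vec, dif_neg (by omega)]
  · rw [map_zero, LinearMap.zero_apply, vec, dif_neg (by omega)]
  · rw [map_zero, vec, dif_neg (by omega)]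

/-- The constant pair of symbols with value `z (A ⊗ B) ⊗ u^l`. -/
def genSymbol (z : ℂ) (A : Disk q 1) (B : Disk q (-1)) (l : ℤ) : Spin → SymbolAlg q :=
  fun _ => z • ((A ⊗ₜ B) ⊗ₜ T l)

theorem model_genSymbol {A : Disk q 1} {B : Disk q (-1)} {dx dy : ℤ} {α β : ℤ → ℝ}
    (hA : IsDiskShift A dx α) (hB : IsDiskShift B dy β) (z : ℝ) (l : ℤ) :
    model q (genSymbol z A B l) = shift 1 l dx dy fun _ x y _ => z * (α x * β y) := by
  refine op_ext fun i => ?_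
  have hx : ((i.x.toNat : ℕ) : ℤ) = i.x := Int.toNat_of_nonneg i.hx.1
  have hy : ((i.y.toNat : ℕ) : ℤ) = i.y := Int.toNat_of_nonneg i.hy.1
  rw [model_single, genSymbol, map_smul, mcol_pure, diskCol_apply, diskCol_apply, hA, hB,
    map_smul, map_smul, LinearMap.smul_apply, lam_evec, hx, hy, shift_single, smul_smul, smul_smul]
  congr 1
  push_cast
  ring

/-- Symbols of the form `z (A ⊗ B) ⊗ u^l` with shifts `A`, `B` act multiplicatively from the left,
provided that the weights are small on the labels which lie out of range but are moved into the
range. -/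
theorem isSmall_model_mul {A : Disk q 1} {B : Disk q (-1)} {dx dy : ℤ} {α β : ℤ → ℝ}
    (hA : IsDiskShift A dx α) (hB : IsDiskShift B dy β) (z : ℝ) (l : ℤ)
    (hout : ∀ (m x y : ℤ) (s : Spin), 0 ≤ x → 0 ≤ y → (m < x ∨ yMax m s < y) →
      (0 ≤ x + dx ∧ x + dx ≤ m + l) → (0 ≤ y + dy ∧ y + dy ≤ yMax (m + l) s) →
      |α x * β y| ≤ rate q ^ m) (f : Spin → SymbolAlg q) :
    IsSmall q (model q (genSymbol z A B l) * model q f - model q (genSymbol z A B l * f)) := by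
  have key : ∀ h : SymbolAlg q, ∃ C : ℝ, 0 ≤ C ∧ ∀ i : Idx,
      nrm (model q (genSymbol z A B l) (mcol q i h) -
        mcol q i (((z : ℂ) • ((A ⊗ₜ[ℂ] B) ⊗ₜ[ℂ] (T l : ℂ[T;T⁻¹]))) * h)) ≤
        C * rate q ^ i.n := by
    intro h
    induction h using symbolAlg_induction with
    | add f g hf hg =>
      obtain ⟨C, h0, hC⟩ := hf
      obtain ⟨C', h0', hC'⟩ := hg
      refine ⟨C + C', by positivity, fun i => ?_⟩
      rw [mul_add, map_add, map_add, map_add, add_mul, add_sub_add_comm]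
      exact (nrm_add_le _ _).trans (add_le_add (hC i) (hC' i))
    | pure X Y l' =>
      obtain ⟨M, hM0, hM⟩ := exists_nrm_diskCol_le X
      obtain ⟨M', hM0', hM'⟩ := exists_nrm_diskCol_le Y
      refine ⟨|z| * rate q ^ l' * (M * M'), by
        have := rate_zpow_pos q l'
        positivity, fun i => ?_⟩
      rw [smul_mul_assoc, map_smul, Algebra.TensorProduct.tmul_mul_tmul,
        Algebra.TensorProduct.tmul_mul_tmul, ← T_add, mcol_pure, mcol_pure, diskCol_apply,
        diskCol_apply, diskCol_apply, diskCol_apply, MulMemClass.coe_mul, MulMemClass.coe_mul,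
        Module.End.mul_apply, Module.End.mul_apply, model_genSymbol hA hB]
      have e : i.n + (l + l') = (i.n + l') + l := by ring
      rw [e]
      set m := i.n + l' with hm
      let β' : Core ℕ →ₗ[ℂ] Core ℕ →ₗ[ℂ] Core Idx :=
        (lam m i.s).compr₂ (shift 1 l dx dy fun _ x y _ => z * (α x * β y)) +
          (-(z : ℂ)) • (lam (m + l) i.s).compl₁₂ (A : Op ℕ) (B : Op ℕ)
      have hr := rate_zpow_pos q m
      have hβ : ∀ x y : ℕ, nrm (β' (Finsupp.single x 1) (Finsupp.single y 1)) ≤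
          |z| * rate q ^ m := by
        intro x y
        have e1 : β' (Finsupp.single x 1) (Finsupp.single y 1) =
            (shift 1 l dx dy fun _ x y _ => z * (α x * β y)) (vec m x y i.s) -
              ((z * (α x * β y) : ℝ) : ℂ) • vec (m + l) (x + dx) (y + dy) i.s := by
          simp only [β', LinearMap.add_apply, LinearMap.compr₂_apply, LinearMap.smul_apply,
            LinearMap.compl₁₂_apply]
          rw [lam_single, hA, hB, map_smul, map_smul, LinearMap.smul_apply, lam_evec, smul_smul,
            smul_smul, sub_eq_add_neg, ← neg_smul]
          congr 2
          push_cast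
          ring
        rw [e1]
        by_cases hin : (0 ≤ (x : ℤ) ∧ (x : ℤ) ≤ m) ∧ (0 ≤ (y : ℤ) ∧ (y : ℤ) ≤ yMax m i.s)
        · rw [shift_vec _ _ _ _ _ _ _ _ _ hin, Equiv.Perm.one_apply, sub_self, nrm_zero]
          positivity
        · rw [vec, dif_neg hin, map_zero, zero_sub, nrm_neg, nrm_smul, Complex.norm_real,
            Real.norm_eq_abs, abs_mul, mul_assoc]
          refine mul_le_mul_of_nonneg_left ?_ (abs_nonneg z)
          by_cases hin' : (0 ≤ (x : ℤ) + dx ∧ (x : ℤ) + dx ≤ m + l) ∧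
              (0 ≤ (y : ℤ) + dy ∧ (y : ℤ) + dy ≤ yMax (m + l) i.s)
          · have h1 := hout m x y i.s (by positivity) (by positivity) (by omega) hin'.1 hin'.2
            exact (mul_le_of_le_one_right (abs_nonneg _) (nrm_vec_le _ _ _ _)).trans h1
          · rw [vec, dif_neg hin', nrm_zero, mul_zero]
            exact hr.le
      have h1 := nrm_bilin_le β' _ hβ ((X : Op ℕ) (Finsupp.single i.x.toNat 1))
        ((Y : Op ℕ) (Finsupp.single i.y.toNat 1))
      have e2 : ∀ v w : Core ℕ, β' v w = (shift 1 l dx dy fun _ x y _ => z * (α x * β y))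
          (lam m i.s v w) - (z : ℂ) • lam (m + l) i.s ((A : Op ℕ) v) ((B : Op ℕ) w) := by
        intro v w
        simp only [β', LinearMap.add_apply, LinearMap.compr₂_apply, LinearMap.smul_apply,
          LinearMap.compl₁₂_apply]
        rw [neg_smul, sub_eq_add_neg]
      rw [e2] at h1
      refine h1.trans ?_
      have h2 : nrm ((X : Op ℕ) (Finsupp.single i.x.toNat 1)) *
          nrm ((Y : Op ℕ) (Finsupp.single i.y.toNat 1)) ≤ M * M' :=
        mul_le_mul (hM _) (hM' _) (nrm_nonneg _) hM0
      have h3 := mul_le_mul_of_nonneg_left h2 (mul_nonneg (abs_nonneg z) hr.le)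
      refine h3.trans (le_of_eq ?_)
      rw [hm, zpow_add₀ (rate_pos q).ne']
      ring
  obtain ⟨C, h0, hC⟩ := exists_common_bound fun s => key (f s)
  refine ⟨C, h0, fun i => ?_⟩
  rw [LinearMap.sub_apply, Module.End.mul_apply, model_single f, model_single (_ * f)]
  exact hC i.s i

/-! ### The weights of the generators -/

theorem one_sub_sq_pos (q : QParam) : 0 < 1 - (q : ℝ) ^ 2 := by
  have := qpos q
  have := q.2.2
  nlinarith

theorem zpow_le_zpow_q (q : QParam) {m n : ℤ} (h : n ≤ m) : (q : ℝ) ^ m ≤ (q : ℝ) ^ n :=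
  zpow_le_zpow_right_of_le_one₀ (qpos q) q.2.2.le h

theorem zpow_le_one_q (q : QParam) {m : ℤ} (h : 0 ≤ m) : (q : ℝ) ^ m ≤ 1 := by
  simpa using zpow_le_zpow_q q h

theorem zpow_q_le_rate (q : QParam) {n : ℤ} (h : 0 ≤ n) : (q : ℝ) ^ n ≤ rate q ^ n := by
  obtain ⟨k, rfl⟩ := Int.eq_ofNat_of_zero_le h
  rw [zpow_natCast, zpow_natCast]
  exact pow_le_pow_left₀ (qpos q).le (q_le_rate q) k

theorem qpow_add (q : QParam) (s t : ℝ) : qpow q (s + t) = qpow q s * qpow q t :=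
  Real.rpow_add (qpos q) _ _

theorem qpow_intCast (q : QParam) (n : ℤ) : qpow q (n : ℝ) = (q : ℝ) ^ n :=
  Real.rpow_intCast _ _

theorem qpow_pos (q : QParam) (t : ℝ) : 0 < qpow q t := Real.rpow_pos_of_pos (qpos q) _

theorem qnum_eq (q : QParam) (N : ℤ) :
    qnum q N = qpow q (1 - N) * ((1 - (q : ℝ) ^ (2 * N)) / (1 - (q : ℝ) ^ 2)) := by
  have hq := (qpos q).ne'
  have hl := (one_sub_sq_pos q).ne'
  have e : qpow q (1 - N) = q * (q : ℝ) ^ (-N) := by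
    have := qpow_intCast q (1 - N)
    push_cast at this
    rw [this, sub_eq_add_neg, zpow_add₀ hq, zpow_one]
  have e2 : (q : ℝ) ^ (2 * N) = (q : ℝ) ^ N * (q : ℝ) ^ N := by rw [two_mul, zpow_add₀ hq]
  have h3 : (q : ℝ)⁻¹ - q = (1 - (q : ℝ) ^ 2) / q := by field_simp
  have h4 : (q : ℝ) ^ N ≠ 0 := zpow_ne_zero _ hq
  rw [qnum, e, e2, h3, zpow_neg]
  field_simp

theorem qsqrt_eq (q : QParam) (N : ℤ) : qsqrt q N =
    qpow q ((1 - N) / 2) * (Real.sqrt (1 - (q : ℝ) ^ (2 * N)) / Real.sqrt (1 - (q : ℝ) ^ 2)) := by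
  have e : qpow q (1 - N) = qpow q ((1 - N) / 2) ^ 2 := by
    rw [sq, ← qpow_add]; congr 1; ring
  rw [qsqrt, qnum_eq, Real.sqrt_mul (qpow_pos _ _).le, e, Real.sqrt_sq (qpow_pos _ _).le,
    Real.sqrt_div' _ (one_sub_sq_pos q).le]

/-- The diagonal weights, with the powers of `q` collected. -/
theorem diag_weight_eq (q : QParam) (t u : ℝ) (a b N e : ℤ)
    (he : (e : ℝ) = t + (1 - a) / 2 + u + (1 - b) / 2 - (1 - N)) :
    qpow q t * qsqrt q a * (qpow q u * qsqrt q b / qnum q N) =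
      (q : ℝ) ^ e * (Real.sqrt (1 - (q : ℝ) ^ (2 * a)) * Real.sqrt (1 - (q : ℝ) ^ (2 * b)) /
        (1 - (q : ℝ) ^ (2 * N))) := by
  have h1 : qpow q t * qpow q ((1 - a) / 2) * qpow q u * qpow q ((1 - b) / 2) =
      (q : ℝ) ^ e * qpow q (1 - N) := by
    rw [← qpow_intCast, ← qpow_add, ← qpow_add, ← qpow_add, ← qpow_add, he]
    congr 1
    ring
  have hl := (one_sub_sq_pos q).ne'
  have h2 : Real.sqrt (1 - (q : ℝ) ^ 2) * Real.sqrt (1 - (q : ℝ) ^ 2) = 1 - (q : ℝ) ^ 2 :=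
    Real.mul_self_sqrt (one_sub_sq_pos q).le
  have h3 : Real.sqrt (1 - (q : ℝ) ^ 2) ≠ 0 := (Real.sqrt_pos.2 (one_sub_sq_pos q)).ne'
  have h4 := (qpow_pos q (1 - N)).ne'
  rw [qsqrt_eq, qsqrt_eq, qnum_eq]
  set A := Real.sqrt (1 - (q : ℝ) ^ (2 * a))
  set B := Real.sqrt (1 - (q : ℝ) ^ (2 * b))
  set M := 1 - (q : ℝ) ^ (2 * N)
  set Λ := Real.sqrt (1 - (q : ℝ) ^ 2)
  calc _ = (qpow q t * qpow q ((1 - a) / 2) * qpow q u * qpow q ((1 - b) / 2)) * (A * B) /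
        (Λ * Λ) / (qpow q (1 - N) * (M / (1 - (q : ℝ) ^ 2))) := by ring
    _ = _ := by
      rw [h1, h2]
      by_cases hM : M = 0
      · simp [hM]
      · field_simp

/-- The off-diagonal weights are bounded by the collected power of `q`. -/
theorem slash_weight_le (q : QParam) (t u : ℝ) (a b N N' e : ℤ)
    (hN : 1 ≤ N) (hN' : 1 ≤ N')
    (he : (e : ℝ) = t + (1 - a) / 2 + u + (1 - b) / 2 - (1 - N) - (1 - N')) :
    |qpow q t * qsqrt q a * (qpow q u * qsqrt q b / (qnum q N * qnum q N'))| ≤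
      (q : ℝ) ^ e / (1 - (q : ℝ) ^ 2) := by
  have hl := one_sub_sq_pos q
  have hΛ := Real.sqrt_pos.2 hl
  have hnum : ∀ N : ℤ, 1 ≤ N → qpow q (1 - N) ≤ qnum q N := by
    intro N hN
    rw [qnum_eq]
    refine le_mul_of_one_le_right (qpow_pos _ _).le ?_
    rw [le_div_iff₀ hl, one_mul]
    have := zpow_le_zpow_q q (show (2 : ℤ) ≤ 2 * N by omega)
    rw [zpow_ofNat] at this
    linarith
  have hsq : ∀ a : ℤ, qsqrt q a ≤ qpow q ((1 - a) / 2) / Real.sqrt (1 - (q : ℝ) ^ 2) := by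
    intro a
    rw [qsqrt_eq, ← mul_div_assoc]
    refine div_le_div_of_nonneg_right (mul_le_of_le_one_right (qpow_pos _ _).le ?_) hΛ.le
    rw [Real.sqrt_le_one]
    have := zpow_pos (qpos q) (2 * a)
    linarith
  have hs0 : ∀ a : ℤ, 0 ≤ qsqrt q a := fun a => Real.sqrt_nonneg _
  have hn0 := (qpow_pos q (1 - N)).trans_le (hnum N hN)
  have hn0' := (qpow_pos q (1 - N')).trans_le (hnum N' hN')
  have ht := qpow_pos q t
  have hu := qpow_pos q u
  have h0 : 0 ≤ qpow q t * qsqrt q a * (qpow q u * qsqrt q b / (qnum q N * qnum q N')) :=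
    mul_nonneg (mul_nonneg ht.le (hs0 _))
      (div_nonneg (mul_nonneg hu.le (hs0 _)) (mul_pos hn0 hn0').le)
  rw [abs_of_nonneg h0]
  have e1 : (q : ℝ) ^ e = qpow q t * qpow q ((1 - a) / 2) * qpow q u * qpow q ((1 - b) / 2) /
      (qpow q (1 - N) * qpow q (1 - N')) := by
    rw [eq_div_iff (mul_pos (qpow_pos _ _) (qpow_pos _ _)).ne', ← qpow_intCast, ← qpow_add,
      ← qpow_add, ← qpow_add, ← qpow_add, ← qpow_add, he]
    congr 1
    ring
  have h2 : Real.sqrt (1 - (q : ℝ) ^ 2) * Real.sqrt (1 - (q : ℝ) ^ 2) = 1 - (q : ℝ) ^ 2 :=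
    Real.mul_self_sqrt hl.le
  calc _ ≤ qpow q t * (qpow q ((1 - a) / 2) / Real.sqrt (1 - (q : ℝ) ^ 2)) *
        (qpow q u * (qpow q ((1 - b) / 2) / Real.sqrt (1 - (q : ℝ) ^ 2)) /
          (qpow q (1 - N) * qpow q (1 - N'))) := by
        have p1 := qpow_pos q ((1 - a) / 2)
        have p2 := qpow_pos q ((1 - b) / 2)
        have p3 := qpow_pos q (1 - N)
        have p4 := qpow_pos q (1 - N')
        have i1 := hsq a
        have i2 := hsq b
        have i3 := hnum N hN
        have i4 := hnum N' hN'
        have i5 := hs0 a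
        have i6 := hs0 b
        gcongr
    _ = _ := by
        rw [e1]
        conv_rhs => rw [← h2]
        ring

/-- Comparison of a diagonal weight with its limit. -/
theorem diag_weight_close {E s s' t t' w ρ l : ℝ} (hE : 0 ≤ E) (hE1 : E ≤ 1) (hl : 0 < l)
    (hs : 0 ≤ s) (hs1 : s ≤ 1) (ht : 0 ≤ t) (ht1 : t ≤ 1) (hs' : 0 ≤ s') (hs1' : s' ≤ 1)
    (h1 : E * |s - s'| ≤ ρ) (h2 : E * |t - t'| ≤ ρ) (hw : 0 ≤ w) (hwl : w ≤ 1 - l) (hwρ : w ≤ ρ) :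
    |E * (s * t / (1 - w)) - E * (s' * t')| ≤ (1 / l + 2) * ρ := by
  have hw1 : 0 < 1 - w := by linarith
  have e : E * (s * t / (1 - w)) - E * (s' * t') =
      E * (s * t) * (w / (1 - w)) + (E * (s - s') * t + E * (t - t') * s') := by
    field_simp
    ring
  have a1 : |E * (s * t) * (w / (1 - w))| ≤ 1 / l * ρ := by
    rw [abs_of_nonneg (by positivity)]
    have b1 : E * (s * t) ≤ 1 := mul_le_one₀ hE1 (by positivity) (mul_le_one₀ hs1 ht ht1)
    have b2 : w / (1 - w) ≤ ρ / l := div_le_div₀ (hw.trans hwρ) hwρ hl (by linarith)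
    calc _ ≤ 1 * (ρ / l) := mul_le_mul b1 b2 (by positivity) zero_le_one
      _ = _ := by ring
  have a2 : |E * (s - s') * t| ≤ ρ := by
    rw [abs_mul, abs_mul, abs_of_nonneg hE, abs_of_nonneg ht]
    exact (mul_le_of_le_one_right (by positivity) ht1).trans h1
  have a3 : |E * (t - t') * s'| ≤ ρ := by
    rw [abs_mul, abs_mul, abs_of_nonneg hE, abs_of_nonneg hs']
    exact (mul_le_of_le_one_right (by positivity) hs1').trans h2
  rw [e]
  have := abs_add_le (E * (s * t) * (w / (1 - w))) (E * (s - s') * t + E * (t - t') * s')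
  have := abs_add_le (E * (s - s') * t) (E * (t - t') * s')
  linarith

theorem sqrt_one_sub_le (q : QParam) (a : ℤ) : Real.sqrt (1 - (q : ℝ) ^ a) ≤ 1 := by
  rw [Real.sqrt_le_one]
  have := zpow_pos (qpos q) a
  linarith

/-- A weight `√(1 - q^a)` may be replaced by `1` in the presence of a factor `q^e`. -/
theorem mul_sqrt_sub_one_le (q : QParam) {e a n : ℤ} (ha : 0 ≤ a) (h : n ≤ e + a) :
    (q : ℝ) ^ e * |Real.sqrt (1 - (q : ℝ) ^ a) - 1| ≤ (q : ℝ) ^ n := by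
  have h1 := abs_sqrt_sub_one_le (zpow_pos (qpos q) a).le (zpow_le_one_q q ha)
  calc _ ≤ (q : ℝ) ^ e * (q : ℝ) ^ a := mul_le_mul_of_nonneg_left h1 (zpow_pos (qpos q) e).le
    _ = (q : ℝ) ^ (e + a) := (zpow_add₀ (qpos q).ne' _ _).symm
    _ ≤ _ := zpow_le_zpow_q q h

/-- The limit of one square-root factor of a diagonal weight: the factor stays (`true`) or becomes
`1` (`false`). -/
def rootLim (q : QParam) (keep : Bool) (a : ℤ) : ℝ :=
  if keep then Real.sqrt (1 - (q : ℝ) ^ (2 * a)) else 1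

/-- A diagonal weight is exponentially close to its limit. -/
theorem abs_diag_weight_sub_le (q : QParam) (k k' : Bool) {e a b N n : ℤ} (hn : 0 ≤ n)
    (he : 0 ≤ e) (ha : 0 ≤ a) (hb : 0 ≤ b) (hN : 1 ≤ N) (hNn : n ≤ 2 * N)
    (hk : k = false → n ≤ e + 2 * a) (hk' : k' = false → n ≤ e + 2 * b) :
    |(q : ℝ) ^ e * (Real.sqrt (1 - (q : ℝ) ^ (2 * a)) * Real.sqrt (1 - (q : ℝ) ^ (2 * b)) /
        (1 - (q : ℝ) ^ (2 * N))) - (q : ℝ) ^ e * (rootLim q k a * rootLim q k' b)| ≤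
      (1 / (1 - (q : ℝ) ^ 2) + 2) * rate q ^ n := by
  have hpos := zpow_pos (qpos q) n
  have hlim : ∀ (k : Bool) (a : ℤ), 0 ≤ a → (k = false → n ≤ e + 2 * a) →
      (q : ℝ) ^ e * |Real.sqrt (1 - (q : ℝ) ^ (2 * a)) - rootLim q k a| ≤ (q : ℝ) ^ n := by
    intro k a ha hk
    cases k
    · exact mul_sqrt_sub_one_le q (by omega) (hk rfl)
    · simp only [rootLim, if_true, sub_self, abs_zero, mul_zero]
      exact hpos.le
  have hl := one_sub_sq_pos q
  refine (diag_weight_close (ρ := (q : ℝ) ^ n) (l := 1 - (q : ℝ) ^ 2) (zpow_pos (qpos q) e).le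
    (zpow_le_one_q q he) hl
    (Real.sqrt_nonneg _) (sqrt_one_sub_le q _) (Real.sqrt_nonneg _) (sqrt_one_sub_le q _) ?_ ?_
    (hlim k a ha hk) (hlim k' b hb hk') (zpow_pos (qpos q) _).le ?_ (zpow_le_zpow_q q hNn)).trans ?_
  · cases k <;> simp [rootLim]
  · cases k
    · simp [rootLim]
    · simpa only [rootLim, if_true] using sqrt_one_sub_le q _
  · have := zpow_le_zpow_q q (show (2 : ℤ) ≤ 2 * N by omega)
    rw [zpow_ofNat] at this
    linarith
  · exact mul_le_mul_of_nonneg_left (zpow_q_le_rate q hn) (by positivity)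

/-! ### Diagonal and off-diagonal parts of the generators -/

/-- The exchange of the two spins. -/
def flipS : Equiv.Perm Spin := Equiv.swap .up .dn

@[simp] theorem flipS_up : flipS .up = .dn := Equiv.swap_apply_left _ _

@[simp] theorem flipS_dn : flipS .dn = .up := Equiv.swap_apply_right _ _

/-- The adjoint of the weighted shift with the same data. -/
def shiftAdj (τ : Equiv.Perm Spin) (d dx dy : ℤ) (c : ℤ → ℤ → ℤ → Spin → ℝ) : Op Idx :=
  shift τ.symm (-d) (-dx) (-dy) fun n x y s => c (n - d) (x - dx) (y - dy) (τ.symm s)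

/-- The weights of the diagonal part of `a_+`. -/
def wAP (q : QParam) (n x y : ℤ) : Spin → ℝ
  | .up => pref q n x y .up * qsqrt q (x + 1) *
      (qpow q (-(n / 2) - 1 / 2) * qsqrt q (y + 1) / qnum q (n + 2))
  | .dn => pref q n x y .dn * qsqrt q (x + 1) *
      (qpow q (-(n / 2)) * qsqrt q (y + 1) / qnum q (n + 1))

/-- The weights of the part of `a_+` from `↑` to `↓`. -/
def sAP (q : QParam) (n x y : ℤ) : Spin → ℝ
  | .up => pref q n x y .up * qsqrt q (x + 1) *
      (qpow q (1 / 2) * qsqrt q (n - y + 1) / (qnum q (n + 1) * qnum q (n + 2)))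
  | .dn => 0

/-- The weights of the diagonal part of `a_-`. -/
def wAM (q : QParam) (n x y : ℤ) : Spin → ℝ
  | .up => pref q n x y .up * qsqrt q (n - x) *
      (qpow q (n / 2 + 1) * qsqrt q (n - y + 1) / qnum q (n + 1))
  | .dn => pref q n x y .dn * qsqrt q (n - x) *
      (qpow q (n / 2 + 1 / 2) * qsqrt q (n - y - 1) / qnum q n)

/-- The weights of the part of `a_-` from `↓` to `↑`. -/
def sAM (q : QParam) (n x y : ℤ) : Spin → ℝ
  | .up => 0
  | .dn => -(pref q n x y .dn * qsqrt q (n - x) *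
      (qpow q (1 / 2) * qsqrt q (y + 1) / (qnum q n * qnum q (n + 1))))

/-- The weights of the diagonal part of `b_+`. -/
def wBP (q : QParam) (n x y : ℤ) : Spin → ℝ
  | .up => pref q n x y .up * qsqrt q (x + 1) *
      (qpow q 0 * qsqrt q (n - y + 2) / qnum q (n + 2))
  | .dn => pref q n x y .dn * qsqrt q (x + 1) *
      (qpow q (-(1 / 2)) * qsqrt q (n - y) / qnum q (n + 1))

/-- The weights of the part of `b_+` from `↑` to `↓`. -/
def sBP (q : QParam) (n x y : ℤ) : Spin → ℝ
  | .up => -(pref q n x y .up * qsqrt q (x + 1) *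
      (qpow q (-(n / 2) - 1) * qsqrt q y / (qnum q (n + 1) * qnum q (n + 2))))
  | .dn => 0

/-- The weights of the diagonal part of `b_-`. -/
def wBM (q : QParam) (n x y : ℤ) : Spin → ℝ
  | .up => -(pref q n x y .up * qsqrt q (n - x) *
      (qpow q (-(1 / 2)) * qsqrt q y / qnum q (n + 1)))
  | .dn => -(pref q n x y .dn * qsqrt q (n - x) *
      (qpow q 0 * qsqrt q y / qnum q n))

/-- The weights of the part of `b_-` from `↓` to `↑`. -/
def sBM (q : QParam) (n x y : ℤ) : Spin → ℝ
  | .up => 0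
  | .dn => -(pref q n x y .dn * qsqrt q (n - x) *
      (qpow q (n / 2) * qsqrt q (n - y) / (qnum q n * qnum q (n + 1))))

theorem qpow_zero (q : QParam) : qpow q 0 = 1 := Real.rpow_zero _

theorem ofReal_smul_core (r : ℝ) (v : Core Idx) : ((r : ℝ) : ℂ) • v = r • v := by
  ext k
  simp

theorem aPlus_eq (q : QParam) :
    aPlus q = shift 1 1 1 1 (wAP q) + shift flipS 1 1 0 (sAP q) := by
  refine op_ext fun ⟨n, x, y, s, hx, hy⟩ => ?_
  rw [LinearMap.add_apply, shift_single, shift_single, ofReal_smul_core, ofReal_smul_core, aPlus,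
    ofBasis_single]
  cases s
  · simp only [wAP, sAP, flipS_up, Equiv.Perm.one_apply, add_zero]
    module
  · simp only [wAP, sAP, flipS_dn, Equiv.Perm.one_apply]
    module

theorem aMinus_eq (q : QParam) :
    aMinus q = shift 1 (-1) 0 0 (wAM q) + shift flipS (-1) 0 1 (sAM q) := by
  refine op_ext fun ⟨n, x, y, s, hx, hy⟩ => ?_
  rw [LinearMap.add_apply, shift_single, shift_single, ofReal_smul_core, ofReal_smul_core, aMinus,
    ofBasis_single]
  cases s
  · simp only [wAM, sAM, flipS_up, Equiv.Perm.one_apply, add_zero, ← sub_eq_add_neg]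
    module
  · simp only [wAM, sAM, flipS_dn, Equiv.Perm.one_apply, add_zero, ← sub_eq_add_neg]
    module

theorem bPlus_eq (q : QParam) :
    bPlus q = shift 1 1 1 0 (wBP q) + shift flipS 1 1 (-1) (sBP q) := by
  refine op_ext fun ⟨n, x, y, s, hx, hy⟩ => ?_
  rw [LinearMap.add_apply, shift_single, shift_single, ofReal_smul_core, ofReal_smul_core, bPlus,
    ofBasis_single]
  cases s
  · simp only [wBP, sBP, flipS_up, Equiv.Perm.one_apply, add_zero, ← sub_eq_add_neg, qpow_zero]
    module
  · simp only [wBP, sBP, flipS_dn, Equiv.Perm.one_apply, add_zero, ← sub_eq_add_neg]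
    module

theorem bMinus_eq (q : QParam) :
    bMinus q = shift 1 (-1) 0 (-1) (wBM q) + shift flipS (-1) 0 0 (sBM q) := by
  refine op_ext fun ⟨n, x, y, s, hx, hy⟩ => ?_
  rw [LinearMap.add_apply, shift_single, shift_single, ofReal_smul_core, ofReal_smul_core, bMinus,
    ofBasis_single]
  cases s
  · simp only [wBM, sBM, flipS_up, Equiv.Perm.one_apply, add_zero, ← sub_eq_add_neg]
    module
  · simp only [wBM, sBM, flipS_dn, Equiv.Perm.one_apply, add_zero, ← sub_eq_add_neg, qpow_zero]
    module

section parts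

variable (d dx dy d' dx' dy' : ℤ) (c c' : ℤ → ℤ → ℤ → Spin → ℝ)

theorem diagPart_add_shift :
    diagPart (shift 1 d dx dy c + shift flipS d' dx' dy' c') = shift 1 d dx dy c := by
  refine op_ext fun i => ?_
  rw [diagPart]
  simp only [LinearMap.add_apply, Module.End.mul_apply, pUp_single, pDn_single]
  cases h : i.s <;>
    simp [h, shift_single, pUp_vec, pDn_vec]

theorem slash_add_shift (hc : ∀ n x y, c n x y .dn = 0) (hc' : ∀ n x y, c' n x y .up = 0)
    (e ex ey e' ex' ey' : ℤ) (w w' : ℤ → ℤ → ℤ → Spin → ℝ) :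
    slash (shift 1 e ex ey w + shift flipS d dx dy c)
      (shift 1 e' ex' ey' w' + shift flipS d' dx' dy' c') =
      shift flipS d dx dy c + shift flipS d' dx' dy' c' := by
  refine op_ext fun i => ?_
  rw [slash]
  simp only [LinearMap.add_apply, Module.End.mul_apply, pUp_single, pDn_single]
  cases h : i.s <;>
    simp [h, shift_single, pUp_vec, pDn_vec, hc, hc']

end parts

theorem diagPart_aPlus (q : QParam) : diagPart (aPlus q) = shift 1 1 1 1 (wAP q) := by
  rw [aPlus_eq, diagPart_add_shift]

theorem diagPart_aMinus (q : QParam) : diagPart (aMinus q) = shift 1 (-1) 0 0 (wAM q) := by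
  rw [aMinus_eq, diagPart_add_shift]

theorem diagPart_bPlus (q : QParam) : diagPart (bPlus q) = shift 1 1 1 0 (wBP q) := by
  rw [bPlus_eq, diagPart_add_shift]

theorem diagPart_bMinus (q : QParam) : diagPart (bMinus q) = shift 1 (-1) 0 (-1) (wBM q) := by
  rw [bMinus_eq, diagPart_add_shift]

/-- The off-diagonal part of `π(a)`. -/
def aSl (q : QParam) : Op Idx := shift flipS 1 1 0 (sAP q) + shift flipS (-1) 0 1 (sAM q)

/-- The off-diagonal part of `π(b)`. -/
def bSl (q : QParam) : Op Idx := shift flipS 1 1 (-1) (sBP q) + shift flipS (-1) 0 0 (sBM q)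

theorem slash_a (q : QParam) : slash (aPlus q) (aMinus q) = aSl q := by
  rw [aPlus_eq, aMinus_eq, slash_add_shift _ _ _ _ _ _ _ _ (fun _ _ _ => rfl) fun _ _ _ => rfl, aSl]

theorem slash_b (q : QParam) : slash (bPlus q) (bMinus q) = bSl q := by
  rw [bPlus_eq, bMinus_eq, slash_add_shift _ _ _ _ _ _ _ _ (fun _ _ _ => rfl) fun _ _ _ => rfl, bSl]

/-- The adjoint of the off-diagonal part of `π(a)`. -/
def aSlAdj (q : QParam) : Op Idx := shiftAdj flipS 1 1 0 (sAP q) + shiftAdj flipS (-1) 0 1 (sAM q)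

/-- The adjoint of the off-diagonal part of `π(b)`. -/
def bSlAdj (q : QParam) : Op Idx :=
  shiftAdj flipS 1 1 (-1) (sBP q) + shiftAdj flipS (-1) 0 0 (sBM q)

theorem isAdj_aSlAdj (q : QParam) : IsAdj (aSlAdj q) (aSl q) :=
  (isAdj_shift _ _ _ _ _).add (isAdj_shift _ _ _ _ _)

theorem isAdj_bSlAdj (q : QParam) : IsAdj (bSlAdj q) (bSl q) :=
  (isAdj_shift _ _ _ _ _).add (isAdj_shift _ _ _ _ _)

/-- `π(a)` is the sum of its components of degree `1`, `-1` and `0` with respect to `|D|`. -/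
theorem a_eq (q : QParam) : aPlus q + aMinus q =
    shift 1 1 1 1 (wAP q) + shift 1 (-1) 0 0 (wAM q) + aSl q := by
  rw [aPlus_eq, aMinus_eq, aSl]; module

theorem b_eq (q : QParam) : bPlus q + bMinus q =
    shift 1 1 1 0 (wBP q) + shift 1 (-1) 0 (-1) (wBM q) + bSl q := by
  rw [bPlus_eq, bMinus_eq, bSl]; module

/-- The adjoint of `π(a)`. -/
def aAdj (q : QParam) : Op Idx :=
  shiftAdj 1 1 1 1 (wAP q) + shiftAdj 1 (-1) 0 0 (wAM q) + aSlAdj q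

/-- The adjoint of `π(b)`. -/
def bAdj (q : QParam) : Op Idx :=
  shiftAdj 1 1 1 0 (wBP q) + shiftAdj 1 (-1) 0 (-1) (wBM q) + bSlAdj q

theorem isAdj_aAdj (q : QParam) : IsAdj (aAdj q) (aPlus q + aMinus q) := by
  rw [a_eq]
  exact ((isAdj_shift _ _ _ _ _).add (isAdj_shift _ _ _ _ _)).add (isAdj_aSlAdj q)

theorem isAdj_bAdj (q : QParam) : IsAdj (bAdj q) (bPlus q + bMinus q) := by
  rw [b_eq]
  exact ((isAdj_shift _ _ _ _ _).add (isAdj_shift _ _ _ _ _)).add (isAdj_bSlAdj q)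

/-! ### Symbols of the generators -/

theorem abs_wAP_sub_le (q : QParam) (i : Idx) :
    |wAP q i.n i.x i.y i.s - 1 * (Real.sqrt (1 - (q : ℝ) ^ (2 * i.x + 2)) *
      Real.sqrt (1 - (q : ℝ) ^ (2 * i.y + 2)))| ≤
      (1 / (1 - (q : ℝ) ^ 2) + 2) * rate q ^ i.n := by
  obtain ⟨n, x, y, s, hx, hy⟩ := i
  have e1 : 2 * x + 2 = 2 * (x + 1) := by ring
  have e2 : 2 * y + 2 = 2 * (y + 1) := by ring
  have e0 : (1 : ℝ) = (q : ℝ) ^ (0 : ℤ) := (zpow_zero _).symm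
  rw [e1, e2]
  cases s
  · simp only [yMax] at hy
    simp only [wAP, pref]
    rw [diag_weight_eq q _ _ _ _ _ 0 (by push_cast; ring)]
    have := abs_diag_weight_sub_le q true true (e := 0) (a := x + 1) (b := y + 1) (N := n + 2)
      (n := n) (by omega) (by omega) (by omega) (by omega) (by omega) (by omega) (by simp)
      (by simp)
    simpa only [rootLim, if_true, zpow_zero] using this
  · simp only [yMax] at hy
    simp only [wAP, pref]
    rw [diag_weight_eq q _ _ _ _ _ 0 (by push_cast; ring)]
    have := abs_diag_weight_sub_le q true true (e := 0) (a := x + 1) (b := y + 1) (N := n + 1)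
      (n := n) (by omega) (by omega) (by omega) (by omega) (by omega) (by omega) (by simp)
      (by simp)
    simpa only [rootLim, if_true, zpow_zero] using this

theorem abs_wAM_sub_le (q : QParam) (i : Idx) :
    |wAM q i.n i.x i.y i.s - -(q : ℝ) * ((((1 : ℤˣ) : ℤ) : ℝ) * (q : ℝ) ^ i.x *
      ((((-1 : ℤˣ) : ℤ) : ℝ) * (q : ℝ) ^ i.y))| ≤
      (1 / (1 - (q : ℝ) ^ 2) + 2) * rate q ^ i.n := by
  obtain ⟨n, x, y, s, hx, hy⟩ := i
  have hq := (qpos q).ne'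
  have e1 : -(q : ℝ) * ((((1 : ℤˣ) : ℤ) : ℝ) * (q : ℝ) ^ x *
      ((((-1 : ℤˣ) : ℤ) : ℝ) * (q : ℝ) ^ y)) = (q : ℝ) ^ (x + y + 1) * (1 * 1) := by
    rw [zpow_add₀ hq, zpow_add₀ hq]
    push_cast
    simp
    ring
  simp only
  rw [e1]
  cases s
  · simp only [yMax] at hy
    simp only [wAM, pref]
    rw [diag_weight_eq q _ _ _ _ _ (x + y + 1) (by push_cast; ring)]
    have := abs_diag_weight_sub_le q false false (e := x + y + 1) (a := n - x) (b := n - y + 1)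
      (N := n + 1)
      (n := n) (by omega) (by omega) (by omega) (by omega) (by omega) (by omega) (by omega)
      (by omega)
    simpa [rootLim] using this
  · simp only [yMax] at hy
    simp only [wAM, pref]
    rw [diag_weight_eq q _ _ _ _ _ (x + y + 1) (by push_cast; ring)]
    have := abs_diag_weight_sub_le q false false (e := x + y + 1) (a := n - x) (b := n - y - 1)
      (N := n)
      (n := n) (by omega) (by omega) (by omega) (by omega) (by omega) (by omega) (by omega)
      (by omega)
    simpa [rootLim] using this

theorem abs_wBP_sub_le (q : QParam) (i : Idx) :
    |wBP q i.n i.x i.y i.s - (-1) * (Real.sqrt (1 - (q : ℝ) ^ (2 * i.x + 2)) *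
      ((((-1 : ℤˣ) : ℤ) : ℝ) * (q : ℝ) ^ i.y))| ≤
      (1 / (1 - (q : ℝ) ^ 2) + 2) * rate q ^ i.n := by
  obtain ⟨n, x, y, s, hx, hy⟩ := i
  have e1 : (-1) * (Real.sqrt (1 - (q : ℝ) ^ (2 * x + 2)) *
      ((((-1 : ℤˣ) : ℤ) : ℝ) * (q : ℝ) ^ y)) =
      (q : ℝ) ^ y * (Real.sqrt (1 - (q : ℝ) ^ (2 * (x + 1))) * 1) := by
    rw [show 2 * x + 2 = 2 * (x + 1) by ring]
    push_cast
    ring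
  simp only
  rw [e1]
  cases s
  · simp only [yMax] at hy
    simp only [wBP, pref]
    rw [diag_weight_eq q _ _ _ _ _ y (by push_cast; ring)]
    have := abs_diag_weight_sub_le q true false (e := y) (a := x + 1) (b := n - y + 2)
      (N := n + 2)
      (n := n) (by omega) (by omega) (by omega) (by omega) (by omega) (by omega) (by simp)
      (by omega)
    simpa [rootLim] using this
  · simp only [yMax] at hy
    simp only [wBP, pref]
    rw [diag_weight_eq q _ _ _ _ _ y (by push_cast; ring)]
    have := abs_diag_weight_sub_le q true false (e := y) (a := x + 1) (b := n - y)
      (N := n + 1)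
      (n := n) (by omega) (by omega) (by omega) (by omega) (by omega) (by omega) (by simp)
      (by omega)
    simpa [rootLim] using this

theorem abs_wBM_sub_le (q : QParam) (i : Idx) :
    |wBM q i.n i.x i.y i.s - (-1) * ((((1 : ℤˣ) : ℤ) : ℝ) * (q : ℝ) ^ i.x *
      Real.sqrt (1 - (q : ℝ) ^ (2 * i.y)))| ≤
      (1 / (1 - (q : ℝ) ^ 2) + 2) * rate q ^ i.n := by
  obtain ⟨n, x, y, s, hx, hy⟩ := i
  have e1 : (-1) * ((((1 : ℤˣ) : ℤ) : ℝ) * (q : ℝ) ^ x *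
      Real.sqrt (1 - (q : ℝ) ^ (2 * y))) =
      -((q : ℝ) ^ x * (1 * Real.sqrt (1 - (q : ℝ) ^ (2 * y)))) := by
    push_cast
    ring
  simp only
  rw [e1]
  cases s
  · simp only [yMax] at hy
    simp only [wBM, pref]
    rw [diag_weight_eq q _ _ _ _ _ x (by push_cast; ring), ← neg_sub', abs_neg]
    have := abs_diag_weight_sub_le q false true (e := x) (a := n - x) (b := y)
      (N := n + 1)
      (n := n) (by omega) (by omega) (by omega) (by omega) (by omega) (by omega) (by omega)
      (by simp)
    simpa [rootLim] using this
  · simp only [yMax] at hy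
    simp only [wBM, pref]
    rw [diag_weight_eq q _ _ _ _ _ x (by push_cast; ring), ← neg_sub', abs_neg]
    have := abs_diag_weight_sub_le q false true (e := x) (a := n - x) (b := y)
      (N := n)
      (n := n) (by omega) (by omega) (by omega) (by omega) (by omega) (by omega) (by omega)
      (by simp)
    simpa [rootLim] using this

/-- A weighted shift with weights close to `z α(x) β(y)`, and its adjoint, have the symbols
`z (A ⊗ B) ⊗ u^l` and `z (A' ⊗ B') ⊗ u^{-l}`. -/
theorem shift_mem_symbolGraph {A A' : Disk q 1} {B B' : Disk q (-1)} {l dx dy : ℤ}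
    {α α' β β' : ℤ → ℝ} {c : ℤ → ℤ → ℤ → Spin → ℝ} {z C : ℝ}
    (hA : IsDiskShift A dx α) (hA' : IsDiskShift A' (-dx) α')
    (hB : IsDiskShift B dy β) (hB' : IsDiskShift B' (-dy) β')
    (hα : ∀ x, α' x = α (x - dx)) (hβ : ∀ y, β' y = β (y - dy))
    (hc : ∀ i : Idx, |c i.n i.x i.y i.s - z * (α i.x * β i.y)| ≤ C * rate q ^ i.n)
    (hout : ∀ (m x y : ℤ) (s : Spin), 0 ≤ x → 0 ≤ y → (m < x ∨ yMax m s < y) →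
      (0 ≤ x + dx ∧ x + dx ≤ m + l) → (0 ≤ y + dy ∧ y + dy ≤ yMax (m + l) s) →
      |α x * β y| ≤ rate q ^ m)
    (hout' : ∀ (m x y : ℤ) (s : Spin), 0 ≤ x → 0 ≤ y → (m < x ∨ yMax m s < y) →
      (0 ≤ x + -dx ∧ x + -dx ≤ m + -l) → (0 ≤ y + -dy ∧ y + -dy ≤ yMax (m + -l) s) →
      |α' x * β' y| ≤ rate q ^ m) :
    (shift 1 l dx dy c, genSymbol (z : ℂ) A B l) ∈ symbolGraph q ∧
      (shiftAdj 1 l dx dy c, genSymbol (z : ℂ) A' B' (-l)) ∈ symbolGraph q := by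
  constructor
  · refine mem_symbolGraph ?_ (isSmall_model_mul hA hB z l hout)
    rw [model_genSymbol hA hB, ← shift_sub]
    exact isSmall_shift _ _ _ _ _ C fun i _ => hc i
  · refine mem_symbolGraph ?_ (isSmall_model_mul hA' hB' z (-l) hout')
    have := isSmall_shift_adj (q := q) 1 l dx dy (fun n x y s => c n x y s - z * (α x * β y)) C hc
    rw [shift_sub] at this
    rw [model_genSymbol hA' hB', shiftAdj]
    simp only [hα, hβ]
    exact this

/-- At labels which the truncation of the model to the range of `(x, y)` removes, the weights of
`b ⊗ b` are exponentially small. -/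
theorem abs_bb_le (q : QParam) {m x y : ℤ} {s : Spin} (hx : 0 ≤ x) (hy : 0 ≤ y)
    (h : m < x ∨ yMax m s < y) :
    |((((1 : ℤˣ) : ℤ) : ℝ) * (q : ℝ) ^ x) * ((((-1 : ℤˣ) : ℤ) : ℝ) * (q : ℝ) ^ y)| ≤
      rate q ^ m := by
  have hm : m ≤ x + y := by
    have : m - 1 ≤ yMax m s := by cases s <;> simp only [yMax] <;> omega
    omega
  have e : ((((1 : ℤˣ) : ℤ) : ℝ) * (q : ℝ) ^ x) * ((((-1 : ℤˣ) : ℤ) : ℝ) * (q : ℝ) ^ y) =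
      -(q : ℝ) ^ (x + y) := by
    rw [zpow_add₀ (qpos q).ne']
    push_cast
    ring
  rw [e, abs_neg, abs_of_pos (zpow_pos (qpos q) _)]
  exact (zpow_q_le_rate q (by omega)).trans
    (zpow_le_zpow_right_of_le_one₀ (rate_pos q) (rate_lt_one q).le hm)

/-- The same for a product of a weight of `a` or `a^*` and a weight of `b` at the label `y`, when
`y` is beyond the cutoff. -/
theorem abs_root_mul_le (q : QParam) {m a y : ℤ} (ε : ℤˣ) (hy : 0 ≤ y) (h : m ≤ y) :
    |Real.sqrt (1 - (q : ℝ) ^ a) * (((ε : ℤ) : ℝ) * (q : ℝ) ^ y)| ≤ rate q ^ m := by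
  have hε : |((ε : ℤ) : ℝ)| = 1 := by
    rcases Int.units_eq_one_or ε with h | h <;> simp [h]
  rw [abs_mul, abs_mul, hε, one_mul, abs_of_nonneg (Real.sqrt_nonneg _),
    abs_of_pos (zpow_pos (qpos q) _)]
  refine (mul_le_of_le_one_left (zpow_pos (qpos q) _).le (sqrt_one_sub_le q _)).trans ?_
  exact (zpow_q_le_rate q hy).trans
    (zpow_le_zpow_right_of_le_one₀ (rate_pos q) (rate_lt_one q).le h)

theorem le_of_yMax_lt {m y : ℤ} {s : Spin} (h : yMax m s < y) : m ≤ y := by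
  cases s <;> simp only [yMax] at h <;> omega

theorem yMax_add (m l : ℤ) (s : Spin) : yMax (m + l) s = yMax m s + l := by
  cases s <;> simp only [yMax] <;> ring

theorem mem_aPlus (q : QParam) :
    (shift 1 1 1 1 (wAP q), genSymbol ((1 : ℝ) : ℂ) (diskA q 1) (diskA q (-1)) 1) ∈
        symbolGraph q ∧
      (shiftAdj 1 1 1 1 (wAP q),
        genSymbol ((1 : ℝ) : ℂ) (diskAStar q 1) (diskAStar q (-1)) (-1)) ∈ symbolGraph q := by
  refine shift_mem_symbolGraph (isDiskShift_diskA 1) (isDiskShift_diskAStar 1)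
    (isDiskShift_diskA (-1)) (isDiskShift_diskAStar (-1)) (fun x => ?_) (fun y => ?_)
    (abs_wAP_sub_le q) ?_ ?_
  · congr 3; ring
  · congr 3; ring
  · intro m x y s hx hy h h1 h2
    rw [yMax_add] at h2
    omega
  · intro m x y s hx hy h h1 h2
    rw [yMax_add] at h2
    omega

theorem mem_aMinus (q : QParam) :
    (shift 1 (-1) 0 0 (wAM q), genSymbol ((-(q : ℝ) : ℝ) : ℂ) (diskB q 1) (diskB q (-1)) (-1)) ∈
        symbolGraph q ∧
      (shiftAdj 1 (-1) 0 0 (wAM q),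
        genSymbol ((-(q : ℝ) : ℝ) : ℂ) (diskB q 1) (diskB q (-1)) 1) ∈ symbolGraph q := by
  refine shift_mem_symbolGraph (l := -1) (isDiskShift_diskB 1) (isDiskShift_diskB 1)
    (isDiskShift_diskB (-1)) (isDiskShift_diskB (-1)) (fun x => by rw [sub_zero])
    (fun y => by rw [sub_zero]) (abs_wAM_sub_le q) ?_ ?_
  · intro m x y s hx hy h h1 h2
    exact abs_bb_le q hx hy h
  · intro m x y s hx hy h h1 h2
    exact abs_bb_le q hx hy h

theorem mem_bPlus (q : QParam) :
    (shift 1 1 1 0 (wBP q), genSymbol ((-1 : ℝ) : ℂ) (diskA q 1) (diskB q (-1)) 1) ∈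
        symbolGraph q ∧
      (shiftAdj 1 1 1 0 (wBP q),
        genSymbol ((-1 : ℝ) : ℂ) (diskAStar q 1) (diskB q (-1)) (-1)) ∈ symbolGraph q := by
  refine shift_mem_symbolGraph (isDiskShift_diskA 1) (isDiskShift_diskAStar 1)
    (isDiskShift_diskB (-1)) (isDiskShift_diskB (-1)) (fun x => ?_) (fun y => by rw [sub_zero])
    (abs_wBP_sub_le q) ?_ ?_
  · congr 3; ring
  · intro m x y s hx hy h h1 h2
    exact abs_root_mul_le q (-1) hy (le_of_yMax_lt (h.resolve_left (by omega)))
  · intro m x y s hx hy h h1 h2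
    exact abs_root_mul_le q (-1) hy (le_of_yMax_lt (h.resolve_left (by omega)))

theorem mem_bMinus (q : QParam) :
    (shift 1 (-1) 0 (-1) (wBM q), genSymbol ((-1 : ℝ) : ℂ) (diskB q 1) (diskAStar q (-1)) (-1)) ∈
        symbolGraph q ∧
      (shiftAdj 1 (-1) 0 (-1) (wBM q),
        genSymbol ((-1 : ℝ) : ℂ) (diskB q 1) (diskA q (-1)) 1) ∈ symbolGraph q := by
  refine shift_mem_symbolGraph (l := -1) (dy := -1) (isDiskShift_diskB 1) (isDiskShift_diskB 1)
    (isDiskShift_diskAStar (-1)) (isDiskShift_diskA (-1)) (fun x => by rw [sub_zero])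
    (fun y => ?_) (abs_wBM_sub_le q) ?_ ?_
  · congr 3; ring
  · intro m x y s hx hy h h1 h2
    rw [yMax_add] at h2
    rw [mul_comm]
    exact abs_root_mul_le q 1 hx (h.resolve_right (by omega)).le
  · intro m x y s hx hy h h1 h2
    rw [yMax_add] at h2
    rw [mul_comm]
    exact abs_root_mul_le q 1 hx (h.resolve_right (by omega)).le

/-! ### The off-diagonal part is negligible -/

/-- `T` exchanges the two spin components. -/
def IsOffDiag (T : Op Idx) : Prop := pUp * T + T * pUp = T

/-- Off-diagonal operators commuting with `|D|`, which are exponentially small even after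
multiplication by `|D|`. -/
structure IsNegligible (q : QParam) (T : Op Idx) : Prop where
  small : IsSmall q T
  small_mul : IsSmall q (absDirac * T)
  delta_eq : delta T = 0
  offDiag : IsOffDiag T

theorem delta_add (S T : Op Idx) : delta (S + T) = delta S + delta T := by
  rw [delta, comm, mul_add, add_mul, delta, delta, comm, comm]; module

theorem delta_smul (c : ℂ) (T : Op Idx) : delta (c • T) = c • delta T := by
  rw [delta, comm, mul_smul_comm, smul_mul_assoc, delta, comm]; module

theorem delta_mul (S T : Op Idx) : delta (S * T) = delta S * T + S * delta T := by
  rw [delta, comm, delta, delta, comm, comm, op_sub_mul, op_mul_sub, mul_assoc, mul_assoc,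
    mul_assoc]
  module

theorem IsNegligible.add {S T : Op Idx} (hS : IsNegligible q S) (hT : IsNegligible q T) :
    IsNegligible q (S + T) where
  small := hS.small.add hT.small
  small_mul := by rw [mul_add]; exact hS.small_mul.add hT.small_mul
  delta_eq := by rw [delta_add, hS.delta_eq, hT.delta_eq, add_zero]
  offDiag := by
    have h1 : pUp * S + S * pUp = S := hS.offDiag
    have h2 : pUp * T + T * pUp = T := hT.offDiag
    rw [IsOffDiag, mul_add, add_mul]
    conv_rhs => rw [← h1, ← h2]
    module

/-- A weighted shift which shifts the eigenvalues of `|D|` by `w` is an eigenvector of `δ`. -/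
theorem delta_shift (τ : Equiv.Perm Spin) (d dx dy : ℤ) (c : ℤ → ℤ → ℤ → Spin → ℝ) (w : ℝ)
    (h : ∀ n x y s, c n x y s ≠ 0 → absEv (n + d) (τ s) = absEv n s + w) :
    delta (shift τ d dx dy c) = (w : ℂ) • shift τ d dx dy c := by
  refine op_ext fun i => ?_
  rw [delta, comm, LinearMap.sub_apply, Module.End.mul_apply, Module.End.mul_apply,
    absDirac_single, map_smul, LinearMap.smul_apply, shift_single, map_smul, absDirac_vec]
  by_cases hc : c i.n i.x i.y i.s = 0
  · simp [hc]
  · rw [h _ _ _ _ hc]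
    push_cast
    module

theorem absDirac_mul_shift (τ : Equiv.Perm Spin) (d dx dy : ℤ) (c : ℤ → ℤ → ℤ → Spin → ℝ) :
    absDirac * shift τ d dx dy c =
      shift τ d dx dy fun n x y s => absEv (n + d) (τ s) * c n x y s := by
  refine op_ext fun i => ?_
  rw [Module.End.mul_apply, shift_single, shift_single, map_smul, absDirac_vec, smul_smul]
  push_cast
  rw [mul_comm]

theorem isOffDiag_shift (d dx dy : ℤ) (c : ℤ → ℤ → ℤ → Spin → ℝ) :
    IsOffDiag (shift flipS d dx dy c) := by
  refine op_ext fun i => ?_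
  rw [LinearMap.add_apply, Module.End.mul_apply, Module.End.mul_apply, pUp_single, shift_single,
    map_smul, pUp_vec]
  cases h : i.s <;> simp [shift_single, h]

/-- The eigenvalue of `|D|` is absorbed by passing from the rate `q` to the rate `√q`. -/
theorem exists_absEv_mul_le (q : QParam) :
    ∃ C : ℝ, 0 ≤ C ∧ ∀ i : Idx, absEv i.n i.s * (q : ℝ) ^ i.n ≤ C * rate q ^ i.n := by
  have h1 : Tendsto (fun n : ℕ => ((n : ℝ) + 3 / 2) * rate q ^ n) atTop (𝓝 0) := by
    have h2 := tendsto_self_mul_const_pow_of_lt_one (rate_pos q).le (rate_lt_one q)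
    have h3 := (tendsto_pow_atTop_nhds_zero_of_lt_one (rate_pos q).le (rate_lt_one q)).const_mul
      (3 / 2)
    have := h2.add h3
    simpa [add_mul] using this
  obtain ⟨C, hC⟩ := h1.bddAbove_range
  have h0 : 0 ≤ C := le_trans (by positivity) (hC ⟨0, rfl⟩)
  refine ⟨C, h0, fun i => ?_⟩
  obtain ⟨n, hn⟩ := Int.eq_ofNat_of_zero_le i.n_nonneg
  have h4 : absEv i.n i.s ≤ n + 3 / 2 := by
    rw [hn]
    cases i.s <;> simp only [absEv] <;> push_cast <;> linarith
  have h5 := hC ⟨n, rfl⟩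
  have h6 : 0 < rate q ^ n := pow_pos (rate_pos q) n
  rw [hn, zpow_natCast, zpow_natCast, ← rate_sq q, ← pow_mul, mul_comm 2 n, pow_mul, sq,
    ← mul_assoc]
  rw [hn] at h4
  exact mul_le_mul_of_nonneg_right ((mul_le_mul_of_nonneg_right h4 h6.le).trans h5) h6.le

theorem flipS_symm : flipS.symm = flipS := Equiv.symm_swap _ _

/-- Weighted shifts between the two spins with weights `O(q^n)` and preserving the eigenvalues of
`|D|` are negligible, and so are their adjoints. -/
theorem isNegligible_shift (d dx dy : ℤ) (c : ℤ → ℤ → ℤ → Spin → ℝ)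
    (h : ∀ n x y s, c n x y s ≠ 0 → absEv (n + d) (flipS s) = absEv n s) (C : ℝ)
    (hc : ∀ i : Idx, |c i.n i.x i.y i.s| ≤ C * (q : ℝ) ^ i.n) :
    IsNegligible q (shift flipS d dx dy c) ∧ IsNegligible q (shiftAdj flipS d dx dy c) := by
  obtain ⟨K, hK0, hK⟩ := exists_absEv_mul_le q
  have hC0 : 0 ≤ C := by
    have := (abs_nonneg _).trans (hc ⟨0, 0, 0, .up, by simp, by simp [yMax]⟩)
    simpa using this
  have hc1 : ∀ i : Idx, |c i.n i.x i.y i.s| ≤ C * rate q ^ i.n := fun i =>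
    (hc i).trans (mul_le_mul_of_nonneg_left (zpow_q_le_rate q i.n_nonneg) hC0)
  set c1 : ℤ → ℤ → ℤ → Spin → ℝ := fun n x y s => absEv n s * c n x y s with hc1def
  have hc2 : ∀ i : Idx, |c1 i.n i.x i.y i.s| ≤ (C * K) * rate q ^ i.n := by
    intro i
    rw [hc1def, abs_mul, abs_of_pos (absEv_pos i)]
    calc _ ≤ absEv i.n i.s * (C * (q : ℝ) ^ i.n) :=
          mul_le_mul_of_nonneg_left (hc i) (absEv_pos i).le
      _ = C * (absEv i.n i.s * (q : ℝ) ^ i.n) := by ring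
      _ ≤ C * (K * rate q ^ i.n) := mul_le_mul_of_nonneg_left (hK i) hC0
      _ = _ := by ring
  have e1 : (fun n x y s => absEv (n + d) (flipS s) * c n x y s) = c1 := by
    funext n x y s
    by_cases h0 : c n x y s = 0
    · simp [hc1def, h0]
    · rw [h _ _ _ _ h0]
  have hadj : ∀ n x y s, c (n - d) (x - dx) (y - dy) (flipS.symm s) ≠ 0 →
      absEv (n + -d) (flipS.symm s) = absEv n s := by
    intro n x y s h0
    have := h _ _ _ _ h0
    rw [sub_add_cancel, Equiv.apply_symm_apply] at this
    rw [this]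
    rfl
  refine ⟨⟨isSmall_shift _ _ _ _ _ C fun i _ => hc1 i, ?_, ?_, isOffDiag_shift _ _ _ _⟩,
    ⟨isSmall_shift_adj _ _ _ _ _ C hc1, ?_, ?_, ?_⟩⟩
  · rw [absDirac_mul_shift, e1]
    exact isSmall_shift _ _ _ _ _ _ fun i _ => hc2 i
  · rw [delta_shift _ _ _ _ _ 0 fun n x y s h0 => by rw [h n x y s h0, add_zero]]
    simp
  · rw [shiftAdj, absDirac_mul_shift]
    exact isSmall_shift_adj (q := q) flipS d dx dy c1 _ hc2
  · rw [shiftAdj, delta_shift _ _ _ _ _ 0 fun n x y s h0 => by rw [hadj n x y s h0, add_zero]]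
    simp
  · rw [shiftAdj, flipS_symm]
    exact isOffDiag_shift _ _ _ _

theorem slash_bound (q : QParam) {n e : ℤ} (h : n ≤ e) :
    (q : ℝ) ^ e / (1 - (q : ℝ) ^ 2) ≤ 1 / (1 - (q : ℝ) ^ 2) * (q : ℝ) ^ n := by
  rw [div_eq_mul_one_div, mul_comm]
  exact mul_le_mul_of_nonneg_left (zpow_le_zpow_q q h) (one_div_pos.2 (one_sub_sq_pos q)).le

theorem zero_slash_bound (q : QParam) (n : ℤ) :
    |(0 : ℝ)| ≤ 1 / (1 - (q : ℝ) ^ 2) * (q : ℝ) ^ n := by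
  rw [abs_zero]
  exact mul_nonneg (one_div_pos.2 (one_sub_sq_pos q)).le (zpow_pos (qpos q) n).le

theorem isNegligible_sAP (q : QParam) :
    IsNegligible q (shift flipS 1 1 0 (sAP q)) ∧ IsNegligible q (shiftAdj flipS 1 1 0 (sAP q)) := by
  refine isNegligible_shift _ _ _ _ (fun n x y s h => ?_) (1 / (1 - (q : ℝ) ^ 2))
    fun ⟨n, x, y, s, hx, hy⟩ => ?_
  · cases s
    · simp only [flipS_up, absEv]; push_cast; ring
    · exact absurd rfl h
  · cases s
    · simp only [yMax] at hy
      simp only [sAP, pref]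
      exact (slash_weight_le q _ _ _ _ _ _ (n + y + 1) (by omega) (by omega)
        (by push_cast; ring)).trans (slash_bound q (by omega))
    · exact zero_slash_bound q n

theorem isNegligible_sAM (q : QParam) :
    IsNegligible q (shift flipS (-1) 0 1 (sAM q)) ∧
      IsNegligible q (shiftAdj flipS (-1) 0 1 (sAM q)) := by
  refine isNegligible_shift _ _ _ _ (fun n x y s h => ?_) (1 / (1 - (q : ℝ) ^ 2))
    fun ⟨n, x, y, s, hx, hy⟩ => ?_
  · cases s
    · exact absurd rfl h
    · simp only [flipS_dn, absEv]; push_cast; ring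
  · cases s
    · exact zero_slash_bound q n
    · simp only [yMax] at hy
      simp only [sAM, pref, abs_neg]
      exact (slash_weight_le q _ _ _ _ _ _ (n + x) (by omega) (by omega)
        (by push_cast; ring)).trans (slash_bound q (by omega))

theorem isNegligible_sBP (q : QParam) :
    IsNegligible q (shift flipS 1 1 (-1) (sBP q)) ∧
      IsNegligible q (shiftAdj flipS 1 1 (-1) (sBP q)) := by
  refine isNegligible_shift _ _ _ _ (fun n x y s h => ?_) (1 / (1 - (q : ℝ) ^ 2))
    fun ⟨n, x, y, s, hx, hy⟩ => ?_
  · cases s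
    · simp only [flipS_up, absEv]; push_cast; ring
    · exact absurd rfl h
  · cases s
    · simp only [yMax] at hy
      simp only [sBP, pref, abs_neg]
      exact (slash_weight_le q _ _ _ _ _ _ n (by omega) (by omega)
        (by push_cast; ring)).trans (slash_bound q (by omega))
    · exact zero_slash_bound q n

theorem isNegligible_sBM (q : QParam) :
    IsNegligible q (shift flipS (-1) 0 0 (sBM q)) ∧
      IsNegligible q (shiftAdj flipS (-1) 0 0 (sBM q)) := by
  refine isNegligible_shift _ _ _ _ (fun n x y s h => ?_) (1 / (1 - (q : ℝ) ^ 2))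
    fun ⟨n, x, y, s, hx, hy⟩ => ?_
  · cases s
    · exact absurd rfl h
    · simp only [flipS_dn, absEv]; push_cast; ring
  · cases s
    · exact zero_slash_bound q n
    · simp only [yMax] at hy
      simp only [sBM, pref, abs_neg]
      exact (slash_weight_le q _ _ _ _ _ _ (x + y + n) (by omega) (by omega)
        (by push_cast; ring)).trans (slash_bound q (by omega))

theorem isNegligible_aSl (q : QParam) : IsNegligible q (aSl q) :=
  (isNegligible_sAP q).1.add (isNegligible_sAM q).1

theorem isNegligible_bSl (q : QParam) : IsNegligible q (bSl q) :=
  (isNegligible_sBP q).1.add (isNegligible_sBM q).1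

theorem isNegligible_aSlAdj (q : QParam) : IsNegligible q (aSlAdj q) :=
  (isNegligible_sAP q).2.add (isNegligible_sAM q).2

theorem isNegligible_bSlAdj (q : QParam) : IsNegligible q (bSlAdj q) :=
  (isNegligible_sBP q).2.add (isNegligible_sBM q).2

/-! ### Components with respect to `|D|` -/

/-- An even operator of degree `w` with respect to `|D|`. -/
structure IsEven (T : Op Idx) (w : ℝ) : Prop where
  delta_eq : delta T = (w : ℂ) • T
  comm_pUp : pUp * T = T * pUp

theorem isEven_shift (d dx dy : ℤ) (c : ℤ → ℤ → ℤ → Spin → ℝ) :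
    IsEven (shift 1 d dx dy c) (d : ℝ) where
  delta_eq := delta_shift _ _ _ _ _ _ fun n x y s _ => by
    rw [Equiv.Perm.one_apply]
    cases s <;> simp only [absEv] <;> push_cast <;> ring
  comm_pUp := by
    refine op_ext fun i => ?_
    rw [Module.End.mul_apply, Module.End.mul_apply, pUp_single, shift_single, map_smul, pUp_vec,
      Equiv.Perm.one_apply]
    split_ifs with h
    · rw [shift_single, Equiv.Perm.one_apply]
    · simp

theorem isEven_shiftAdj (d dx dy : ℤ) (c : ℤ → ℤ → ℤ → Spin → ℝ) :
    IsEven (shiftAdj 1 d dx dy c) (-d : ℝ) := by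
  have := isEven_shift (-d) (-dx) (-dy)
    fun n x y s => c (n - d) (x - dx) (y - dy) ((1 : Equiv.Perm Spin).symm s)
  push_cast at this
  exact this

theorem signD_eq' : signD = (2 : ℂ) • pUp - 1 := by
  rw [signD_eq, pDn_eq]; module

/-- `[D, T] = F [|D|, T]` for even `T`. -/
theorem IsEven.comm_dirac {T : Op Idx} {w : ℝ} (h : IsEven T w) :
    comm dirac T = (w : ℂ) • (signD * T) := by
  have h1 : absDirac * T = (w : ℂ) • T + T * absDirac := by
    have := h.delta_eq
    rw [delta, comm] at this
    rw [← this]; module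
  have h2 : T * signD = signD * T := by
    rw [signD_eq', op_mul_sub, op_sub_mul, mul_smul_comm, smul_mul_assoc, h.comm_pUp, one_mul,
      mul_one]
  rw [comm, dirac_eq, mul_assoc, h1, ← mul_assoc, h2, mul_add, mul_smul_comm, mul_assoc]
  module

/-- `[D, T] = 2 F |D| T` for off-diagonal `T` commuting with `|D|`. -/
theorem IsNegligible.comm_dirac {T : Op Idx} (h : IsNegligible q T) :
    comm dirac T = (2 : ℂ) • (signD * (absDirac * T)) := by
  have h1 : absDirac * T = T * absDirac := by
    have := h.delta_eq
    rw [delta, comm] at this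
    have e : absDirac * T = (absDirac * T - T * absDirac) + T * absDirac := by module
    rw [e, this, zero_add]
  have h2 : T * signD = -(1 : ℂ) • (signD * T) := by
    have h3 : pUp * T + T * pUp = T := h.offDiag
    have h4 : T * signD + signD * T = (2 : ℂ) • (pUp * T + T * pUp) - (2 : ℂ) • T := by
      rw [signD_eq', op_mul_sub, op_sub_mul, mul_smul_comm, smul_mul_assoc, one_mul, mul_one]
      module
    have e : T * signD = (T * signD + signD * T) + -(1 : ℂ) • (signD * T) := by module
    rw [e, h4, h3]
    module
  rw [comm, dirac_eq, ← mul_assoc T, h2, mul_assoc, smul_mul_assoc, mul_assoc, h1]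
  module

theorem isBdd_signD : IsBdd signD := ⟨1, zero_le_one, fun i => by
  rw [signD_single, nrm_smul, nrm_single]
  cases i.s <;> simp [spinSign]⟩

theorem delta_pUp : delta pUp = 0 := by
  rw [delta, comm, pUp_mul_absDirac]
  exact op_sub_self _

theorem delta_signD : delta signD = 0 := by
  rw [delta, comm, signD_mul_absDirac]
  exact op_sub_self _

theorem delta_absDirac : delta absDirac = 0 := op_sub_self _

/-- The commutator with `D` of a negligible operator is small, of degree `0` and off-diagonal. -/
theorem IsNegligible.comm_dirac_prop {T : Op Idx} (h : IsNegligible q T) :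
    IsSmall q (comm dirac T) ∧ delta (comm dirac T) = 0 ∧ IsOffDiag (comm dirac T) := by
  rw [h.comm_dirac]
  refine ⟨(isBdd_signD.mul_isSmall h.small_mul).smul 2, ?_, ?_⟩
  · rw [delta_smul, delta_mul, delta_mul, h.delta_eq, delta_signD, delta_absDirac]
    simp
  · have h3 : pUp * T + T * pUp = T := h.offDiag
    have h4 : pUp * signD = signD * pUp := by
      rw [signD_eq', op_mul_sub, op_sub_mul, mul_smul_comm, smul_mul_assoc, one_mul, mul_one]
    have e1 : pUp * (signD * (absDirac * T)) = signD * (absDirac * (pUp * T)) := by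
      rw [← mul_assoc, h4, mul_assoc, ← mul_assoc pUp, pUp_mul_absDirac, mul_assoc]
    have e2 : signD * (absDirac * T) * pUp = signD * (absDirac * (T * pUp)) := by
      rw [mul_assoc, mul_assoc]
    rw [IsOffDiag, mul_smul_comm, smul_mul_assoc, e1, e2, ← smul_add, ← mul_add, ← mul_add, h3]

/-! ### Generators of the algebras -/

/-- The diagonal parts of the generators and of their adjoints. -/
def evenGens (q : QParam) : Set (Op Idx) :=
  {shift 1 1 1 1 (wAP q), shift 1 (-1) 0 0 (wAM q), shift 1 1 1 0 (wBP q),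
    shift 1 (-1) 0 (-1) (wBM q), shiftAdj 1 1 1 1 (wAP q), shiftAdj 1 (-1) 0 0 (wAM q),
    shiftAdj 1 1 1 0 (wBP q), shiftAdj 1 (-1) 0 (-1) (wBM q)}

/-- The off-diagonal parts of the generators and of their adjoints. -/
def oddGens (q : QParam) : Set (Op Idx) := {aSl q, bSl q, aSlAdj q, bSlAdj q}

theorem exists_isEven {T : Op Idx} (hT : T ∈ evenGens q) : ∃ w : ℝ, IsEven T w := by
  rcases hT with rfl | rfl | rfl | rfl | rfl | rfl | rfl | rfl
  · exact ⟨_, isEven_shift _ _ _ _⟩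
  · exact ⟨_, isEven_shift _ _ _ _⟩
  · exact ⟨_, isEven_shift _ _ _ _⟩
  · exact ⟨_, isEven_shift _ _ _ _⟩
  · exact ⟨_, isEven_shiftAdj _ _ _ _⟩
  · exact ⟨_, isEven_shiftAdj _ _ _ _⟩
  · exact ⟨_, isEven_shiftAdj _ _ _ _⟩
  · exact ⟨_, isEven_shiftAdj _ _ _ _⟩

theorem isNegligible_oddGens {T : Op Idx} (hT : T ∈ oddGens q) : IsNegligible q T := by
  rcases hT with rfl | rfl | rfl | rfl
  · exact isNegligible_aSl q
  · exact isNegligible_bSl q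
  · exact isNegligible_aSlAdj q
  · exact isNegligible_bSlAdj q

/-- The generators of `π(𝒜)` are sums of two even generators, of degrees `1` and `-1`, and an odd
one. -/
theorem algA_generator {g : Op Idx}
    (hg : g ∈ ({aPlus q + aMinus q, bPlus q + bMinus q} : Set (Op Idx)) ∪
      {S | ∃ T ∈ ({aPlus q + aMinus q, bPlus q + bMinus q} : Set (Op Idx)), IsAdj S T}) :
    ∃ U ∈ evenGens q, ∃ V ∈ evenGens q, ∃ W ∈ oddGens q,
      IsEven U 1 ∧ IsEven V (-1) ∧ g = U + V + W := by
  rcases hg with (rfl | rfl) | ⟨T, (rfl | rfl), h⟩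
  · refine ⟨_, Or.inl rfl, _, Or.inr (Or.inl rfl), aSl q, Or.inl rfl, ?_, ?_, a_eq q⟩
    · simpa using isEven_shift 1 1 1 (wAP q)
    · simpa using isEven_shift (-1) 0 0 (wAM q)
  · refine ⟨shift 1 1 1 0 (wBP q), by simp [evenGens], shift 1 (-1) 0 (-1) (wBM q),
      by simp [evenGens], bSl q, by simp [oddGens], ?_, ?_, b_eq q⟩
    · simpa using isEven_shift 1 1 0 (wBP q)
    · simpa using isEven_shift (-1) 0 (-1) (wBM q)
  · rw [isAdj_unique h (isAdj_aAdj q)]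
    refine ⟨shiftAdj 1 (-1) 0 0 (wAM q), by simp [evenGens], shiftAdj 1 1 1 1 (wAP q),
      by simp [evenGens], aSlAdj q, by simp [oddGens], ?_, ?_, ?_⟩
    · simpa using isEven_shiftAdj (-1) 0 0 (wAM q)
    · simpa using isEven_shiftAdj 1 1 1 (wAP q)
    · rw [aAdj]; module
  · rw [isAdj_unique h (isAdj_bAdj q)]
    refine ⟨shiftAdj 1 (-1) 0 (-1) (wBM q), by simp [evenGens], shiftAdj 1 1 1 0 (wBP q),
      by simp [evenGens], bSlAdj q, by simp [oddGens], ?_, ?_, ?_⟩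
    · simpa using isEven_shiftAdj (-1) 0 (-1) (wBM q)
    · simpa using isEven_shiftAdj 1 1 0 (wBP q)
    · rw [bAdj]; module

theorem algA_le_algB (q : QParam) : algA q ≤ algB q := fun T hT =>
  Algebra.subset_adjoin ⟨0, T, hT, rfl⟩

theorem algB_le_psi0 (q : QParam) : algB q ≤ psi0 q := by
  refine Algebra.adjoin_le ?_
  rintro S ⟨k, T, hT, rfl⟩
  exact Algebra.subset_adjoin ⟨k, T, hT, Or.inl rfl⟩

theorem psi0_le_psi0P (q : QParam) : psi0 q ≤ psi0P q := fun _ hT =>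
  Algebra.subset_adjoin (Or.inl hT)

/-- The components of `g` of degrees `1`, `-1`, `0` with respect to `|D|` are linear combinations of
`g`, `δ(g)` and `δ²(g)`. -/
theorem components_mem_algB {g U V W : Op Idx} (hg : g ∈ algA q) (hU : IsEven U 1)
    (hV : IsEven V (-1)) (hW : delta W = 0) (h : g = U + V + W) :
    U ∈ algB q ∧ V ∈ algB q ∧ W ∈ algB q := by
  have d0 : g ∈ algB q := algA_le_algB q hg
  have d1 : delta g ∈ algB q := Algebra.subset_adjoin ⟨1, g, hg, rfl⟩
  have d2 : delta (delta g) ∈ algB q := Algebra.subset_adjoin ⟨2, g, hg, rfl⟩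
  have e1 : delta g = U - V := by
    rw [h, delta_add, delta_add, hU.delta_eq, hV.delta_eq, hW]
    push_cast
    module
  have e2 : delta (delta g) = U + V := by
    have : delta g = U + (-1 : ℂ) • V := by rw [e1]; module
    rw [this, delta_add, delta_smul, hU.delta_eq, hV.delta_eq]
    push_cast
    module
  refine ⟨?_, ?_, ?_⟩
  · have e : U = (1 / 2 : ℂ) • (delta g + delta (delta g)) := by rw [e2, e1]; module
    rw [e]
    exact (algB q).smul_mem ((algB q).add_mem d1 d2) _
  · have e : V = (1 / 2 : ℂ) • (delta (delta g) + (-1 : ℂ) • delta g) := by rw [e2, e1]; module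
    rw [e]
    exact (algB q).smul_mem ((algB q).add_mem d2 ((algB q).smul_mem d1 _)) _
  · have e : W = g + (-1 : ℂ) • delta (delta g) := by rw [e2, h]; module
    rw [e]
    exact (algB q).add_mem d0 ((algB q).smul_mem d2 _)

theorem a_mem_algA (q : QParam) : aPlus q + aMinus q ∈ algA q :=
  Algebra.subset_adjoin (Or.inl (Or.inl rfl))

theorem b_mem_algA (q : QParam) : bPlus q + bMinus q ∈ algA q :=
  Algebra.subset_adjoin (Or.inl (Or.inr rfl))

theorem aAdj_mem_algA (q : QParam) : aAdj q ∈ algA q :=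
  Algebra.subset_adjoin (Or.inr ⟨_, Or.inl rfl, isAdj_aAdj q⟩)

theorem bAdj_mem_algA (q : QParam) : bAdj q ∈ algA q :=
  Algebra.subset_adjoin (Or.inr ⟨_, Or.inr rfl, isAdj_bAdj q⟩)

theorem gens_subset_algB (q : QParam) : evenGens q ∪ oddGens q ⊆ algB q := by
  have ha := components_mem_algB (a_mem_algA q)
    (by simpa using isEven_shift 1 1 1 (wAP q)) (by simpa using isEven_shift (-1) 0 0 (wAM q))
    (isNegligible_aSl q).delta_eq (a_eq q)
  have hb := components_mem_algB (b_mem_algA q)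
    (by simpa using isEven_shift 1 1 0 (wBP q)) (by simpa using isEven_shift (-1) 0 (-1) (wBM q))
    (isNegligible_bSl q).delta_eq (b_eq q)
  have ha' := components_mem_algB (aAdj_mem_algA q)
    (by simpa using isEven_shiftAdj (-1) 0 0 (wAM q))
    (by simpa using isEven_shiftAdj 1 1 1 (wAP q))
    (isNegligible_aSlAdj q).delta_eq (by rw [aAdj]; module)
  have hb' := components_mem_algB (bAdj_mem_algA q)
    (by simpa using isEven_shiftAdj (-1) 0 (-1) (wBM q))
    (by simpa using isEven_shiftAdj 1 1 0 (wBP q))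
    (isNegligible_bSlAdj q).delta_eq (by rw [bAdj]; module)
  rintro T ((rfl | rfl | rfl | rfl | rfl | rfl | rfl | rfl) | (rfl | rfl | rfl | rfl))
  exacts [ha.1, ha.2.1, hb.1, hb.2.1, ha'.2.1, ha'.1, hb'.2.1, hb'.1, ha.2.2, hb.2.2, ha'.2.2,
    hb'.2.2]

/-- A subalgebra is stable under `δ` if its generators are mapped into it. -/
theorem delta_mem_adjoin {X : Set (Op Idx)} (hX : ∀ g ∈ X, delta g ∈ Algebra.adjoin ℂ X)
    {T : Op Idx} (hT : T ∈ Algebra.adjoin ℂ X) (k : ℕ) : delta^[k] T ∈ Algebra.adjoin ℂ X := by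
  have h1 : ∀ T ∈ Algebra.adjoin ℂ X, delta T ∈ Algebra.adjoin ℂ X := by
    intro T hT
    induction hT using Algebra.adjoin_induction with
    | mem g hg => exact hX g hg
    | algebraMap c =>
      have e : delta (algebraMap ℂ (Op Idx) c) = 0 := by
        rw [delta, comm, Algebra.commutes]
        exact op_sub_self _
      rw [e]
      exact Subalgebra.zero_mem _
    | add S T _ _ hS hT => rw [delta_add]; exact Subalgebra.add_mem _ hS hT
    | mul S T hS' hT' hS hT =>
      rw [delta_mul]
      exact Subalgebra.add_mem _ (Subalgebra.mul_mem _ hS hT') (Subalgebra.mul_mem _ hS' hT)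
  induction k with
  | zero => exact hT
  | succ k ih =>
    rw [Function.iterate_succ_apply']
    exact h1 _ ih

/-- The generators are eigenvectors of `δ`, so that the algebra generated by them is stable under
`δ` and contains all `δ^k(𝒜)`. -/
theorem algB_le_adjoin (q : QParam) : algB q ≤ Algebra.adjoin ℂ (evenGens q ∪ oddGens q) := by
  refine Algebra.adjoin_le ?_
  rintro S ⟨k, T, hT, rfl⟩
  refine delta_mem_adjoin (fun g hg => ?_) ?_ k
  · rcases hg with hg | hg
    · obtain ⟨w, hw⟩ := exists_isEven hg
      rw [hw.delta_eq]
      exact Subalgebra.smul_mem _ (Algebra.subset_adjoin (Set.mem_union_left _ hg)) _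
    · rw [(isNegligible_oddGens hg).delta_eq]
      exact Subalgebra.zero_mem _
  · refine Algebra.adjoin_le (fun g hg => ?_) hT
    obtain ⟨U, hU, V, hV, W, hW, -, -, rfl⟩ := algA_generator hg
    exact Subalgebra.add_mem _ (Subalgebra.add_mem _ (Algebra.subset_adjoin (Or.inl hU))
      (Algebra.subset_adjoin (Or.inl hV))) (Algebra.subset_adjoin (Or.inr hW))

/-- The elements of `Ψ⁰_P` which are off-diagonal, exponentially small and commute with `|D|`. -/
def offGens (q : QParam) : Set (Op Idx) :=
  {T | T ∈ psi0P q ∧ IsSmall q T ∧ delta T = 0 ∧ IsOffDiag T}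

theorem oddGens_subset_offGens (q : QParam) : oddGens q ⊆ offGens q := fun _ hT =>
  have h := isNegligible_oddGens hT
  ⟨algB_le_psi0P q (gens_subset_algB q (Or.inr hT)), h.small, h.delta_eq, h.offDiag⟩

/-- Generators of `Ψ⁰_P`. -/
def fullGens (q : QParam) : Set (Op Idx) := evenGens q ∪ {pUp} ∪ offGens q

theorem comm_mul (R S T : Op Idx) : comm R (S * T) = comm R S * T + S * comm R T := by
  rw [comm, comm, comm, op_sub_mul, op_mul_sub, mul_assoc, mul_assoc, mul_assoc]
  module

theorem comm_add (R S T : Op Idx) : comm R (S + T) = comm R S + comm R T := by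
  rw [comm, comm, comm, mul_add, add_mul]
  module

theorem signD_mem {S : Subalgebra ℂ (Op Idx)} (h : pUp ∈ S) : signD ∈ S := by
  have e : signD = (2 : ℂ) • pUp + (-1 : ℂ) • 1 := by rw [signD_eq']; module
  rw [e]
  exact S.add_mem (S.smul_mem h _) (S.smul_mem S.one_mem _)

theorem IsEven.comm_dirac_mem {S : Subalgebra ℂ (Op Idx)} (h : pUp ∈ S) {T : Op Idx} {w : ℝ}
    (hT : IsEven T w) (hTS : T ∈ S) : comm dirac T ∈ S := by
  rw [hT.comm_dirac]
  exact S.smul_mem (S.mul_mem (signD_mem h) hTS) _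

/-- For an even generator `T` of degree `w`, `[D, T] = F [|D|, T] = w F T` with `F = 2 P^↑ - 1`;
for an odd one, `[D, T] = 2 F |D| T` is again small, off-diagonal and of degree `0`. -/
theorem psi0P_le_adjoin (q : QParam) : psi0P q ≤ Algebra.adjoin ℂ (fullGens q) := by
  set S := Algebra.adjoin ℂ (fullGens q) with hS
  have hpUp : pUp ∈ S := Algebra.subset_adjoin (Or.inl (Or.inr rfl))
  have heven : ∀ T ∈ evenGens q, T ∈ S := fun T hT => Algebra.subset_adjoin (Or.inl (Or.inl hT))
  have hoff : ∀ T ∈ offGens q, T ∈ S := fun T hT => Algebra.subset_adjoin (Or.inr hT)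
  have hδ : ∀ g ∈ fullGens q, delta g ∈ S := by
    rintro g ((hg | rfl) | hg)
    · obtain ⟨w, hw⟩ := exists_isEven hg
      rw [hw.delta_eq]
      exact S.smul_mem (heven _ hg) _
    · rw [delta_pUp]
      exact S.zero_mem
    · rw [hg.2.2.1]
      exact S.zero_mem
  have hA : ∀ T ∈ algA q, T ∈ S ∧ comm dirac T ∈ S := by
    intro T hT
    induction hT using Algebra.adjoin_induction with
    | mem g hg =>
      obtain ⟨U, hU, V, hV, W, hW, hU1, hV1, h⟩ := algA_generator hg
      refine ⟨?_, ?_⟩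
      · rw [h]
        exact S.add_mem (S.add_mem (heven _ hU) (heven _ hV))
          (hoff _ (oddGens_subset_offGens q hW))
      · rw [h, comm_add, comm_add]
        refine S.add_mem (S.add_mem (hU1.comm_dirac_mem hpUp (heven _ hU))
          (hV1.comm_dirac_mem hpUp (heven _ hV))) (hoff _ ?_)
        refine ⟨?_, (isNegligible_oddGens hW).comm_dirac_prop⟩
        -- `[D, W]` is the difference of `[D, g]` and of the commutators with the even parts
        have hP := pUp_mem q
        have hB : ∀ R ∈ evenGens q, R ∈ psi0P q := fun R hR =>
          algB_le_psi0P q (gens_subset_algB q (Or.inl hR))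
        have e : comm dirac W = comm dirac g +
            (-1 : ℂ) • (comm dirac U + comm dirac V) := by
          rw [h, comm_add, comm_add]; module
        rw [e]
        refine (psi0P q).add_mem (psi0_le_psi0P q (Algebra.subset_adjoin
          ⟨0, g, Algebra.subset_adjoin hg, Or.inr rfl⟩)) ((psi0P q).smul_mem ((psi0P q).add_mem
            (hU1.comm_dirac_mem hP (hB _ hU)) (hV1.comm_dirac_mem hP (hB _ hV))) _)
    | algebraMap c =>
      have e : comm dirac (algebraMap ℂ (Op Idx) c) = 0 := by
        rw [comm, Algebra.commutes]
        exact op_sub_self _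
      rw [e]
      exact ⟨S.algebraMap_mem c, S.zero_mem⟩
    | add T T' _ _ h h' =>
      rw [comm_add]
      exact ⟨S.add_mem h.1 h'.1, S.add_mem h.2 h'.2⟩
    | mul T T' _ _ h h' =>
      rw [comm_mul]
      exact ⟨S.mul_mem h.1 h'.1, S.add_mem (S.mul_mem h.2 h'.1) (S.mul_mem h.1 h'.2)⟩
  refine Algebra.adjoin_le ?_
  rintro T (hT | rfl)
  · refine Algebra.adjoin_le ?_ hT
    rintro R ⟨k, T, hT, (rfl | rfl)⟩
    · exact delta_mem_adjoin hδ (hA T hT).1 k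
    · exact delta_mem_adjoin hδ (hA T hT).2 k
  · exact hpUp

/-! ### The symbol maps -/

/-- Homomorphisms on a subalgebra which agree on a generating set are equal. -/
theorem algHom_ext_of_le_adjoin {A B : Type*} [Semiring A] [Algebra ℂ A] [Semiring B]
    [Algebra ℂ B] {S : Subalgebra ℂ A} {X : Set A} (hS : S ≤ Algebra.adjoin ℂ X)
    {φ ψ : S →ₐ[ℂ] B} (h : ∀ x ∈ X, ∃ hx : x ∈ S, φ ⟨x, hx⟩ = ψ ⟨x, hx⟩) : φ = ψ := by
  have h1 : Algebra.adjoin ℂ X ≤ (AlgHom.equalizer φ ψ).map S.val :=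
    Algebra.adjoin_le fun x hx => by
      obtain ⟨hxS, e⟩ := h x hx
      exact ⟨⟨x, hxS⟩, e, rfl⟩
  refine AlgHom.ext fun x => ?_
  obtain ⟨y, hy, e⟩ := h1 (hS x.2)
  have : y = x := Subtype.ext e
  rw [← this]
  exact hy

theorem evenGens_symbol {T : Op Idx} (hT : T ∈ evenGens q) :
    ∃ g : SymbolAlg q, (T, fun _ => g) ∈ symbolGraph q := by
  rcases hT with rfl | rfl | rfl | rfl | rfl | rfl | rfl | rfl
  exacts [⟨_, (mem_aPlus q).1⟩, ⟨_, (mem_aMinus q).1⟩, ⟨_, (mem_bPlus q).1⟩,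
    ⟨_, (mem_bMinus q).1⟩, ⟨_, (mem_aPlus q).2⟩, ⟨_, (mem_aMinus q).2⟩, ⟨_, (mem_bPlus q).2⟩,
    ⟨_, (mem_bMinus q).2⟩]

theorem exists_symbol {T : Op Idx} (hT : T ∈ psi0P q) :
    ∃ f : Spin → SymbolAlg q, (T, f) ∈ symbolGraph q := by
  have h : Algebra.adjoin ℂ (fullGens q) ≤
      (symbolGraph q).map (AlgHom.fst ℂ (Op Idx) (Spin → SymbolAlg q)) := by
    refine Algebra.adjoin_le ?_
    rintro T ((hT | rfl) | hT)
    · obtain ⟨g, hg⟩ := evenGens_symbol hT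
      exact ⟨_, hg, rfl⟩
    · exact ⟨_, mem_symbolGraph_pUp, rfl⟩
    · exact ⟨_, mem_symbolGraph_of_isSmall hT.2.1, rfl⟩
  obtain ⟨⟨_, f⟩, hf, rfl⟩ := h (psi0P_le_adjoin q hT)
  exact ⟨f, hf⟩

/-- The pair of symbols of an element of `Ψ⁰_P`. -/
def symVal {T : Op Idx} (hT : T ∈ psi0P q) : Spin → SymbolAlg q := (exists_symbol hT).choose

theorem symVal_mem {T : Op Idx} (hT : T ∈ psi0P q) : (T, symVal hT) ∈ symbolGraph q :=
  (exists_symbol hT).choose_spec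

theorem symVal_eq {T : Op Idx} (hT : T ∈ psi0P q) {f : Spin → SymbolAlg q}
    (h : (T, f) ∈ symbolGraph q) : symVal hT = f :=
  symbolGraph_unique (symVal_mem hT) h

theorem symVal_mul {S T : Op Idx} (hS : S ∈ psi0P q) (hT : T ∈ psi0P q) :
    symVal ((psi0P q).mul_mem hS hT) = symVal hS * symVal hT :=
  symVal_eq _ (ActsAs.mul (symVal_mem hS) (symVal_mem hT))

theorem symVal_add {S T : Op Idx} (hS : S ∈ psi0P q) (hT : T ∈ psi0P q) :
    symVal ((psi0P q).add_mem hS hT) = symVal hS + symVal hT :=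
  symVal_eq _ (ActsAs.add (symVal_mem hS) (symVal_mem hT))

theorem symVal_algebraMap (c : ℂ) :
    symVal ((psi0P q).algebraMap_mem c) = algebraMap ℂ (Spin → SymbolAlg q) c :=
  symVal_eq _ (ActsAs.scalar c)

theorem symVal_one : symVal (psi0P q).one_mem = 1 := symVal_eq _ (symbolGraph q).one_mem

theorem symVal_zero : symVal (psi0P q).zero_mem = 0 := symVal_eq _ (symbolGraph q).zero_mem

/-- The symbol map on `Ψ⁰_P`: the pair of symbols determined by the graph. -/
def symR (q : QParam) : psi0P q →ₐ[ℂ] (Spin → SymbolAlg q) where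
  toFun T := symVal T.2
  map_one' := symVal_one
  map_mul' S T := symVal_mul S.2 T.2
  map_zero' := symVal_zero
  map_add' S T := symVal_add S.2 T.2
  commutes' c := symVal_algebraMap c

theorem symR_mem (T : psi0P q) : ((T : Op Idx), symR q T) ∈ symbolGraph q :=
  symVal_mem T.2

theorem symR_eq {T : Op Idx} (hT : T ∈ psi0P q) {f : Spin → SymbolAlg q}
    (h : (T, f) ∈ symbolGraph q) : symR q ⟨T, hT⟩ = f :=
  symbolGraph_unique (symR_mem ⟨T, hT⟩) h

/-- The symbol map on `ℬ`. -/
def symRho (q : QParam) : algB q →ₐ[ℂ] SymbolAlg q :=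
  (Pi.evalAlgHom ℂ (fun _ : Spin => SymbolAlg q) .up).comp
    ((symR q).comp (Subalgebra.inclusion (algB_le_psi0P q)))

/-- On `ℬ` the two components of the symbol agree: the symbols of the generators are constant pairs.
-/
theorem symR_inclusion (T : algB q) (s : Spin) :
    symR q (Subalgebra.inclusion (algB_le_psi0P q) T) s = symRho q T := by
  have h : (Pi.evalAlgHom ℂ (fun _ : Spin => SymbolAlg q) s).comp
      ((symR q).comp (Subalgebra.inclusion (algB_le_psi0P q))) = symRho q := by
    refine algHom_ext_of_le_adjoin (algB_le_adjoin q) fun x hx => ?_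
    have hxB := gens_subset_algB q hx
    refine ⟨hxB, ?_⟩
    change symR q ⟨x, _⟩ s = symR q ⟨x, _⟩ .up
    rcases hx with hx | hx
    · obtain ⟨g, hg⟩ := evenGens_symbol hx
      rw [symR_eq (algB_le_psi0P q hxB) hg]
    · rw [symR_eq (algB_le_psi0P q hxB)
        (mem_symbolGraph_of_isSmall (isNegligible_oddGens hx).small)]
      rfl
  exact DFunLike.congr_fun h T

theorem symRho_eq {T : Op Idx} (hT : T ∈ algB q) {f : Spin → SymbolAlg q}
    (h : (T, f) ∈ symbolGraph q) : symRho q ⟨T, hT⟩ = f .up := by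
  rw [← symR_inclusion _ .up]
  exact congrFun (symR_eq (algB_le_psi0P q hT) h) _

theorem sends_symRho {T : Op Idx} (hT : T ∈ evenGens q ∪ oddGens q) {f : Spin → SymbolAlg q}
    (h : (T, f) ∈ symbolGraph q) {v : SymbolAlg q} (hv : f .up = v) : Sends (symRho q) T v :=
  ⟨gens_subset_algB q hT, (symRho_eq _ h).trans hv⟩

theorem isSymbolMap_symRho (q : QParam) : IsSymbolMap q (symRho q) where
  aPlus := by
    rw [diagPart_aPlus]
    exact sends_symRho (Or.inl (by simp [evenGens])) (mem_aPlus q).1 (by simp [genSymbol])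
  aMinus := by
    rw [diagPart_aMinus]
    exact sends_symRho (Or.inl (by simp [evenGens])) (mem_aMinus q).1 (by simp [genSymbol])
  bPlus := by
    rw [diagPart_bPlus]
    exact sends_symRho (Or.inl (by simp [evenGens])) (mem_bPlus q).1 (by simp [genSymbol])
  bMinus := by
    rw [diagPart_bMinus]
    exact sends_symRho (Or.inl (by simp [evenGens])) (mem_bMinus q).1 (by simp [genSymbol])
  aSlash := by
    rw [slash_a]
    exact sends_symRho (Or.inr (by simp [oddGens]))
      (mem_symbolGraph_of_isSmall (isNegligible_aSl q).small) rfl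
  bSlash := by
    rw [slash_b]
    exact sends_symRho (Or.inr (by simp [oddGens]))
      (mem_symbolGraph_of_isSmall (isNegligible_bSl q).small) rfl
  aPlusStar := by
    rw [diagPart_aPlus]
    exact ⟨_, isAdj_shift _ _ _ _ _,
      sends_symRho (Or.inl (by simp [evenGens, shiftAdj])) (mem_aPlus q).2 (by simp [genSymbol])⟩
  aMinusStar := by
    rw [diagPart_aMinus]
    exact ⟨_, isAdj_shift _ _ _ _ _,
      sends_symRho (Or.inl (by simp [evenGens, shiftAdj])) (mem_aMinus q).2 (by simp [genSymbol])⟩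
  bPlusStar := by
    rw [diagPart_bPlus]
    exact ⟨_, isAdj_shift _ _ _ _ _,
      sends_symRho (Or.inl (by simp [evenGens, shiftAdj])) (mem_bPlus q).2 (by simp [genSymbol])⟩
  bMinusStar := by
    rw [diagPart_bMinus]
    exact ⟨_, isAdj_shift _ _ _ _ _,
      sends_symRho (Or.inl (by simp [evenGens, shiftAdj])) (mem_bMinus q).2 (by simp [genSymbol])⟩
  aSlashStar := by
    rw [slash_a]
    exact ⟨_, isAdj_aSlAdj q, sends_symRho (Or.inr (by simp [oddGens]))
      (mem_symbolGraph_of_isSmall (isNegligible_aSlAdj q).small) rfl⟩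
  bSlashStar := by
    rw [slash_b]
    exact ⟨_, isAdj_bSlAdj q, sends_symRho (Or.inr (by simp [oddGens]))
      (mem_symbolGraph_of_isSmall (isNegligible_bSlAdj q).small) rfl⟩

theorem Sends.agree {S : Subalgebra ℂ (Op Idx)} {V : Type} {ρ ρ' : S → V} {T : Op Idx} {v : V}
    (h : Sends ρ T v) (h' : Sends ρ' T v) : ∃ hT : T ∈ S, ρ ⟨T, hT⟩ = ρ' ⟨T, hT⟩ :=
  ⟨h.1, h.2.trans h'.2.symm⟩

theorem SendsAdj.sends {S : Subalgebra ℂ (Op Idx)} {V : Type} {ρ : S → V} {T T' : Op Idx} {v : V}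
    (h : SendsAdj ρ T v) (hT : IsAdj T' T) : Sends ρ T' v := by
  obtain ⟨T'', h1, h2⟩ := h
  rwa [isAdj_unique hT h1]

theorem IsAdj.congr_right {S T T' : Op Idx} (e : T' = T) (h : IsAdj S T) : IsAdj S T' := e ▸ h

theorem isSymbolMap_unique {ρ ρ' : algB q →ₐ[ℂ] SymbolAlg q} (h : IsSymbolMap q ρ)
    (h' : IsSymbolMap q ρ') : ρ = ρ' := by
  refine algHom_ext_of_le_adjoin (algB_le_adjoin q) ?_
  rintro T ((rfl | rfl | rfl | rfl | rfl | rfl | rfl | rfl) | (rfl | rfl | rfl | rfl))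
  · rw [← diagPart_aPlus]; exact h.aPlus.agree h'.aPlus
  · rw [← diagPart_aMinus]; exact h.aMinus.agree h'.aMinus
  · rw [← diagPart_bPlus]; exact h.bPlus.agree h'.bPlus
  · rw [← diagPart_bMinus]; exact h.bMinus.agree h'.bMinus
  · have e := IsAdj.congr_right (diagPart_aPlus q) (isAdj_shift 1 1 1 1 (wAP q))
    exact (h.aPlusStar.sends e).agree (h'.aPlusStar.sends e)
  · have e := IsAdj.congr_right (diagPart_aMinus q) (isAdj_shift 1 (-1) 0 0 (wAM q))
    exact (h.aMinusStar.sends e).agree (h'.aMinusStar.sends e)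
  · have e := IsAdj.congr_right (diagPart_bPlus q) (isAdj_shift 1 1 1 0 (wBP q))
    exact (h.bPlusStar.sends e).agree (h'.bPlusStar.sends e)
  · have e := IsAdj.congr_right (diagPart_bMinus q) (isAdj_shift 1 (-1) 0 (-1) (wBM q))
    exact (h.bMinusStar.sends e).agree (h'.bMinusStar.sends e)
  · rw [← slash_a]; exact h.aSlash.agree h'.aSlash
  · rw [← slash_b]; exact h.bSlash.agree h'.bSlash
  · have e := IsAdj.congr_right (slash_a q) (isAdj_aSlAdj q)
    exact (h.aSlashStar.sends e).agree (h'.aSlashStar.sends e)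
  · have e := IsAdj.congr_right (slash_b q) (isAdj_bSlAdj q)
    exact (h.bSlashStar.sends e).agree (h'.bSlashStar.sends e)

theorem isExtendedSymbolMap_symR (q : QParam) : IsExtendedSymbolMap q (symRho q) (symR q) where
  extends_symbol T := funext fun s => symR_inclusion T s
  map_pUp := symR_eq (pUp_mem q) mem_symbolGraph_pUp

/-- Any extension of the symbol map annihilates the off-diagonal elements, because `P^↑` is
sent to a central element. -/
theorem map_offDiag {R : psi0P q →ₐ[ℂ] (Spin → SymbolAlg q)}
    (hR : R ⟨pUp, pUp_mem q⟩ = Pi.single Spin.up 1) {T : Op Idx} (hT : T ∈ psi0P q)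
    (h : IsOffDiag T) : R ⟨T, hT⟩ = 0 := by
  set g := R ⟨T, hT⟩ with hg
  have e : (⟨pUp, pUp_mem q⟩ : psi0P q) * ⟨T, hT⟩ + ⟨T, hT⟩ * ⟨pUp, pUp_mem q⟩ = ⟨T, hT⟩ :=
    Subtype.ext h
  have h1 := congrArg R e
  have hadd : ∀ a b, R (a + b) = R a + R b := R.map_add'
  have hmul : ∀ a b, R (a * b) = R a * R b := R.map_mul'
  rw [hadd, hmul, hmul, hR, ← hg] at h1
  funext s
  have h2 := congrFun h1 s
  rw [Pi.add_apply, Pi.mul_apply, Pi.mul_apply] at h2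
  cases s
  · rw [Pi.single_eq_same, one_mul, mul_one] at h2
    have e1 : g .up = (g .up + g .up) + (-1 : ℂ) • g .up := by module
    rw [e1, h2, Pi.zero_apply]
    module
  · rw [Pi.single_eq_of_ne (by decide), zero_mul, mul_zero, add_zero] at h2
    exact h2.symm

theorem isExtendedSymbolMap_unique {ρ : algB q →ₐ[ℂ] SymbolAlg q}
    {R R' : psi0P q →ₐ[ℂ] (Spin → SymbolAlg q)} (h : IsExtendedSymbolMap q ρ R)
    (h' : IsExtendedSymbolMap q ρ R') : R = R' := by
  refine algHom_ext_of_le_adjoin (psi0P_le_adjoin q) ?_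
  rintro T ((hT | rfl) | hT)
  · have hTB := gens_subset_algB q (Or.inl hT)
    exact ⟨algB_le_psi0P q hTB, (h.extends_symbol ⟨T, hTB⟩).trans
      (h'.extends_symbol ⟨T, hTB⟩).symm⟩
  · exact ⟨pUp_mem q, h.map_pUp.trans h'.map_pUp.symm⟩
  · exact ⟨hT.1, (map_offDiag h.map_pUp hT.1 hT.2.2.2).trans
      (map_offDiag h'.map_pUp hT.1 hT.2.2.2).symm⟩

/-! ### Dirichlet series over the spectrum of `|D|` -/

/-- The zeta function `∑ (m + 1/2)^{-z}` of the spectrum of `|D|`. -/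
def specZeta (z : ℂ) : ℂ := HurwitzZeta.hurwitzZeta ((1 / 2 : ℝ) : UnitAddCircle) z

theorem hasSum_specZeta {z : ℂ} (hz : 1 < z.re) :
    HasSum (fun m : ℕ => ((m + 1 / 2 : ℝ) : ℂ) ^ (-z)) (specZeta z) := by
  have h := HurwitzZeta.hasSum_hurwitzZeta_of_one_lt_re (a := 1 / 2) ⟨by norm_num, by norm_num⟩ hz
  refine h.congr_fun fun m => ?_
  rw [Complex.cpow_neg, ← one_div ((_ : ℂ) ^ z)]
  push_cast
  rfl

theorem analyticAt_specZeta {z : ℂ} (hz : z ≠ 1) : AnalyticAt ℂ specZeta z := by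
  have h : DifferentiableOn ℂ specZeta {1}ᶜ := fun w hw =>
    (HurwitzZeta.differentiableAt_hurwitzZeta _ hw).differentiableWithinAt
  exact h.analyticAt (isOpen_compl_singleton.mem_nhds hz)

theorem tendsto_specZeta :
    Tendsto (fun z => (z - 1) * specZeta z) (𝓝[≠] 1) (𝓝 1) := HurwitzZeta.hurwitzZeta_residue_one _

theorem meromorphicAt_specZeta (z : ℂ) : MeromorphicAt specZeta z := by
  by_cases hz : z = 1
  · subst hz
    -- `(z - 1) ζ(z)` is bounded and holomorphic around `1`
    have h2 : ∀ᶠ s in 𝓝[≠] (1 : ℂ), DifferentiableAt ℂ (fun s => (s - 1) * specZeta s) s := by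
      filter_upwards [self_mem_nhdsWithin] with s hs
      exact (differentiableAt_id.sub_const 1).mul (HurwitzZeta.differentiableAt_hurwitzZeta _ hs)
    have h3 : MeromorphicAt (fun s => (s - 1) * specZeta s) 1 := by
      have hlim := tendsto_specZeta
      have hu : AnalyticAt ℂ (Function.update (fun s => (s - 1) * specZeta s) 1 1) 1 := by
        refine Complex.analyticAt_of_differentiable_on_punctured_nhds_of_continuousAt ?_ ?_
        · filter_upwards [h2, self_mem_nhdsWithin] with s hs hs1
          refine hs.congr_of_eventuallyEq ?_
          filter_upwards [isOpen_compl_singleton.mem_nhds hs1] with t ht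
          exact Function.update_of_ne ht _ _
        · exact continuousAt_update_same.2 hlim
      refine hu.meromorphicAt.congr ?_
      filter_upwards [self_mem_nhdsWithin] with s hs
      exact Function.update_of_ne hs _ _
    have h4 : MeromorphicAt (fun s : ℂ => (s - 1)⁻¹ * ((s - 1) * specZeta s)) 1 :=
      ((MeromorphicAt.id _).sub (MeromorphicAt.const 1 _)).inv.mul h3
    refine h4.congr ?_
    filter_upwards [self_mem_nhdsWithin] with s hs
    have : s - 1 ≠ 0 := sub_ne_zero.2 hs
    field_simp
  · exact (analyticAt_specZeta hz).meromorphicAt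

theorem norm_spec_cpow_le (m K : ℕ) {z : ℂ} (hz : ‖z‖ ≤ K) :
    ‖((m + 1 / 2 : ℝ) : ℂ) ^ (-z)‖ ≤ ((m : ℝ) + 2) ^ K := by
  have hd : (0 : ℝ) < m + 1 / 2 := by positivity
  have hm : (0 : ℝ) < (m : ℝ) + 2 := by positivity
  rw [Complex.norm_cpow_eq_rpow_re_of_pos hd, Complex.neg_re, Real.rpow_def_of_pos hd,
    ← Real.rpow_natCast, Real.rpow_def_of_pos hm]
  refine Real.exp_le_exp.2 ?_
  have hre : |z.re| ≤ K := (Complex.abs_re_le_norm z).trans hz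
  have hlog : |Real.log (m + 1 / 2)| ≤ Real.log (m + 2) := by
    rw [abs_le]
    constructor
    · have h0 : (0 : ℝ) ≤ m := m.cast_nonneg
      have h1 : ((m : ℝ) + 2)⁻¹ ≤ 2⁻¹ := inv_anti₀ (by norm_num) (by linarith)
      rw [← Real.log_inv]
      exact Real.log_le_log (by positivity) (by linarith)
    · exact Real.log_le_log hd (by linarith)
  calc Real.log (m + 1 / 2) * -z.re ≤ |Real.log (m + 1 / 2)| * |z.re| := by
        rw [← abs_neg z.re, ← abs_mul]; exact le_abs_self _
    _ ≤ Real.log (m + 2) * K := mul_le_mul hlog hre (abs_nonneg _) ((abs_nonneg _).trans hlog)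

theorem summable_shift_pow_mul_geometric (k : ℕ) {r : ℝ} (h0 : 0 < r) (h1 : r < 1) :
    Summable fun m : ℕ => ((m : ℝ) + 2) ^ k * r ^ m := by
  have h := summable_pow_mul_geometric_of_norm_lt_one k (r := r)
    (by rwa [Real.norm_eq_abs, abs_of_pos h0])
  have h2 := ((summable_nat_add_iff 2).2 h).mul_left (r ^ 2)⁻¹
  refine h2.congr fun m => ?_
  rw [pow_add]
  push_cast
  field_simp

/-- The Dirichlet series of an exponentially decaying sequence is entire. -/
theorem differentiable_dirichlet {e : ℕ → ℂ} {C r : ℝ} (h0 : 0 < r) (h1 : r < 1)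
    (he : ∀ m, ‖e m‖ ≤ C * ((m : ℝ) + 2) ^ 2 * r ^ m) :
    Differentiable ℂ (fun z : ℂ => ∑' m : ℕ, e m * ((m + 1 / 2 : ℝ) : ℂ) ^ (-z)) ∧
      ∀ z : ℂ, Summable fun m : ℕ => e m * ((m + 1 / 2 : ℝ) : ℂ) ^ (-z) := by
  have hle : ∀ (K : ℕ) (m : ℕ) (z : ℂ), ‖z‖ ≤ K → ‖e m * ((m + 1 / 2 : ℝ) : ℂ) ^ (-z)‖ ≤
      C * (((m : ℝ) + 2) ^ (2 + K) * r ^ m) := by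
    intro K m z hz
    rw [norm_mul]
    calc _ ≤ (C * ((m : ℝ) + 2) ^ 2 * r ^ m) * ((m : ℝ) + 2) ^ K :=
          mul_le_mul (he m) (norm_spec_cpow_le m K hz) (norm_nonneg _)
            ((norm_nonneg _).trans (he m))
      _ = _ := by ring
  have hs : ∀ K : ℕ, Summable fun m : ℕ => C * (((m : ℝ) + 2) ^ (2 + K) * r ^ m) := fun K =>
    (summable_shift_pow_mul_geometric (2 + K) h0 h1).mul_left C
  constructor
  · intro z
    obtain ⟨K, hK⟩ := exists_nat_gt ‖z‖
    have h := Complex.differentiableOn_tsum_of_summable_norm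
      (F := fun (m : ℕ) (z : ℂ) => e m * ((m + 1 / 2 : ℝ) : ℂ) ^ (-z))
      (U := Metric.ball 0 K) (hs K) (fun m => ?_) Metric.isOpen_ball
      fun m w hw => hle K m w (by simpa using (Metric.mem_ball.1 hw).le)
    · exact h.differentiableAt (Metric.isOpen_ball.mem_nhds (by simpa using hK))
    · have hd : ((m + 1 / 2 : ℝ) : ℂ) ≠ 0 := by
        have : (0 : ℝ) < m + 1 / 2 := by positivity
        exact_mod_cast this.ne'
      exact ((differentiable_neg.const_cpow (Or.inl hd)).const_mul _).differentiableOn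
  · intro z
    obtain ⟨K, hK⟩ := exists_nat_gt ‖z‖
    exact Summable.of_norm_bounded (hs K) fun m => hle K m z hK.le

/-- A Dirichlet series over the spectrum of `|D|` whose coefficients are a quadratic polynomial in
the eigenvalue, up to an exponentially small error, has at most simple poles, located at
`1`, `2`, `3`, with the coefficients of the polynomial as residues. -/
theorem exists_continuation {L : ℕ → ℂ} {α β γ : ℂ} {C r : ℝ} (h0 : 0 < r) (h1 : r < 1)
    (hL : ∀ m : ℕ, ‖L m - (α * ((m + 1 / 2 : ℝ) : ℂ) ^ 2 + β * ((m + 1 / 2 : ℝ) : ℂ) + γ)‖ ≤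
      C * ((m : ℝ) + 2) ^ 2 * r ^ m) :
    ∃ Z : ℂ → ℂ, (∀ z : ℂ, 3 < z.re →
        HasSum (fun m : ℕ => L m * ((m + 1 / 2 : ℝ) : ℂ) ^ (-z)) (Z z)) ∧
      (∀ w, MeromorphicAt Z w) ∧ (∀ w : ℂ, w ∉ ({1, 2, 3} : Set ℂ) → AnalyticAt ℂ Z w) ∧
      Tendsto (fun z => (z - 3) * Z z) (𝓝[≠] 3) (𝓝 α) ∧
      Tendsto (fun z => (z - 2) * Z z) (𝓝[≠] 2) (𝓝 β) ∧
      Tendsto (fun z => (z - 1) * Z z) (𝓝[≠] 1) (𝓝 γ) := by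
  set e : ℕ → ℂ := fun m =>
    L m - (α * ((m + 1 / 2 : ℝ) : ℂ) ^ 2 + β * ((m + 1 / 2 : ℝ) : ℂ) + γ) with he
  obtain ⟨hE, hEs⟩ := differentiable_dirichlet (e := e) h0 h1 hL
  set E : ℂ → ℂ := fun z => ∑' m : ℕ, e m * ((m + 1 / 2 : ℝ) : ℂ) ^ (-z) with hEdef
  have hsub : ∀ k w : ℂ, AnalyticAt ℂ (fun z : ℂ => z - k) w := fun k w =>
    analyticAt_id.sub analyticAt_const
  have hA : ∀ k w : ℂ, w - k ≠ 1 → AnalyticAt ℂ (fun z => specZeta (z - k)) w := fun k w h =>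
    (analyticAt_specZeta h).comp_of_eq (hsub k w) rfl
  have hEA : ∀ w, AnalyticAt ℂ E w := fun w => hE.analyticAt w
  have hM : ∀ k w : ℂ, MeromorphicAt (fun z => specZeta (z - k)) w := fun k w =>
    MeromorphicAt.comp_analyticAt (f := specZeta) (g := fun z => z - k)
      (meromorphicAt_specZeta (w - k)) (hsub k w)
  refine ⟨fun z => α * specZeta (z - 2) + β * specZeta (z - 1) + γ * specZeta (z - 0) + E z,
    ?_, ?_, ?_, ?_, ?_, ?_⟩
  · intro z hz
    have hd : ∀ m : ℕ, ((m + 1 / 2 : ℝ) : ℂ) ≠ 0 := fun m => by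
      have : (0 : ℝ) < m + 1 / 2 := by positivity
      exact_mod_cast this.ne'
    have s2 := (hasSum_specZeta (z := z - 2) (by simp; linarith)).mul_left α
    have s1 := (hasSum_specZeta (z := z - 1) (by simp; linarith)).mul_left β
    have s0 := (hasSum_specZeta (z := z - 0) (by simp; linarith)).mul_left γ
    refine (((s2.add s1).add s0).add (hEs z).hasSum).congr_fun fun m => ?_
    have e2 : -(z - 2) = (2 : ℕ) + -z := by push_cast; ring
    have e1 : -(z - 1) = 1 + -z := by ring
    rw [e2, e1, sub_zero, Complex.cpow_add _ _ (hd m), Complex.cpow_add _ _ (hd m),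
      Complex.cpow_natCast, Complex.cpow_one, he]
    ring
  · intro w
    exact ((((MeromorphicAt.const α w).mul (hM 2 w)).add ((MeromorphicAt.const β w).mul
      (hM 1 w))).add ((MeromorphicAt.const γ w).mul (hM 0 w))).add (hEA w).meromorphicAt
  · intro w hw
    simp only [Set.mem_insert_iff, Set.mem_singleton_iff, not_or] at hw
    refine (((analyticAt_const.mul (hA 2 w ?_)).add (analyticAt_const.mul (hA 1 w ?_))).add
      (analyticAt_const.mul (hA 0 w ?_))).add (hEA w)
    · intro h; exact hw.2.2 (by linear_combination h)
    · intro h; exact hw.2.1 (by linear_combination h)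
    · intro h; exact hw.1 (by linear_combination h)
  all_goals
    have hpole : ∀ k : ℂ, Tendsto (fun z => (z - (k + 1)) * specZeta (z - k)) (𝓝[≠] (k + 1))
        (𝓝 1) := by
      intro k
      have ht : Tendsto (fun z : ℂ => z - k) (𝓝[≠] (k + 1)) (𝓝[≠] 1) := by
        refine tendsto_nhdsWithin_iff.2 ⟨?_, ?_⟩
        · have : Tendsto (fun z : ℂ => z - k) (𝓝 (k + 1)) (𝓝 (k + 1 - k)) :=
            tendsto_id.sub_const k
          rw [add_sub_cancel_left] at this
          exact this.mono_left nhdsWithin_le_nhds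
        · filter_upwards [self_mem_nhdsWithin] with z hz h
          exact hz (by rw [Set.mem_singleton_iff] at h ⊢; linear_combination h)
      refine (tendsto_specZeta.comp ht).congr fun z => ?_
      simp only [Function.comp_apply]
      ring
    have hzero : ∀ (w : ℂ) (f : ℂ → ℂ), AnalyticAt ℂ f w →
        Tendsto (fun z => (z - w) * f z) (𝓝[≠] w) (𝓝 0) := by
      intro w f hf
      have : Tendsto (fun z => (z - w) * f z) (𝓝 w) (𝓝 ((w - w) * f w)) :=
        (tendsto_id.sub_const w).mul hf.continuousAt
      rw [sub_self, zero_mul] at this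
      exact this.mono_left nhdsWithin_le_nhds
  · have hp := (hpole 2).const_mul α
    norm_num at hp
    have hz := hzero 3 (fun z => β * specZeta (z - 1) + γ * specZeta (z - 0) + E z)
      (((analyticAt_const.mul (hA 1 3 (by norm_num))).add
        (analyticAt_const.mul (hA 0 3 (by norm_num)))).add (hEA 3))
    have := hp.add hz
    rw [add_zero] at this
    refine this.congr fun z => ?_
    ring
  · have hp := (hpole 1).const_mul β
    norm_num at hp
    have hz := hzero 2 (fun z => α * specZeta (z - 2) + γ * specZeta (z - 0) + E z)
      (((analyticAt_const.mul (hA 2 2 (by norm_num))).add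
        (analyticAt_const.mul (hA 0 2 (by norm_num)))).add (hEA 2))
    have := hp.add hz
    rw [add_zero] at this
    refine this.congr fun z => ?_
    ring
  · have hp := (hpole 0).const_mul γ
    rw [zero_add, mul_one] at hp
    have hz := hzero 1 (fun z => α * specZeta (z - 2) + β * specZeta (z - 1) + E z)
      (((analyticAt_const.mul (hA 2 1 (by norm_num))).add
        (analyticAt_const.mul (hA 1 1 (by norm_num)))).add (hEA 1))
    have := hp.add hz
    rw [add_zero] at this
    refine this.congr fun z => ?_
    ring

/-! ### Poles and meromorphic continuation -/

theorem neg_one_le_order_of_tendsto {Z : ℂ → ℂ} {w c : ℂ} (hZ : MeromorphicAt Z w)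
    (h : Tendsto (fun z => (z - w) * Z z) (𝓝[≠] w) (𝓝 c)) :
    ((-1 : ℤ) : WithTop ℤ) ≤ meromorphicOrderAt Z w := by
  have hid : MeromorphicAt (fun z : ℂ => z - w) w :=
    (MeromorphicAt.id w).sub (MeromorphicAt.const w w)
  have h1 : meromorphicOrderAt (fun z : ℂ => z - w) w = 1 := meromorphicOrderAt_id_sub_const
  have h2 : 0 ≤ meromorphicOrderAt ((fun z : ℂ => z - w) * Z) w :=
    (tendsto_nhds_iff_meromorphicOrderAt_nonneg (hid.mul hZ)).1 ⟨c, h⟩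
  rw [meromorphicOrderAt_mul hid hZ, h1] at h2
  cases hn : meromorphicOrderAt Z w with
  | top => exact le_top
  | coe n =>
    rw [hn] at h2
    have h3 : (0 : ℤ) ≤ 1 + n := by exact_mod_cast h2
    exact_mod_cast (by omega : (-1 : ℤ) ≤ n)

theorem order_neg_of_tendsto {Z : ℂ → ℂ} {w c : ℂ} (hZ : MeromorphicAt Z w) (hc : c ≠ 0)
    (h : Tendsto (fun z => (z - w) * Z z) (𝓝[≠] w) (𝓝 c)) : meromorphicOrderAt Z w < 0 := by
  by_contra h0
  rw [not_lt] at h0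
  obtain ⟨d, hd⟩ := (tendsto_nhds_iff_meromorphicOrderAt_nonneg hZ).2 h0
  have h1 : Tendsto (fun z : ℂ => z - w) (𝓝[≠] w) (𝓝 0) := by
    have : Tendsto (fun z : ℂ => z - w) (𝓝 w) (𝓝 (w - w)) := tendsto_id.sub_const w
    rw [sub_self] at this
    exact this.mono_left nhdsWithin_le_nhds
  have h2 := h1.mul hd
  rw [zero_mul] at h2
  exact hc (tendsto_nhds_unique h h2)

/-- Meromorphic functions which agree on a right half-plane have the same orders everywhere. -/
theorem order_eq_of_eq_on_halfPlane {Z Z' : ℂ → ℂ} (hZ : ∀ w, MeromorphicAt Z w)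
    (hZ' : ∀ w, MeromorphicAt Z' w) {R : ℝ} (h : ∀ z : ℂ, R < z.re → Z z = Z' z) (w : ℂ) :
    meromorphicOrderAt Z w = meromorphicOrderAt Z' w := by
  have hsub : MeromorphicOn (Z - Z') Set.univ := fun w _ => (hZ w).sub (hZ' w)
  have htop : meromorphicOrderAt (Z - Z') ((R + 1 : ℝ) : ℂ) = ⊤ := by
    rw [meromorphicOrderAt_eq_top_iff]
    have hopen : IsOpen {z : ℂ | R < z.re} := isOpen_lt continuous_const Complex.continuous_re
    have hmem : {z : ℂ | R < z.re} ∈ 𝓝 ((R + 1 : ℝ) : ℂ) :=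
      hopen.mem_nhds (by simp only [Set.mem_ofPred_eq, Complex.ofReal_re]; linarith)
    filter_upwards [nhdsWithin_le_nhds hmem] with z hz
    rw [Pi.sub_apply, h z hz, sub_self]
  have hw : meromorphicOrderAt (Z - Z') w = ⊤ := by
    by_contra hne
    exact hsub.meromorphicOrderAt_ne_top_of_isPreconnected isPreconnected_univ
      (Set.mem_univ w) (Set.mem_univ _) hne htop
  rw [meromorphicOrderAt_eq_top_iff] at hw
  refine meromorphicOrderAt_congr ?_
  filter_upwards [hw] with z hz
  exact sub_eq_zero.1 hz

/-! ### Hilbert–Schmidt operators and traces -/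

/-- Square summable columns define a Hilbert–Schmidt operator. -/
theorem exists_hilbertSchmidt (w : Idx → SpinorSpace) (hw : Summable fun i => ‖w i‖ ^ 2) :
    ∃ A : SpinorSpace →L[ℂ] SpinorSpace, IsHilbertSchmidt A ∧
      ∀ i, A (lp.single 2 i (1 : ℂ)) = w i := by
  have hg : Memℓp (fun i : Idx => ((‖w i‖ : ℝ) : ℂ)) 2 := memℓp_gen (by simpa using hw)
  let g : SpinorSpace := ⟨_, hg⟩
  have hgi : ∀ i, ‖g i‖ = ‖w i‖ := fun i => by simp [g]
  have h2 : (ENNReal.toReal 2).HolderConjugate (ENNReal.toReal 2) := by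
    rw [ENNReal.toReal_ofNat]; exact Real.HolderConjugate.two_two
  -- the Cauchy–Schwarz inequality
  have hCS : ∀ v : SpinorSpace, (Summable fun i => ‖v i • w i‖) ∧
      ∑' i, ‖v i • w i‖ ≤ ‖v‖ * ‖g‖ := fun v => by
    have h := lp.tsum_mul_le_mul_norm h2 v g
    simpa only [norm_smul, hgi] using h
  let A₀ : SpinorSpace →ₗ[ℂ] SpinorSpace :=
    { toFun := fun v => ∑' i, v i • w i
      map_add' := fun v v' => by
        rw [← (hCS v).1.of_norm.tsum_add (hCS v').1.of_norm]
        exact tsum_congr fun i => by rw [lp.coeFn_add, Pi.add_apply, add_smul]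
      map_smul' := fun c v => by
        rw [RingHom.id_apply, ← (hCS v).1.of_norm.tsum_const_smul]
        exact tsum_congr fun i => by rw [lp.coeFn_smul, Pi.smul_apply, smul_assoc] }
  let A : SpinorSpace →L[ℂ] SpinorSpace := A₀.mkContinuous ‖g‖ fun v =>
    (norm_tsum_le_tsum_norm (hCS v).1).trans ((hCS v).2.trans (mul_comm _ _).le)
  have hA : ∀ i, A (lp.single 2 i (1 : ℂ)) = w i := fun i => by
    change ∑' k, (lp.single 2 i (1 : ℂ) : SpinorSpace) k • w k = w i
    rw [tsum_eq_single i fun k hk => by rw [lp.single_apply_ne _ _ _ hk, zero_smul],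
      lp.single_apply_self, one_smul]
  exact ⟨A, by simpa only [IsHilbertSchmidt, hA] using hw, hA⟩

/-- The inclusion of the algebraic span of the basis into the Hilbert space. -/
def emb : Core Idx →ₗ[ℂ] SpinorSpace :=
  Finsupp.linearCombination ℂ fun i => lp.single 2 i (1 : ℂ)

theorem emb_apply (v : Core Idx) (k : Idx) : emb v k = v k := by
  classical
  induction v using Finsupp.induction_linear with
  | zero => simp
  | add v w hv hw => rw [map_add, lp.coeFn_add, Pi.add_apply, hv, hw, Finsupp.add_apply]
  | single i c =>
    rw [emb, Finsupp.linearCombination_single, lp.coeFn_smul, Pi.smul_apply]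
    by_cases h : k = i
    · subst h; simp
    · rw [lp.single_apply_ne _ _ _ h]; simp [Ne.symm h]

theorem norm_emb_le (v : Core Idx) : ‖emb v‖ ≤ nrm v := by
  rw [emb, Finsupp.linearCombination_apply, nrm]
  refine (norm_sum_le _ _).trans (Finset.sum_le_sum fun i _ => ?_)
  rw [norm_smul, lp.norm_single (by norm_num), norm_one, mul_one]

theorem absDiracPow_single (w : ℂ) (i : Idx) : absDiracPow w (Finsupp.single i 1) =
    ((absEv i.n i.s : ℝ) : ℂ) ^ w • Finsupp.single i 1 := by
  rw [absDiracPow, diag, ofBasis_single, abs_diracEv]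
  simp

theorem absDiracPow_mul (v w : ℂ) : absDiracPow v * absDiracPow w = absDiracPow (v + w) := by
  refine op_ext fun i => ?_
  have h : ((absEv i.n i.s : ℝ) : ℂ) ≠ 0 := by exact_mod_cast (absEv_pos i).ne'
  rw [Module.End.mul_apply, absDiracPow_single, map_smul, absDiracPow_single, absDiracPow_single,
    smul_smul, Complex.cpow_add _ _ h, mul_comm]

/-- The trace is determined by the operator on the span of the basis. -/
theorem HasTrace.unique {T : Op Idx} {t t' : ℂ} (h : HasTrace T t) (h' : HasTrace T t') :
    t = t' := by
  obtain ⟨S, hS, -, hs⟩ := h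
  obtain ⟨S', hS', -, hs'⟩ := h'
  refine hs.unique (hs'.congr_fun fun i => ?_)
  rw [lp.inner_single_left, lp.inner_single_left, hS, hS']

/-! ### The eigenspaces of `|D|` -/

/-- The labels of the basis of the eigenspace of `|D|` for the eigenvalue `m + 1/2`: pairs `(x, y)`
for spin `↑` and `2j = m - 1`, or for spin `↓` and `2j = m`. -/
abbrev Level (m : ℕ) : Type := (Fin m × Fin (m + 1)) ⊕ (Fin (m + 1) × Fin m)

/-- The label of a basis vector of an eigenspace of `|D|`. -/
def idxOf : (Σ m : ℕ, Level m) → Idx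
  | ⟨m, .inl p⟩ => ⟨m - 1, p.1, p.2, .up, by omega, by simp only [yMax]; omega⟩
  | ⟨m, .inr p⟩ => ⟨m, p.1, p.2, .dn, by omega, by simp only [yMax]; omega⟩

theorem idxOf_bijective : Function.Bijective idxOf := by
  constructor
  · rintro ⟨m, ⟨⟨x, hx⟩, ⟨y, hy⟩⟩ | ⟨⟨x, hx⟩, ⟨y, hy⟩⟩⟩
      ⟨m', ⟨⟨x', hx'⟩, ⟨y', hy'⟩⟩ | ⟨⟨x', hx'⟩, ⟨y', hy'⟩⟩⟩ h
    · simp only [idxOf, Idx.mk.injEq] at h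
      obtain rfl : m = m' := by omega
      obtain rfl : x = x' := by omega
      obtain rfl : y = y' := by omega
      rfl
    · simp [idxOf] at h
    · simp [idxOf] at h
    · simp only [idxOf, Idx.mk.injEq] at h
      obtain rfl : m = m' := by omega
      obtain rfl : x = x' := by omega
      obtain rfl : y = y' := by omega
      rfl
  · rintro ⟨n, x, y, s, hx, hy⟩
    cases s
    · simp only [yMax] at hy
      refine ⟨⟨(n + 1).toNat, .inl (⟨x.toNat, by omega⟩, ⟨y.toNat, by omega⟩)⟩, ?_⟩
      exact (Idx.mk.injEq ..).mpr ⟨by omega, Int.toNat_of_nonneg hx.1,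
        Int.toNat_of_nonneg hy.1, rfl⟩
    · simp only [yMax] at hy
      refine ⟨⟨n.toNat, .inr (⟨x.toNat, by omega⟩, ⟨y.toNat, by omega⟩)⟩, ?_⟩
      exact (Idx.mk.injEq ..).mpr ⟨by omega, Int.toNat_of_nonneg hx.1,
        Int.toNat_of_nonneg hy.1, rfl⟩

theorem absEv_idxOf (m : ℕ) (j : Level m) :
    absEv (idxOf ⟨m, j⟩).n (idxOf ⟨m, j⟩).s = m + 1 / 2 := by
  rcases j with j | j
  · simp only [idxOf, absEv]; push_cast; ring
  · simp only [idxOf, absEv]; push_cast; ring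

theorem card_level (m : ℕ) : Fintype.card (Level m) = 2 * (m * (m + 1)) := by
  simp; ring

theorem sub_one_le_idxOf_n (m : ℕ) (j : Level m) : (m : ℤ) - 1 ≤ (idxOf ⟨m, j⟩).n := by
  rcases j with j | j <;> simp [idxOf]

theorem summable_absEv_rpow {σ : ℝ} (hσ : 3 < σ) :
    Summable fun i : Idx => absEv i.n i.s ^ (-σ) := by
  rw [← (Equiv.ofBijective _ idxOf_bijective).summable_iff]
  refine (summable_sigma_of_nonneg ?_).2 ⟨fun m => Summable.of_finite, ?_⟩
  · exact fun p => Real.rpow_nonneg (absEv_pos _).le _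
  · -- the eigenvalue `d = m + 1/2` has multiplicity `2 m (m + 1) ≤ 2 d ^ 2`
    have hs : Summable fun m : ℕ => 2 * |(m : ℝ) + 1 / 2| ^ (-(σ - 2)) := by
      have := (Real.summable_one_div_nat_add_rpow (1 / 2) (σ - 2)).2 (by linarith)
      refine (this.mul_left 2).congr fun m => ?_
      rw [Real.rpow_neg (abs_nonneg _), one_div]
    refine hs.of_nonneg_of_le (fun m => tsum_nonneg fun j => Real.rpow_nonneg (absEv_pos _).le _)
      fun m => ?_
    have hd : (0 : ℝ) < m + 1 / 2 := by positivity
    simp only [Function.comp_apply, Equiv.ofBijective_apply, absEv_idxOf, tsum_fintype,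
      Finset.sum_const, Finset.card_univ, card_level, nsmul_eq_mul]
    rw [abs_of_pos hd, neg_sub, sub_eq_add_neg, Real.rpow_add hd, Real.rpow_two,
      ← mul_assoc (2 : ℝ)]
    refine mul_le_mul_of_nonneg_right ?_ (Real.rpow_nonneg hd.le _)
    push_cast
    nlinarith

/-- The zeta function of an operator with bounded columns. -/
theorem hasTrace_of_isBdd {T : Op Idx} (hT : IsBdd T) {z : ℂ} (hz : 3 < z.re) :
    Summable (fun i : Idx => T (Finsupp.single i 1) i * ((absEv i.n i.s : ℝ) : ℂ) ^ (-z)) ∧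
    HasTrace (T * absDiracPow (-z))
      (∑' i : Idx, T (Finsupp.single i 1) i * ((absEv i.n i.s : ℝ) : ℂ) ^ (-z)) := by
  obtain ⟨C, hC0, hC⟩ := hT
  have hs := summable_absEv_rpow hz
  have hnorm : ∀ (i : Idx) (w : ℂ),
      ‖((absEv i.n i.s : ℝ) : ℂ) ^ w‖ = absEv i.n i.s ^ w.re := fun i w =>
    Complex.norm_cpow_eq_rpow_re_of_pos (absEv_pos i) w
  have hsum : Summable
      (fun i : Idx => T (Finsupp.single i 1) i * ((absEv i.n i.s : ℝ) : ℂ) ^ (-z)) := by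
    refine Summable.of_norm_bounded (hs.mul_left C) fun i => ?_
    rw [norm_mul, hnorm, Complex.neg_re]
    exact mul_le_mul_of_nonneg_right ((norm_apply_le_nrm _ i).trans (hC i))
      (Real.rpow_nonneg (absEv_pos i).le _)
  -- `T |D|^{-z}` is the product of `T |D|^{-z/2}` and `|D|^{-z/2}`
  have hhalf : ∀ i : Idx, ‖((absEv i.n i.s : ℝ) : ℂ) ^ (-z / 2)‖ ^ 2 = absEv i.n i.s ^ (-z.re) := by
    intro i
    rw [hnorm, ← Real.rpow_natCast, ← Real.rpow_mul (absEv_pos i).le]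
    congr 1
    have : (-z / 2).re = -z.re / 2 := by
      rw [show (2 : ℂ) = ((2 : ℝ) : ℂ) by norm_num, Complex.div_ofReal_re, Complex.neg_re]
    rw [this]
    push_cast
    ring
  obtain ⟨A, hA, hAe⟩ := exists_hilbertSchmidt
    (fun i => ((absEv i.n i.s : ℝ) : ℂ) ^ (-z / 2) • emb (T (Finsupp.single i 1))) (by
      refine (hs.mul_right (C ^ 2)).of_nonneg_of_le (fun i => sq_nonneg _) fun i => ?_
      rw [norm_smul, mul_pow, hhalf]
      exact mul_le_mul_of_nonneg_left
        (pow_le_pow_left₀ (norm_nonneg _) ((norm_emb_le _).trans (hC i)) 2)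
        (Real.rpow_nonneg (absEv_pos i).le _))
  obtain ⟨B, hB, hBe⟩ := exists_hilbertSchmidt
    (fun i => ((absEv i.n i.s : ℝ) : ℂ) ^ (-z / 2) • lp.single 2 i (1 : ℂ)) (by
      refine hs.congr fun i => ?_
      rw [norm_smul, mul_pow, hhalf, lp.norm_single (by norm_num), norm_one, one_pow, mul_one])
  have hS : ∀ i k : Idx, (A ∘L B) (lp.single 2 k (1 : ℂ)) i =
      T (Finsupp.single k 1) i * ((absEv k.n k.s : ℝ) : ℂ) ^ (-z) := by
    intro i k
    have h0 : ((absEv k.n k.s : ℝ) : ℂ) ≠ 0 := by exact_mod_cast (absEv_pos k).ne'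
    rw [ContinuousLinearMap.comp_apply, hBe, map_smul, hAe, smul_smul, ← Complex.cpow_add _ _ h0,
      show -z / 2 + -z / 2 = -z by ring, lp.coeFn_smul, Pi.smul_apply, emb_apply, smul_eq_mul,
      mul_comm]
  refine ⟨hsum, A ∘L B, fun i k => ?_, ⟨A, B, hA, hB, rfl⟩, ?_⟩
  · rw [hS, Module.End.mul_apply, absDiracPow_single, map_smul, Finsupp.smul_apply, smul_eq_mul,
      mul_comm]
  · refine hsum.hasSum.congr_fun fun i => ?_
    rw [lp.inner_single_left, hS]
    simp

/-- The sum of the diagonal entries of an operator over an eigenspace of `|D|`. -/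
def levelTr (m : ℕ) (T : Op Idx) : ℂ :=
  ∑ j : Level m, T (Finsupp.single (idxOf ⟨m, j⟩) 1) (idxOf ⟨m, j⟩)

/-- The zeta function of an operator is a Dirichlet series over the spectrum of `|D|`. -/
theorem hasTrace_of_hasSum_levelTr {T : Op Idx} (hT : IsBdd T) {z : ℂ} (hz : 3 < z.re) {t : ℂ}
    (h : HasSum (fun m : ℕ => levelTr m T * ((m + 1 / 2 : ℝ) : ℂ) ^ (-z)) t) :
    HasTrace (T * absDiracPow (-z)) t := by
  obtain ⟨hs, htr⟩ := hasTrace_of_isBdd hT hz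
  have h1 := (Equiv.ofBijective _ idxOf_bijective).hasSum_iff.2 hs.hasSum
  have h2 := h1.sigma fun m => hasSum_fintype _
  have h3 := h2.unique (h.congr_fun fun m => ?_)
  · rwa [h3] at htr
  · rw [levelTr, Finset.sum_mul]
    refine Finset.sum_congr rfl fun j _ => ?_
    rw [Function.comp_apply, Equiv.ofBijective_apply, absEv_idxOf]

/-! ### Asymptotics of the traces over the eigenspaces of `|D|` -/

/-- The trace over the first `N` basis vectors. -/
def ptrace (q : QParam) (ε : ℤˣ) (N : ℕ) : Disk q ε →ₗ[ℂ] ℂ :=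
  ∑ k ∈ Finset.range N, entry q ε k k

theorem ptrace_apply {ε : ℤˣ} (N : ℕ) (x : Disk q ε) :
    ptrace q ε N x = ∑ k ∈ Finset.range N, (x : Op ℕ) (Finsupp.single k 1) k := by
  rw [ptrace, LinearMap.sum_apply]
  rfl

/-- Up to an exponentially small error, `Tr_{N-1}(x) = (N - 1 + c) τ₁(x) + τ₀(x)`, where `τ₀` is
normalized by the constant `c`. -/
theorem exists_ptrace_sub_le {ε : ℤˣ} (c : ℂ) (x : Disk q ε) :
    ∃ K : ℝ, 0 ≤ K ∧ ∀ N : ℕ,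
      ‖ptrace q ε N x - (tau1 q ε x * (N - 1 + c) + tau0 q ε c x)‖ ≤ K * (q : ℝ) ^ N := by
  obtain ⟨C₁, h0, hC⟩ := (hasSymbol_symb x).exists_nonneg
  set d : ℕ → ℂ := fun k => (x : Op ℕ) (Finsupp.single k 1) k - tau1 q ε x with hd
  have ht : tau1 q ε x = (symb x).coeff 0 := circleMean_apply _
  have hdle : ∀ k, ‖d k‖ ≤ C₁ * (q : ℝ) ^ k := fun k => by
    refine le_trans (le_of_eq ?_) ((norm_le_l1 _ k).trans (hC k))
    rw [Finsupp.sub_apply, toep_apply, hd, ht, sub_self]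
  have hs : Summable d := Summable.of_norm_bounded
    ((summable_geometric_of_lt_one (qpos q).le q.2.2).mul_left C₁) hdle
  have hpt : ∀ N, ptrace q ε N x = ∑ k ∈ Finset.range N, d k + N * tau1 q ε x := fun N => by
    rw [ptrace_apply]
    simp only [hd, Finset.sum_sub_distrib, Finset.sum_const, Finset.card_range, nsmul_eq_mul]
    ring
  have h0x : tau0 q ε c x = ∑' k, d k + (1 - c) * tau1 q ε x := by
    refine Tendsto.limUnder_eq ?_
    have h1 := ((tendsto_add_atTop_iff_nat 1).2 hs.hasSum.tendsto_sum_nat).add_const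
      ((1 - c) * tau1 q ε x)
    refine h1.congr fun N => ?_
    have e : tauSeq q ε c N x = ptrace q ε (N + 1) x - (N + c) * tau1 q ε x := by
      rw [ptrace_apply]; rfl
    rw [e, hpt]
    push_cast
    ring
  refine ⟨C₁ / (1 - q), div_nonneg h0 (sub_nonneg.2 q.2.2.le), fun N => ?_⟩
  have h2 := norm_sub_le_of_geometric_bound_of_hasSum q.2.2 hdle hs.hasSum N
  have e : ptrace q ε N x - (tau1 q ε x * (N - 1 + c) + tau0 q ε c x) =
      ∑ k ∈ Finset.range N, d k - ∑' k, d k := by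
    rw [hpt, h0x]; ring
  rw [e]
  exact h2.trans (by rw [div_mul_eq_mul_div])

/-- The functionals `φ m` have the form `τ (m + 1/2) + σ` up to an exponentially small error. -/
def IsAffine (q : QParam) {V : Type} [AddCommMonoid V] [Module ℂ V] (φ : ℕ → V →ₗ[ℂ] ℂ)
    (τ σ : V →ₗ[ℂ] ℂ) : Prop :=
  ∀ x, ∃ K : ℝ, 0 ≤ K ∧ ∀ m : ℕ,
    ‖φ m x - (τ x * ((m + 1 / 2 : ℝ) : ℂ) + σ x)‖ ≤ K * rate q ^ m

theorem isAffine_up (q : QParam) (ε : ℤˣ) :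
    IsAffine q (fun m => ptrace q ε m) (tau1 q ε) (tau0Up q ε) := fun x => by
  obtain ⟨K, h0, hK⟩ := exists_ptrace_sub_le (3 / 2) x
  refine ⟨K, h0, fun m => ?_⟩
  have e : ((m + 1 / 2 : ℝ) : ℂ) = m - 1 + 3 / 2 := by push_cast; ring
  rw [e]
  exact (hK m).trans (mul_le_mul_of_nonneg_left
    (pow_le_pow_left₀ (qpos q).le (q_le_rate q) m) h0)

theorem isAffine_dn (q : QParam) (ε : ℤˣ) :
    IsAffine q (fun m => ptrace q ε (m + 1)) (tau1 q ε) (tau0Dn q ε) := fun x => by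
  obtain ⟨K, h0, hK⟩ := exists_ptrace_sub_le (1 / 2) x
  refine ⟨K, h0, fun m => ?_⟩
  have e : ((m + 1 / 2 : ℝ) : ℂ) = (m + 1 : ℕ) - 1 + 1 / 2 := by push_cast; ring
  rw [e]
  refine (hK (m + 1)).trans (mul_le_mul_of_nonneg_left ?_ h0)
  exact (pow_le_pow_of_le_one (qpos q).le q.2.2.le m.le_succ).trans
    (pow_le_pow_left₀ (qpos q).le (q_le_rate q) m)

/-- The polynomial `α d ^ 2 + β d + γ` in the eigenvalue `d = m + 1/2` of `|D|`. -/
def quad (α β γ : ℂ) (m : ℕ) : ℂ :=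
  α * ((m + 1 / 2 : ℝ) : ℂ) ^ 2 + β * ((m + 1 / 2 : ℝ) : ℂ) + γ

theorem norm_affine_le (a b : ℂ) (m : ℕ) :
    ‖a * ((m + 1 / 2 : ℝ) : ℂ) + b‖ ≤ (‖a‖ + ‖b‖) * ((m : ℝ) + 2) := by
  have h0 : (0 : ℝ) ≤ m := m.cast_nonneg
  refine (norm_add_le _ _).trans ?_
  rw [norm_mul, Complex.norm_real, Real.norm_eq_abs, abs_of_nonneg (by positivity)]
  nlinarith [norm_nonneg a, norm_nonneg b]

/-- Products of affine asymptotics are quadratic asymptotics. -/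
theorem exists_tens_sub_quad_le {φ : ℕ → Disk q 1 →ₗ[ℂ] ℂ} {ψ : ℕ → Disk q (-1) →ₗ[ℂ] ℂ}
    {τ σ : Disk q 1 →ₗ[ℂ] ℂ} {τ' σ' : Disk q (-1) →ₗ[ℂ] ℂ} (hφ : IsAffine q φ τ σ)
    (hψ : IsAffine q ψ τ' σ') (g : Disk q 1 ⊗[ℂ] Disk q (-1)) :
    ∃ K : ℝ, 0 ≤ K ∧ ∀ m : ℕ,
      ‖tens (φ m) (ψ m) g -
        quad (tens τ τ' g) ((tens τ σ' + tens σ τ') g) (tens σ σ' g) m‖ ≤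
        K * ((m : ℝ) + 2) ^ 2 * rate q ^ m := by
  induction g using TensorProduct.induction_on with
  | zero => exact ⟨0, le_rfl, fun m => by simp [quad]⟩
  | add g g' hg hg' =>
    obtain ⟨K, h0, hK⟩ := hg
    obtain ⟨K', h0', hK'⟩ := hg'
    refine ⟨K + K', by positivity, fun m => ?_⟩
    rw [add_mul, add_mul]
    refine le_trans (le_of_eq ?_) ((norm_add_le _ _).trans (add_le_add (hK m) (hK' m)))
    congr 1
    simp only [map_add, quad]
    ring
  | tmul X Y =>
    obtain ⟨K, h0, hK⟩ := hφ X
    obtain ⟨K', h0', hK'⟩ := hψ Y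
    set A := ‖τ X‖ + ‖σ X‖ with hA
    set A' := ‖τ' Y‖ + ‖σ' Y‖ with hA'
    refine ⟨K * (A' + K') + A * K', by positivity, fun m => ?_⟩
    have hm : (0 : ℝ) ≤ m := m.cast_nonneg
    have hr := pow_pos (rate_pos q) m
    have hr1 : rate q ^ m ≤ 1 := pow_le_one₀ (rate_pos q).le (rate_lt_one q).le
    set u := τ X * ((m + 1 / 2 : ℝ) : ℂ) + σ X with hu
    set v := τ' Y * ((m + 1 / 2 : ℝ) : ℂ) + σ' Y with hv
    have hun : ‖u‖ ≤ A * ((m : ℝ) + 2) := norm_affine_le _ _ _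
    have hvn : ‖v‖ ≤ A' * ((m : ℝ) + 2) := norm_affine_le _ _ _
    have hψn : ‖ψ m Y‖ ≤ (A' + K') * ((m : ℝ) + 2) := by
      have := norm_add_le (ψ m Y - v) v
      rw [sub_add_cancel] at this
      have h3 := hK' m
      nlinarith
    have e : tens (φ m) (ψ m) (X ⊗ₜ Y) - quad (tens τ τ' (X ⊗ₜ Y))
        ((tens τ σ' + tens σ τ') (X ⊗ₜ Y)) (tens σ σ' (X ⊗ₜ Y)) m =
        (φ m X - u) * ψ m Y + u * (ψ m Y - v) := by
      simp only [tens, quad, LinearMap.add_apply, LinearMap.comp_apply, TensorProduct.map_tmul,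
        LinearMap.mul'_apply, hu, hv]
      ring
    rw [e]
    calc _ ≤ ‖φ m X - u‖ * ‖ψ m Y‖ + ‖u‖ * ‖ψ m Y - v‖ := by
          refine (norm_add_le _ _).trans (le_of_eq ?_)
          rw [norm_mul, norm_mul]
      _ ≤ (K * rate q ^ m) * ((A' + K') * ((m : ℝ) + 2)) +
          (A * ((m : ℝ) + 2)) * (K' * rate q ^ m) :=
        add_le_add (mul_le_mul (hK m) hψn (norm_nonneg _) (by positivity))
          (mul_le_mul hun (hK' m) (norm_nonneg _) (by positivity))
      _ = (K * (A' + K') + A * K') * ((m : ℝ) + 2) * rate q ^ m := by ring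
      _ ≤ _ := by
        refine mul_le_mul_of_nonneg_right ?_ hr.le
        refine mul_le_mul_of_nonneg_left ?_ (by positivity)
        nlinarith

theorem symEntry_zero (x x' y y' : ℕ) (h : SymbolAlg q) :
    symEntry q x x' y y' 0 h = tens (entry q 1 x x') (entry q (-1) y y') (rZero q h) := by
  induction h using symbolAlg_induction with
  | add f g hf hg => simp only [map_add, hf, hg]
  | pure X Y l =>
    have e : rZero q ((X ⊗ₜ Y) ⊗ₜ T l) = lcoeff 0 (T l) • (X ⊗ₜ[ℂ] Y) := rfl
    rw [e, map_smul, symEntry, tensorFun_tmul, smul_eq_mul, mul_comm]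
    rfl

theorem sum_tens_entry (a b : ℕ) (g : Disk q 1 ⊗[ℂ] Disk q (-1)) :
    ∑ p : Fin a × Fin b, tens (entry q 1 p.1 p.1) (entry q (-1) p.2 p.2) g =
      tens (ptrace q 1 a) (ptrace q (-1) b) g := by
  induction g using TensorProduct.induction_on with
  | zero => simp
  | add g g' hg hg' => simp only [map_add, Finset.sum_add_distrib, hg, hg']
  | tmul X Y =>
    simp only [tens, LinearMap.comp_apply, TensorProduct.map_tmul, LinearMap.mul'_apply]
    rw [Fintype.sum_prod_type, ptrace, ptrace, LinearMap.sum_apply, LinearMap.sum_apply,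
      Finset.sum_mul_sum, ← Fin.sum_univ_eq_sum_range
        (fun k => ∑ j ∈ Finset.range b, entry q 1 k k X * entry q (-1) j j Y)]
    refine Finset.sum_congr rfl fun x _ => ?_
    exact Fin.sum_univ_eq_sum_range (fun j => entry q 1 x x X * entry q (-1) j j Y) b

theorem levelTr_model (f : Spin → SymbolAlg q) (m : ℕ) :
    levelTr m (model q f) =
      tens (ptrace q 1 m) (ptrace q (-1) (m + 1)) (rZero q (f .up)) +
        tens (ptrace q 1 (m + 1)) (ptrace q (-1) m) (rZero q (f .dn)) := by
  have h : ∀ i : Idx, model q f (Finsupp.single i 1) i =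
      tens (entry q 1 i.x.toNat i.x.toNat) (entry q (-1) i.y.toNat i.y.toNat)
        (rZero q (f i.s)) := fun i => by
    rw [model_single, mcol_apply, if_pos rfl, sub_self, symEntry_zero]
  rw [levelTr, Fintype.sum_sum_type, ← sum_tens_entry, ← sum_tens_entry]
  congr 1
  · exact Finset.sum_congr rfl fun p _ => h _
  · exact Finset.sum_congr rfl fun p _ => h _

/-- The coefficient of `d ^ 2` in the trace of an operator with symbol `f` over the eigenspace of
`|D|` for the eigenvalue `d`; it is the residue of the zeta function at `3`. -/
def resThree (f : Spin → SymbolAlg q) : ℂ :=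
  tens (tau1 q 1) (tau1 q (-1)) (rZero q (f .up)) +
    tens (tau1 q 1) (tau1 q (-1)) (rZero q (f .dn))

/-- The coefficient of `d` in the trace of an operator with symbol `f` over the eigenspace of `|D|`
for the eigenvalue `d`; it is the residue of the zeta function at `2`. -/
def resTwo (f : Spin → SymbolAlg q) : ℂ :=
  (tens (tau1 q 1) (tau0Dn q (-1)) + tens (tau0Up q 1) (tau1 q (-1))) (rZero q (f .up)) +
    (tens (tau1 q 1) (tau0Up q (-1)) + tens (tau0Dn q 1) (tau1 q (-1))) (rZero q (f .dn))

/-- The constant term in the trace of an operator with symbol `f` over the eigenspaces of `|D|`; it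
is the residue of the zeta function at `1`. -/
def resOne (f : Spin → SymbolAlg q) : ℂ :=
  tens (tau0Up q 1) (tau0Dn q (-1)) (rZero q (f .up)) +
    tens (tau0Dn q 1) (tau0Up q (-1)) (rZero q (f .dn))

theorem exists_levelTr_model_le (f : Spin → SymbolAlg q) :
    ∃ K : ℝ, ∀ m : ℕ, ‖levelTr m (model q f) - quad (resThree f) (resTwo f) (resOne f) m‖ ≤
      K * ((m : ℝ) + 2) ^ 2 * rate q ^ m := by
  obtain ⟨K, -, hK⟩ := exists_tens_sub_quad_le (isAffine_up q 1) (isAffine_dn q (-1))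
    (rZero q (f .up))
  obtain ⟨K', -, hK'⟩ := exists_tens_sub_quad_le (isAffine_dn q 1) (isAffine_up q (-1))
    (rZero q (f .dn))
  refine ⟨K + K', fun m => ?_⟩
  rw [add_mul, add_mul]
  refine le_trans (le_of_eq ?_) ((norm_add_le _ _).trans (add_le_add (hK m) (hK' m)))
  congr 1
  rw [levelTr_model]
  simp only [quad, resThree, resTwo, resOne]
  ring

theorem exists_levelTr_le_of_isSmall {E : Op Idx} (h : IsSmall q E) :
    ∃ K : ℝ, ∀ m : ℕ, ‖levelTr m E‖ ≤ K * ((m : ℝ) + 2) ^ 2 * rate q ^ m := by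
  obtain ⟨C, h0, hC⟩ := h
  refine ⟨2 * (C * (rate q)⁻¹), fun m => ?_⟩
  have hr := rate_pos q
  have hle : ∀ j : Level m, ‖E (Finsupp.single (idxOf ⟨m, j⟩) 1) (idxOf ⟨m, j⟩)‖ ≤
      C * (rate q)⁻¹ * rate q ^ m := fun j => by
    refine (norm_apply_le_nrm _ _).trans ((hC _).trans ?_)
    rw [mul_assoc]
    refine mul_le_mul_of_nonneg_left ?_ h0
    have e : (rate q)⁻¹ * rate q ^ m = rate q ^ ((m : ℤ) - 1) := by
      rw [zpow_sub_one₀ hr.ne', zpow_natCast, mul_comm]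
    rw [e]
    exact zpow_le_zpow_right_of_le_one₀ hr (rate_lt_one q).le (sub_one_le_idxOf_n m j)
  refine (norm_sum_le _ _).trans ((Finset.sum_le_sum fun j _ => hle j).trans ?_)
  rw [Finset.sum_const, Finset.card_univ, card_level, nsmul_eq_mul]
  have hm : (0 : ℝ) ≤ m := m.cast_nonneg
  have hcard : ((2 * (m * (m + 1)) : ℕ) : ℝ) ≤ 2 * ((m : ℝ) + 2) ^ 2 := by
    push_cast; nlinarith
  calc _ ≤ 2 * ((m : ℝ) + 2) ^ 2 * (C * (rate q)⁻¹ * rate q ^ m) :=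
        mul_le_mul_of_nonneg_right hcard (by positivity)
    _ = _ := by ring

theorem op_sub_add_cancel (S T : Op Idx) : S - T + T = S := sub_add_cancel S T

theorem levelTr_add (m : ℕ) (S T : Op Idx) : levelTr m (S + T) = levelTr m S + levelTr m T :=
  Finset.sum_add_distrib

/-- The trace of an operator with symbol `f` over the eigenspaces of `|D|` is a quadratic polynomial
in the eigenvalue up to an exponentially small error. -/
theorem exists_levelTr_le {S : Op Idx} {f : Spin → SymbolAlg q} (h : (S, f) ∈ symbolGraph q) :
    ∃ K : ℝ, ∀ m : ℕ, ‖levelTr m S - quad (resThree f) (resTwo f) (resOne f) m‖ ≤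
      K * ((m : ℝ) + 2) ^ 2 * rate q ^ m := by
  obtain ⟨K, hK⟩ := exists_levelTr_le_of_isSmall (isSmall_sub_model h)
  obtain ⟨K', hK'⟩ := exists_levelTr_model_le f
  refine ⟨K + K', fun m => ?_⟩
  have e : levelTr m S = levelTr m (S - model q f) + levelTr m (model q f) := by
    rw [← levelTr_add, op_sub_add_cancel]
  rw [e, add_sub_assoc, add_mul, add_mul]
  exact (norm_add_le _ _).trans (add_le_add (hK m) (hK' m))

theorem isBdd_of_mem_symbolGraph {S : Op Idx} {f : Spin → SymbolAlg q}
    (h : (S, f) ∈ symbolGraph q) : IsBdd S := by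
  have := (isSmall_sub_model h).isBdd.add (isBdd_model f)
  rwa [op_sub_add_cancel] at this

/-- The zeta function of an operator with symbol `f`: its trace class half-plane, its poles, and its
residues. -/
theorem exists_zeta {S : Op Idx} {f : Spin → SymbolAlg q} (h : (S, f) ∈ symbolGraph q) :
    ∃ Z : ℂ → ℂ, (∀ z : ℂ, 3 < z.re → HasTrace (S * absDiracPow (-z)) (Z z)) ∧
      (∀ w, MeromorphicAt Z w) ∧ (∀ w : ℂ, w ∉ ({1, 2, 3} : Set ℂ) → AnalyticAt ℂ Z w) ∧
      Tendsto (fun z => (z - 3) * Z z) (𝓝[≠] 3) (𝓝 (resThree f)) ∧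
      Tendsto (fun z => (z - 2) * Z z) (𝓝[≠] 2) (𝓝 (resTwo f)) ∧
      Tendsto (fun z => (z - 1) * Z z) (𝓝[≠] 1) (𝓝 (resOne f)) := by
  obtain ⟨K, hK⟩ := exists_levelTr_le h
  obtain ⟨Z, hZ, hrest⟩ := exists_continuation (rate_pos q) (rate_lt_one q) hK
  exact ⟨Z, fun z hz => hasTrace_of_hasSum_levelTr (isBdd_of_mem_symbolGraph h) hz (hZ z hz), hrest⟩

/-! ### Noncommutative integrals and the dimension spectrum -/

theorem hasNcint_of_tendsto {S : Op Idx} {Z : ℂ → ℂ} {k r : ℂ}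
    (htr : ∀ z : ℂ, 3 < z.re → HasTrace (S * absDiracPow (-z)) (Z z))
    (hm : ∀ w, MeromorphicAt Z w)
    (hres : Tendsto (fun z => (z - k) * Z z) (𝓝[≠] k) (𝓝 r)) :
    HasNcint (S * absDiracPow (-k)) r := by
  have hadd : ∀ w : ℂ, AnalyticAt ℂ (fun z : ℂ => z + k) w := fun w =>
    analyticAt_id.add analyticAt_const
  refine ⟨fun z => Z (z + k), ⟨fun w => MeromorphicAt.comp_analyticAt (f := Z)
    (g := fun z => z + k) (hm (w + k)) (hadd w), 3 - k.re, fun z hz => ?_⟩, ?_⟩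
  · have h := htr (z + k) (by rw [Complex.add_re]; linarith)
    rwa [neg_add_rev, ← absDiracPow_mul, ← mul_assoc] at h
  · have ht : Tendsto (fun z : ℂ => z + k) (𝓝[≠] 0) (𝓝[≠] k) := by
      refine tendsto_nhdsWithin_iff.2 ⟨?_, ?_⟩
      · have : Tendsto (fun z : ℂ => z + k) (𝓝 0) (𝓝 (0 + k)) := tendsto_id.add_const k
        rw [zero_add] at this
        exact this.mono_left nhdsWithin_le_nhds
      · filter_upwards [self_mem_nhdsWithin] with z hz h
        exact hz (by simpa using h)
    refine (hres.comp ht).congr fun z => ?_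
    simp only [Function.comp_apply, add_sub_cancel_right]

/-- The zeta functions of operators with a symbol have at most simple poles, located at
`1`, `2`, `3`. -/
theorem exists_zeta_order {S : Op Idx} {f : Spin → SymbolAlg q} (h : (S, f) ∈ symbolGraph q) :
    ∃ Z : ℂ → ℂ, IsZeta S Z ∧
      (∀ z : ℂ, 3 < z.re → HasTrace (S * absDiracPow (-z)) (Z z)) ∧
      (∀ w : ℂ, w ∉ ({1, 2, 3} : Set ℂ) → AnalyticAt ℂ Z w) ∧
      (∀ w : ℂ, ((-1 : ℤ) : WithTop ℤ) ≤ meromorphicOrderAt Z w) := by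
  obtain ⟨Z, htr, hm, han, h3, h2, h1⟩ := exists_zeta h
  refine ⟨Z, ⟨hm, 3, htr⟩, htr, han, fun w => ?_⟩
  by_cases hw : w ∈ ({1, 2, 3} : Set ℂ)
  · rcases hw with rfl | rfl | rfl
    · exact neg_one_le_order_of_tendsto (hm _) h1
    · exact neg_one_le_order_of_tendsto (hm _) h2
    · exact neg_one_le_order_of_tendsto (hm _) h3
  · exact le_trans (by decide) (han w hw).meromorphicOrderAt_nonneg

/-- The zeta function is unique, so its poles do not depend on the choice of a continuation. -/
theorem dimSpectrum_subset {X : Subalgebra ℂ (Op Idx)} (hX : X ≤ psi0P q) :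
    dimSpectrum X ⊆ {1, 2, 3} := by
  rintro w ⟨S, hS, Z, ⟨hm, R, htr⟩, hw⟩
  obtain ⟨Z', htr', hm', han, -⟩ := exists_zeta (symR_mem ⟨S, hX hS⟩)
  by_contra hn
  have h : meromorphicOrderAt Z w = meromorphicOrderAt Z' w :=
    order_eq_of_eq_on_halfPlane hm hm' (R := max R 3) (fun z hz =>
      (htr z ((le_max_left _ _).trans_lt hz)).unique
        (htr' z ((le_max_right _ _).trans_lt hz))) w
  rw [h] at hw
  exact absurd (han w hn).meromorphicOrderAt_nonneg (not_le.2 hw)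

theorem tau1_eq {ε : ℤˣ} (x : Disk q ε) : tau1 q ε x = (sigma q ε x).coeff 0 :=
  circleMean_apply _

theorem tau1_one (ε : ℤˣ) : tau1 q ε 1 = 1 := by
  rw [tau1_eq, map_one]
  simp

theorem tau0_eq_of_tendsto {ε : ℤˣ} {c t : ℂ} {x : Disk q ε}
    (h : Tendsto (fun N => tauSeq q ε c N x) atTop (𝓝 t)) : tau0 q ε c x = t := h.limUnder_eq

theorem tau0_one (ε : ℤˣ) (c : ℂ) : tau0 q ε c 1 = 1 - c := by
  refine tau0_eq_of_tendsto (tendsto_const_nhds.congr fun N => ?_)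
  have e : tauSeq q ε c N 1 = (∑ k ∈ Finset.range (N + 1),
      ((1 : Disk q ε) : Op ℕ) (Finsupp.single k 1) k) - (N + c) * tau1 q ε 1 := rfl
  rw [e, tau1_one]
  simp

theorem rZero_pure (A : Disk q 1) (B : Disk q (-1)) :
    rZero q ((A ⊗ₜ B) ⊗ₜ T 0) = A ⊗ₜ B := by
  have e : rZero q ((A ⊗ₜ B) ⊗ₜ T 0) = lcoeff 0 (T 0) • (A ⊗ₜ[ℂ] B) := rfl
  rw [e, lcoeff_T, if_pos rfl, one_smul]

theorem tens_tmul (φ : Disk q 1 →ₗ[ℂ] ℂ) (ψ : Disk q (-1) →ₗ[ℂ] ℂ) (A : Disk q 1)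
    (B : Disk q (-1)) : tens φ ψ (A ⊗ₜ B) = φ A * ψ B := by
  simp [tens]

/-- The symbol of the identity is `(1 ⊗ 1) ⊗ 1`. -/
theorem rZero_one : rZero q 1 = 1 ⊗ₜ 1 := rZero_pure 1 1

theorem resThree_one : resThree (q := q) 1 = 2 := by
  rw [resThree, Pi.one_apply, Pi.one_apply, rZero_one, tens_tmul, tau1_one, tau1_one]
  norm_num

theorem resOne_one : resOne (q := q) 1 = -1 / 2 := by
  rw [resOne, Pi.one_apply, Pi.one_apply, rZero_one, tens_tmul, tens_tmul, tau0Up, tau0Dn, tau0Up,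
    tau0Dn, tau0_one, tau0_one, tau0_one, tau0_one]
  norm_num

theorem tau1_diskB_sq : tau1 q 1 (diskB q 1 * diskB q 1) = 0 := by
  rw [tau1_eq, map_mul, sigma_diskB]
  simp

theorem tau1_diskAStar_mul_diskA : tau1 q (-1) (diskAStar q (-1) * diskA q (-1)) = 1 := by
  rw [tau1_eq, map_mul, sigma_diskA, sigma_diskAStar, ← T_add]
  simp

/-- On the ideal of trace class elements, `τ₀` is the trace. -/
theorem tau0_diskB_sq (c : ℂ) :
    tau0 q 1 c (diskB q 1 * diskB q 1) = (((1 - (q : ℝ) ^ 2)⁻¹ : ℝ) : ℂ) := by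
  have hq1 : (q : ℝ) ^ 2 < 1 := pow_lt_one₀ (qpos q).le q.2.2 two_ne_zero
  have hs := (hasSum_geometric_of_lt_one (sq_nonneg (q : ℝ)) hq1).mapL Complex.ofRealCLM
  have h1 := (tendsto_add_atTop_iff_nat 1).2 hs.tendsto_sum_nat
  refine tau0_eq_of_tendsto (h1.congr fun N => ?_)
  have e : tauSeq q 1 c N (diskB q 1 * diskB q 1) = (∑ k ∈ Finset.range (N + 1),
      (piB q 1 * piB q 1) (Finsupp.single k 1) k) -
        (N + c) * tau1 q 1 (diskB q 1 * diskB q 1) := rfl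
  rw [e, tau1_diskB_sq, mul_zero, sub_zero]
  refine Finset.sum_congr rfl fun k _ => ?_
  have hk : (piB q 1) (Finsupp.single k 1) = ((q : ℝ) : ℂ) ^ k • Finsupp.single k 1 := by
    rw [piB, ofBasis_single]
    simp
  rw [Module.End.mul_apply, hk, map_smul, hk]
  simp
  ring

theorem rZero_genSymbol_mul (A A' : Disk q 1) (B B' : Disk q (-1)) (z w : ℂ) (l : ℤ) (s : Spin) :
    rZero q ((genSymbol z A B (-l) * genSymbol w A' B' l) s) =
      (z * w) • ((A * A') ⊗ₜ[ℂ] (B * B')) := by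
  have e : (genSymbol z A B (-l) * genSymbol w A' B' l) s =
      (z * w) • (((A * A') ⊗ₜ[ℂ] (B * B')) ⊗ₜ[ℂ] T 0) := by
    rw [Pi.mul_apply]
    simp only [genSymbol]
    rw [smul_mul_smul_comm, Algebra.TensorProduct.tmul_mul_tmul,
      Algebra.TensorProduct.tmul_mul_tmul, ← T_add, neg_add_cancel]
  rw [e, map_smul, rZero_pure]

theorem resTwo_ne_zero {f : Spin → SymbolAlg q} (h : ∀ s, rZero q (f s) =
    (((-1 : ℝ) : ℂ) * ((-1 : ℝ) : ℂ)) •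
      ((diskB q 1 * diskB q 1) ⊗ₜ[ℂ] (diskAStar q (-1) * diskA q (-1)))) : resTwo f ≠ 0 := by
  have hq1 : (0 : ℝ) < (1 - (q : ℝ) ^ 2)⁻¹ := inv_pos.2 (one_sub_sq_pos q)
  have hne : (((1 - (q : ℝ) ^ 2)⁻¹ : ℝ) : ℂ) ≠ 0 := by exact_mod_cast hq1.ne'
  rw [resTwo, h, h, map_smul, map_smul]
  simp only [LinearMap.add_apply, tens_tmul, tau1_diskB_sq, tau1_diskAStar_mul_diskA, tau0Up,
    tau0Dn, tau0_diskB_sq]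
  intro h0
  apply hne
  push_cast at h0 ⊢
  simp only [smul_eq_mul] at h0
  linear_combination h0 / 2

theorem shift_bMinus_mem_algB (q : QParam) : shift 1 (-1) 0 (-1) (wBM q) ∈ algB q :=
  gens_subset_algB q (Or.inl (by simp [evenGens]))

theorem shiftAdj_bMinus_mem_algB (q : QParam) : shiftAdj 1 (-1) 0 (-1) (wBM q) ∈ algB q :=
  gens_subset_algB q (Or.inl (by simp [evenGens]))

theorem bMinus_mul_adj_mem_symbolGraph (q : QParam) :
    (shift 1 (-1) 0 (-1) (wBM q) * shiftAdj 1 (-1) 0 (-1) (wBM q),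
      genSymbol ((-1 : ℝ) : ℂ) (diskB q 1) (diskAStar q (-1)) (-1) *
        genSymbol ((-1 : ℝ) : ℂ) (diskB q 1) (diskA q (-1)) 1) ∈ symbolGraph q :=
  ActsAs.mul (mem_bMinus q).1 (mem_bMinus q).2

/-- An operator of `ℬ` whose zeta function has a pole at `2`: the symbol of `b̃_- b̃_-^*` is
`b² ⊗ a^* a ⊗ 1`, and `b²` is trace class while `a^* a` has nonzero symbol. -/
theorem exists_resTwo_ne_zero (q : QParam) :
    ∃ S ∈ algB q, ∃ f : Spin → SymbolAlg q, (S, f) ∈ symbolGraph q ∧ resTwo f ≠ 0 :=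
  ⟨_, (algB q).mul_mem (shift_bMinus_mem_algB q) (shiftAdj_bMinus_mem_algB q), _,
    bMinus_mul_adj_mem_symbolGraph q,
    resTwo_ne_zero fun s => rZero_genSymbol_mul _ _ _ _ _ _ 1 s⟩

theorem dimSpectrum_eq {X : Subalgebra ℂ (Op Idx)} (h1 : algB q ≤ X) (h2 : X ≤ psi0P q) :
    dimSpectrum X = {1, 2, 3} := by
  refine (dimSpectrum_subset h2).antisymm ?_
  obtain ⟨Z, htr, hm, -, hr3, -, hr1⟩ := exists_zeta (symbolGraph q).one_mem
  rintro w (rfl | rfl | rfl)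
  · refine ⟨1, one_mem X, Z, ⟨hm, 3, htr⟩, order_neg_of_tendsto (hm _) ?_ hr1⟩
    exact (resOne_one (q := q)).trans_ne (by norm_num)
  · obtain ⟨S, hS, f, hf, hne⟩ := exists_resTwo_ne_zero q
    obtain ⟨Z', htr', hm', -, -, hr2, -⟩ := exists_zeta hf
    exact ⟨S, h1 hS, Z', ⟨hm', 3, htr'⟩, order_neg_of_tendsto (hm' _) hne hr2⟩
  · refine ⟨1, one_mem X, Z, ⟨hm, 3, htr⟩, order_neg_of_tendsto (hm _) ?_ hr3⟩
    exact (resThree_one (q := q)).trans_ne (by norm_num)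

theorem hasNcint_of_mem_symbolGraph {S : Op Idx} {f : Spin → SymbolAlg q}
    (h : (S, f) ∈ symbolGraph q) :
    HasNcint (S * absDiracPow (-3)) (resThree f) ∧ HasNcint (S * absDiracPow (-2)) (resTwo f) ∧
      HasNcint (S * absDiracPow (-1)) (resOne f) := by
  obtain ⟨Z, htr, hm, -, h3, h2, h1⟩ := exists_zeta h
  exact ⟨hasNcint_of_tendsto htr hm h3, hasNcint_of_tendsto htr hm h2,
    hasNcint_of_tendsto htr hm h1⟩

theorem tens_add_left (φ φ' : Disk q 1 →ₗ[ℂ] ℂ) (ψ : Disk q (-1) →ₗ[ℂ] ℂ) :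
    tens (φ + φ') ψ = tens φ ψ + tens φ' ψ := by
  rw [tens, TensorProduct.map_add_left, LinearMap.comp_add]
  rfl

theorem tens_add_right (φ : Disk q 1 →ₗ[ℂ] ℂ) (ψ ψ' : Disk q (-1) →ₗ[ℂ] ℂ) :
    tens φ (ψ + ψ') = tens φ ψ + tens φ ψ' := by
  rw [tens, TensorProduct.map_add_right, LinearMap.comp_add]
  rfl

/-- The residues for a symbol with equal components for the two spins. -/
theorem hasNcint_of_const {S : Op Idx} {g : SymbolAlg q}
    (h : (S, fun _ => g) ∈ symbolGraph q) :
    HasNcint (S * absDiracPow (-3)) (2 * tens (tau1 q 1) (tau1 q (-1)) (rZero q g)) ∧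
      HasNcint (S * absDiracPow (-2))
        ((tens (tau1 q 1) (tau0Up q (-1) + tau0Dn q (-1)) +
          tens (tau0Up q 1 + tau0Dn q 1) (tau1 q (-1))) (rZero q g)) ∧
      HasNcint (S * absDiracPow (-1))
        ((tens (tau0Up q 1) (tau0Dn q (-1)) + tens (tau0Dn q 1) (tau0Up q (-1))) (rZero q g)) := by
  obtain ⟨h3, h2, h1⟩ := hasNcint_of_mem_symbolGraph h
  have e2 : resTwo (fun _ => g) = (tens (tau1 q 1) (tau0Up q (-1) + tau0Dn q (-1)) +
      tens (tau0Up q 1 + tau0Dn q 1) (tau1 q (-1))) (rZero q g) := by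
    simp only [resTwo, tens_add_left, tens_add_right, LinearMap.add_apply]
    ring
  rw [e2] at h2
  rw [two_mul]
  exact ⟨h3, h2, h1⟩

theorem symR_inclusion_eq (T : algB q) :
    symR q (Subalgebra.inclusion (algB_le_psi0P q) T) = fun _ => symRho q T :=
  funext fun s => symR_inclusion T s

theorem mem_symbolGraph_symR_inclusion (T : algB q) :
    ((T : Op Idx), symR q (Subalgebra.inclusion (algB_le_psi0P q) T)) ∈ symbolGraph q := by
  rw [← Subalgebra.coe_inclusion (algB_le_psi0P q) T]
  exact symR_mem (Subalgebra.inclusion (algB_le_psi0P q) T)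

theorem mem_symbolGraph_symRho (T : algB q) :
    ((T : Op Idx), fun _ => symRho q T) ∈ symbolGraph q := by
  rw [← symR_inclusion_eq]
  exact mem_symbolGraph_symR_inclusion T

end SUq2

end

theorem mainTheorem3 (q : QParam) :
    -- the zeta functions have at most simple poles, located in `{1, 2, 3}`
    (∀ T ∈ psi0P q, ∃ Z : ℂ → ℂ, IsZeta T Z ∧
      (∀ z : ℂ, 3 < z.re → HasTrace (T * absDiracPow (-z)) (Z z)) ∧
      (∀ w : ℂ, w ∉ ({1, 2, 3} : Set ℂ) → AnalyticAt ℂ Z w) ∧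
      (∀ w : ℂ, ((-1 : ℤ) : WithTop ℤ) ≤ meromorphicOrderAt Z w)) ∧
    -- the dimension spectrum
    dimSpectrum (psi0 q) = {1, 2, 3} ∧
    dimSpectrum (psi0P q) = {1, 2, 3} ∧
    -- the symbol map and its extension exist and are unique
    (∃! ρ : algB q →ₐ[ℂ] SymbolAlg q, IsSymbolMap q ρ) ∧
    ∀ ρ : algB q →ₐ[ℂ] SymbolAlg q, IsSymbolMap q ρ →
      -- the residues for `T` in the algebra `ℬ`
      (∀ T : algB q,
        HasNcint (T * absDiracPow (-3))
          (2 * tens (tau1 q 1) (tau1 q (-1)) (rZero q (ρ T))) ∧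
        HasNcint (T * absDiracPow (-2))
          ((tens (tau1 q 1) (tau0Up q (-1) + tau0Dn q (-1)) +
            tens (tau0Up q 1 + tau0Dn q 1) (tau1 q (-1))) (rZero q (ρ T))) ∧
        HasNcint (T * absDiracPow (-1))
          ((tens (tau0Up q 1) (tau0Dn q (-1)) +
            tens (tau0Dn q 1) (tau0Up q (-1))) (rZero q (ρ T)))) ∧
      (∃! R : psi0P q →ₐ[ℂ] (Spin → SymbolAlg q), IsExtendedSymbolMap q ρ R) ∧
      -- the residues for all `T` in `Ψ⁰` (with `P^↑` adjoined)
      ∀ R : psi0P q →ₐ[ℂ] (Spin → SymbolAlg q), IsExtendedSymbolMap q ρ R → ∀ T : psi0P q,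
        HasNcint (T * absDiracPow (-3))
          (tens (tau1 q 1) (tau1 q (-1)) (rZero q (R T .up)) +
            tens (tau1 q 1) (tau1 q (-1)) (rZero q (R T .dn))) ∧
        HasNcint (T * absDiracPow (-2))
          ((tens (tau1 q 1) (tau0Dn q (-1)) + tens (tau0Up q 1) (tau1 q (-1)))
              (rZero q (R T .up)) +
            (tens (tau1 q 1) (tau0Up q (-1)) + tens (tau0Dn q 1) (tau1 q (-1)))
              (rZero q (R T .dn))) ∧
        HasNcint (T * absDiracPow (-1))
          (tens (tau0Up q 1) (tau0Dn q (-1)) (rZero q (R T .up)) +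
            tens (tau0Dn q 1) (tau0Up q (-1)) (rZero q (R T .dn))) := by
  refine ⟨fun T hT => exists_zeta_order (symR_mem ⟨T, hT⟩),
    dimSpectrum_eq (algB_le_psi0 q) (psi0_le_psi0P q),
    dimSpectrum_eq (algB_le_psi0P q) le_rfl,
    ⟨symRho q, isSymbolMap_symRho q, fun ρ h => isSymbolMap_unique h (isSymbolMap_symRho q)⟩,
    fun ρ hρ => ?_⟩
  obtain rfl : ρ = symRho q := isSymbolMap_unique hρ (isSymbolMap_symRho q)
  have hext : ∀ R, IsExtendedSymbolMap q (symRho q) R → R = symR q := fun R hR =>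
    isExtendedSymbolMap_unique hR (isExtendedSymbolMap_symR q)
  refine ⟨fun T => ?_, ⟨symR q, isExtendedSymbolMap_symR q, hext⟩, fun R hR T => ?_⟩
  · exact hasNcint_of_const (mem_symbolGraph_symRho T)
  · obtain rfl := hext R hR
    exact hasNcint_of_mem_symbolGraph (symR_mem T)
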